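/- **Setting.** There are $m$ agents; agent $i$ has a random vector $\xi_i\in\mathbb R^d$, a sampled objective $f_i(x,\xi_i)\in\mathbb R$ and a sampled mapping $F_i(x,\xi_i)\in\mathbb R^n$, $x\in\mathbb R^n$. Put $f_i(x)=\mathbb E[f_i(x,\xi_i)]$, $F_i(x)=\mathbb E[F_i(x,\xi_i)]$, $f=\sum_i f_i$, $F=\sum_i F_i$, and $\mathrm{SOL}(\mathbb R^n,F)=\{x: F(x)^\top(y-x)\ge 0\ \forall y\in\mathbb R^n\}$, assumed nonempty. The problem is $\min f(x)$ subject to $x\in\mathrm{SOL}(\mathbb R^n,F)$. Assume: $\nabla f$ is $\mu_f$-strongly monotone, each $\nabla f_i$ is $L_f$-Lipschitz, $F$ is monotone, each $F_i$ is $L_F$-Lipschitz ($\mu_f,L_f,L_F>0$); $\mathbb E[\nabla f_i(x,\xi_i)]=\nabla f_i(x)$, $\mathbb E\|\nabla f_i(x,\xi_i)-\nabla f_i(x)\|^2\le\nu_f^2$ and $\mathbb E\|F_i(x,\xi_i)-F_i(x)\|^2\le\nu_F^2$ for all $x$. The matrix $W\in\mathbb R^{m\times m}$ is doubly stochastic with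 positive diagonal, and its off-diagonal support is the edge set of a connected undirected graph; $\rho_W$ is the spectral norm of $W-\frac1m\mathbf 1\mathbf 1^\top$, and $\|W-I\|$ is a Frobenius norm. **Method (IR-DSGT).** With independent samples $\xi_{i,k}$ distributed as $\xi_i$, independent of the square-integrable (e.g. deterministic) initial points $x_{i,0}$, let $\tilde G_{i,k}(x)=F_i(x,\xi_{i,k})+\lambda_k\nabla f_i(x,\xi_{i,k})$, $y_{i,0}=\tilde G_{i,0}(x_{i,0})$, $$x_{i,k+1}=\sum_j W_{ij}(x_{j,k}-\gamma_k y_{j,k}),\qquad y_{i,k+1}=\sum_j W_{ij}y_{j,k}+\tilde G_{i,k+1}(x_{i,k+1})-\tilde G_{i,k}(x_{i,k}).$$ Here $\gamma_k=\gamma/(k+\Gamma)^a$, $\lambda_k=\lambda/(k+\Gamma)^b$ with $\gamma,\lambda>0$, $\Gamma\ge1$, $a>b>0$, $3a+b<2$, and $$\Gamma\ge\max\Big\{\big(\tfrac{\mu_f\gamma\lambda}2\big)^{\frac1{a+b}},\big(\tfrac{\lambda L_f}{L_F}\big)^{\frac1b},(2\gamma L_F)^{\frac1a},\big(4\gamma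 L_F\zeta^{-1}\sqrt{1+\zeta}\big)^{\frac1a}\Big\},\qquad 0<\zeta\le\tfrac{1-\rho_W^2}{4\rho_W^2}$$ (no upper bound on $\zeta$ if $\rho_W=0$). Let $\bar x_k,\bar y_k$ be the averages over the agents, $\mathbf x_k,\mathbf y_k$ the matrices with rows $x_{i,k},y_{i,k}$, $L_k=L_F+\lambda_kL_f$, $\Lambda_k=|1-\lambda_{k+1}/\lambda_k|$, $x^*_{\lambda}$ the unique solution of $\mathrm{VI}(\mathbb R^n,F+\lambda\nabla f)$ for $\lambda>0$, $x^*$ the unique optimal solution of the problem (both exist), and $$e_{1,k}=\mathbb E\|\bar x_k-x^*_{\lambda_{k-1}}\|^2,\quad e_{2,k}=\mathbb E\|\mathbf x_k-\mathbf 1\bar x_k\|^2,\quad e_{3,k}=\mathbb E\|\mathbf y_k-\mathbf 1\bar y_k\|^2,$$ where $\lambda_{-1}=\lambda/(\Gamma-1)^b$; all statements below that involve $e_{1,0}$ are made for $\Gamma>1$. **Theorem.** For every $R$, for all sufficiently large $M,B_F>0$ and for some $c>0$ (the thresholds for $M,B_F$ and the constant $c$ depend on the problem, $W$, the parameters and $R$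 only), $M$ satisfies $\|x^*_{\lambda_k}-x^*_{\lambda_{k-1}}\|\le\frac M{\mu_f}\Lambda_{k-1}$ for $k\ge1$, $B_F$ satisfies $L_F\|\mathbf 1x^*_{\lambda_k}-\mathbf 1x^*\|\le B_F$ for $k\ge0$, and the following holds for every run with $\sum_i\mathbb E\|x_{i,0}\|^2\le R$; all expectations are finite. (a) For all $k\ge0$, $$e_{1,k+1}\le(1-\theta_1\gamma_k\lambda_k)e_{1,k}+\theta_2e_{2,k}+\theta_3\gamma_k^2,\quad e_{2,k+1}\le(1-\theta_4)e_{2,k}+\theta_5\gamma_k^2e_{3,k},\quad e_{3,k+1}\le(1-\theta_6)e_{3,k}+\theta_7e_{1,k}+\theta_8e_{2,k}+\theta_9,$$ where $\theta_1=\frac{\mu_f}2$, $\theta_2=\frac{L_0^2\gamma_0(1+\mu_f\lambda\gamma)}{m\lambda_0\mu_f}$, $\theta_3=\frac{2(\nu_F^2\Gamma^{2b}+\lambda^2\nu_f^2)}{m\Gamma^{2b}}+\frac{2M^2}{\mu_f^3\lambda\gamma^3\Gamma^{2-3a-b}}$, $\theta_4=\frac{1-\rho_W^2}2$, $\theta_5=\frac{(1+\rho_W^2)\rho_W^2}{1-\rho_W^2}$,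 $\theta_6=1-\big((1+\zeta^{-1})4L_0^2\gamma_0^2+\zeta+1\big)\rho_W^2$, $\theta_7=(1+\zeta^{-1})12mL_0^2(\frac4{\Gamma^2}+1)$, $\theta_8=(1+\zeta^{-1})4L_0^2\big(\frac{6L_0^2}{\Gamma^2}+\|W-I\|^2+\frac{1.5\gamma^2}{\Gamma^{2a}}\big)$, and, with $\nu^2=\nu_F^2+\frac{\lambda^2}{\Gamma^2}\nu_f^2$, $\theta_9=(1+\zeta^{-1})12\nu^2+(1+\zeta^{-1})\frac{6B_F^2}{\Gamma^2}+(8m+4)\nu^2+(1+\zeta^{-1})12mL_0^2\frac{M^2}{\mu_f^2}(\frac4{\Gamma^2}+1)\frac1{\Gamma^2}$. All $\theta_t$ are positive and $\theta_4,\theta_6<1$, except that $\theta_5=0$ and $\theta_6=1$ if $\rho_W=0$. (b) Suppose $\rho_W,e_{1,0},e_{2,0}>0$ and $\gamma\lambda>1/\theta_1$. Put $C_1=\theta_2e_{2,0}$, $C_2=\theta_3\gamma^2$, $C_3=(\gamma\lambda\theta_1-1)e_{1,0}$, $C_4=\frac{6\theta_9\theta_5\gamma^2}{e_{2,0}\theta_4\theta_6}$,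 $C_5=\frac{\theta_7e_{1,0}}{\theta_9}$, $C_6=\frac{\theta_8e_{2,0}}{\theta_9}$, $\mathsf n_1=\frac{2C_2}{C_3\Gamma^{a-b}-2C_1C_4C_5}$, $\mathsf n_2=\frac{2C_4C_5}{\Gamma^{2a}}\mathsf n_1$, $\mathsf n_3=\frac{C_5}{\Gamma^{2a}}\mathsf n_1$. If $\Gamma\ge(2C_4C_6)^{\frac1{2a}}$, $\Gamma>\big(\frac{2C_1C_4C_5}{C_3}\big)^{\frac1{a-b}}$ and $\Gamma\ge\frac1{1-(1-0.5\theta_4)^{1/(2a)}}-1$, then $\mathsf n_1,\mathsf n_2,\mathsf n_3>0$ and, for all $k\ge0$, $$e_{1,k}\le\frac{\Gamma^{a-b}e_{1,0}\mathsf n_1}{(k+\Gamma)^{a-b}},\qquad e_{2,k}\le\frac{\Gamma^{2a}e_{2,0}\mathsf n_2}{(k+\Gamma)^{2a}},\qquad e_{3,k}\le\Gamma^{2a}\frac{3\theta_9}{\theta_6}\mathsf n_3.$$ Moreover, without these additional conditions, $e_{1,k}\le\frac c{(k+\Gamma)^{a-b}}$, $e_{2,k}\le\frac c{(k+\Gamma)^{2a}}$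 and $e_{3,k}\le c$ for all $k\ge0$. (c) $\lim_{k\to\infty}\mathbb E\|\bar x_{k+1}-x^*\|^2=0$. -/

import Mathlib

open MeasureTheory ProbabilityTheory Filter Topology

noncomputable section

namespace IRDSGT

/-- Euclidean space of column vectors. -/
abbrev Vec (n : ℕ) : Type := EuclideanSpace ℝ (Fin n)

/-- Solution set of the variational inequality `VI(X, F)`. -/
def VISol {n : ℕ} (X : Set (Vec n)) (F : Vec n → Vec n) : Set (Vec n) :=
  {x | x ∈ X ∧ ∀ y ∈ X, 0 ≤ inner ℝ (F x) (y - x)}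

/-- Data of the stochastic VI-constrained problem
`min ∑ i, E[f i (x, ξ i)]` subject to `x ∈ SOL(ℝⁿ, ∑ i, E[F i (x, ξ i)])` with `m` agents.
The random vector `ξ i` of agent `i` has law `law i` on `ℝᵈ`. -/
structure Problem (m n d : ℕ) where
  /-- sampled local objectives `f i (x, s)` -/
  f : Fin m → Vec n → Vec d → ℝ
  /-- sampled local mappings `F i (x, s)` -/
  F : Fin m → Vec n → Vec d → Vec n
  /-- law of the random vector of each agent -/
  law : Fin m → Measure (Vec d)

namespace Problem

variable {m n d : ℕ} (D : Problem m n d)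

/-- Sampled gradient `∇ f i (x, s)` with respect to `x`. -/
def gradS (i : Fin m) (x : Vec n) (s : Vec d) : Vec n := gradient (fun z => D.f i z s) x

/-- Expected local objective. -/
def fLoc (i : Fin m) (x : Vec n) : ℝ := ∫ s, D.f i x s ∂(D.law i)

/-- Expected local mapping. -/
def FLoc (i : Fin m) (x : Vec n) : Vec n := ∫ s, D.F i x s ∂(D.law i)

/-- Global objective. -/
def fTot (x : Vec n) : ℝ := ∑ i, D.fLoc i x

/-- Global mapping. -/
def FTot (x : Vec n) : Vec n := ∑ i, D.FLoc i x

/-- Solution set of the constraint `VI(ℝⁿ, F)`. -/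
def sol : Set (Vec n) := VISol Set.univ D.FTot

/-- Set of optimal solutions of the VI-constrained problem. -/
def optSet : Set (Vec n) := {x | x ∈ D.sol ∧ ∀ y ∈ D.sol, D.fTot x ≤ D.fTot y}

/-- Solution set of the regularized problem `VI(ℝⁿ, F + l ∇f)`. -/
def regSol (l : ℝ) : Set (Vec n) :=
  VISol Set.univ (fun x => D.FTot x + l • gradient D.fTot x)

/-- The point `x*_l` of the Tikhonov trajectory, the solution of `VI(ℝⁿ, F + l ∇f)`. -/
def tik (l : ℝ) : Vec n := Classical.epsilon (fun x => x ∈ D.regSol l)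

end Problem

/-- All scalar constants and parameters: strong convexity modulus `μf`, Lipschitz constants
`Lf`, `LF`, standard deviation bounds `νf`, `νF`, and the parameters
`γ`, `lam`, `Γ`, `a`, `b`, `ζ` of the method and its analysis. -/
structure Par where
  μf : ℝ
  Lf : ℝ
  LF : ℝ
  νf : ℝ
  νF : ℝ
  γ : ℝ
  lam : ℝ
  Γ : ℝ
  a : ℝ
  b : ℝ
  ζ : ℝ

namespace Par

variable (p : Par)

/-- Stepsize `γ_t = γ / (t + Γ)^a`. -/
def step (t : ℝ) : ℝ := p.γ / (t + p.Γ) ^ p.a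

/-- Regularization parameter `λ_t = lam / (t + Γ)^b`; real `t`, so that `t = k - 1` is literal. -/
def reg (t : ℝ) : ℝ := p.lam / (t + p.Γ) ^ p.b

/-- `L_t = L_F + λ_t L_f`. -/
def L (t : ℝ) : ℝ := p.LF + p.reg t * p.Lf

/-- `Λ_t = |1 - λ_{t+1} / λ_t|`. -/
def Lam (t : ℝ) : ℝ := |1 - p.reg (t + 1) / p.reg t|

end Par

/-- The standing assumptions on the problem. -/
structure Problem.Assumptions {m n d : ℕ} (D : Problem m n d) (p : Par) : Prop where
  μf_pos : 0 < p.μf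
  Lf_pos : 0 < p.Lf
  LF_pos : 0 < p.LF
  νf_nonneg : 0 ≤ p.νf
  νF_nonneg : 0 ≤ p.νF
  prob : ∀ i, IsProbabilityMeasure (D.law i)
  -- regularity of the sampled objects
  diff_sample : ∀ i s, Differentiable ℝ (fun x => D.f i x s)
  integrable_f : ∀ i x, Integrable (D.f i x) (D.law i)
  meas_grad : ∀ i, Measurable (fun q : Vec n × Vec d => D.gradS i q.1 q.2)
  meas_F : ∀ i, Measurable (fun q : Vec n × Vec d => D.F i q.1 q.2)
  -- smoothness of the local objectives, strong convexity of the global one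
  diff_f : ∀ i, Differentiable ℝ (D.fLoc i)
  smooth_f : ∀ i x y,
    ‖gradient (D.fLoc i) x - gradient (D.fLoc i) y‖ ≤ p.Lf * ‖x - y‖
  strong_f : ∀ x y, p.μf * ‖x - y‖ ^ 2 ≤
    inner ℝ (gradient D.fTot x - gradient D.fTot y) (x - y)
  -- Lipschitz local mappings, merely monotone global mapping
  lip_F : ∀ i x y, ‖D.FLoc i x - D.FLoc i y‖ ≤ p.LF * ‖x - y‖
  mono_F : ∀ x y, 0 ≤ inner ℝ (D.FTot x - D.FTot y) (x - y)
  -- stochastic oracle: unbiased, with bounded variance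
  memLp_grad : ∀ i x, MemLp (D.gradS i x) 2 (D.law i)
  memLp_F : ∀ i x, MemLp (D.F i x) 2 (D.law i)
  unbiased_grad : ∀ i x, ∫ s, D.gradS i x s ∂(D.law i) = gradient (D.fLoc i) x
  unbiased_F : ∀ i x, ∫ s, D.F i x s ∂(D.law i) = D.FLoc i x
  var_grad : ∀ i x,
    ∫ s, ‖D.gradS i x s - gradient (D.fLoc i) x‖ ^ 2 ∂(D.law i) ≤ p.νf ^ 2
  var_F : ∀ i x, ∫ s, ‖D.F i x s - D.FLoc i x‖ ^ 2 ∂(D.law i) ≤ p.νF ^ 2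

/-- `W` is a doubly stochastic weight matrix with positive diagonal, and its off-diagonal
support is the edge set of the connected undirected graph `G`. -/
structure IsWeight {m : ℕ} (G : SimpleGraph (Fin m)) (W : Matrix (Fin m) (Fin m) ℝ) : Prop where
  stochastic : W ∈ doublyStochastic ℝ (Fin m)
  diag_pos : ∀ i, 0 < W i i
  adj_iff : ∀ i j, i ≠ j → (G.Adj i j ↔ 0 < W i j)
  connected : G.Connected

/-- Spectral norm of `W - (1/m) 1 1ᵀ`. -/
def rho {m : ℕ} (W : Matrix (Fin m) (Fin m) ℝ) : ℝ :=
  ‖Matrix.toEuclideanCLM (n := Fin m) (𝕜 := ℝ) (W - Matrix.of (fun _ _ => 1 / (m : ℝ)))‖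

/-- Squared Frobenius norm of a matrix. -/
def frobSq {m : ℕ} (A : Matrix (Fin m) (Fin m) ℝ) : ℝ := ∑ i, ∑ j, A i j ^ 2

/-- The conditions on the parameters. -/
structure Par.Valid (p : Par) {m : ℕ} (W : Matrix (Fin m) (Fin m) ℝ) : Prop where
  γ_pos : 0 < p.γ
  lam_pos : 0 < p.lam
  one_le_Γ : 1 ≤ p.Γ
  b_pos : 0 < p.b
  b_lt_a : p.b < p.a
  exponents : 3 * p.a + p.b < 2
  ζ_pos : 0 < p.ζ
  -- for `rho W = 0` the upper bound on `ζ` is `+∞`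
  ζ_le : 0 < rho W → p.ζ ≤ (1 - rho W ^ 2) / (4 * rho W ^ 2)
  Γ_ge₁ : (p.μf * p.γ * p.lam / 2) ^ (1 / (p.a + p.b)) ≤ p.Γ
  Γ_ge₂ : (p.lam * p.Lf / p.LF) ^ (1 / p.b) ≤ p.Γ
  Γ_ge₃ : (2 * p.γ * p.LF) ^ (1 / p.a) ≤ p.Γ
  Γ_ge₄ : (4 * p.γ * p.LF * p.ζ⁻¹ * √(1 + p.ζ)) ^ (1 / p.a) ≤ p.Γ

section Algorithm

variable {m n d : ℕ}

/-- Sampled regularized map of agent `i` at iteration `k`. -/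
def gMap (D : Problem m n d) (p : Par) (k : ℕ) (i : Fin m) (x : Vec n) (s : Vec d) : Vec n :=
  D.F i x s + p.reg k • D.gradS i x s

/-- IR-DSGT along one sample path `s k i`, from the initial points `x0 i`:
the pair of local copies `x_{i,k}` and trackers `y_{i,k}`. -/
def iter (D : Problem m n d) (p : Par) (W : Matrix (Fin m) (Fin m) ℝ)
    (x0 : Fin m → Vec n) (s : ℕ → Fin m → Vec d) : ℕ → (Fin m → Vec n) × (Fin m → Vec n)
  | 0 => (x0, fun i => gMap D p 0 i (x0 i) (s 0 i))
  | k + 1 =>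
    let x := (iter D p W x0 s k).1
    let y := (iter D p W x0 s k).2
    let x' : Fin m → Vec n := fun i => ∑ j, W i j • (x j - p.step k • y j)
    (x', fun i => ∑ j, W i j • y j + gMap D p (k + 1) i (x' i) (s (k + 1) i)
        - gMap D p k i (x i) (s k i))

/-- Average of the agents' vectors. -/
def avg (x : Fin m → Vec n) : Vec n := (1 / (m : ℝ)) • ∑ i, x i

/-- Squared Frobenius norm `‖x - 1 x̄‖²`. -/
def disagreement (x : Fin m → Vec n) : ℝ := ∑ i, ‖x i - avg x‖ ^ 2

/-- A run of the method on a probability space: square-integrable random (in particular, any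
deterministic) initial points, and samples `ξ k i` with law `D.law i` that are independent
over all agents and iterations and independent of the initial points. -/
structure Run (D : Problem m n d) {Ω : Type*} [MeasurableSpace Ω] (P : Measure Ω) where
  x0 : Fin m → Ω → Vec n
  ξ : ℕ → Fin m → Ω → Vec d
  meas_x0 : ∀ i, Measurable (x0 i)
  memLp_x0 : ∀ i, MemLp (x0 i) 2 P
  meas_ξ : ∀ k i, Measurable (ξ k i)
  law_ξ : ∀ k i, P.map (ξ k i) = D.law i
  indep : iIndepFun (fun (q : ℕ × Fin m) => ξ q.1 q.2) P
  indep_x0 : IndepFun (fun ω i => x0 i ω) (fun ω (q : ℕ × Fin m) => ξ q.1 q.2 ω) P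

namespace Run

variable {D : Problem m n d} {Ω : Type*} [MeasurableSpace Ω] {P : Measure Ω}
variable (r : Run D P) (p : Par) (W : Matrix (Fin m) (Fin m) ℝ)

/-- The random local copies `x_k`. -/
def x (k : ℕ) (ω : Ω) : Fin m → Vec n :=
  (iter D p W (fun i => r.x0 i ω) (fun k i => r.ξ k i ω) k).1

/-- The random trackers `y_k`. -/
def y (k : ℕ) (ω : Ω) : Fin m → Vec n :=
  (iter D p W (fun i => r.x0 i ω) (fun k i => r.ξ k i ω) k).2

/-- `e_{1,k} = E‖x̄_k - x*_{λ_{k-1}}‖²`. -/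
def e1 (k : ℕ) : ℝ := ∫ ω, ‖avg (r.x p W k ω) - D.tik (p.reg ((k : ℝ) - 1))‖ ^ 2 ∂P

/-- `e_{2,k} = E‖x_k - 1 x̄_k‖²`. -/
def e2 (k : ℕ) : ℝ := ∫ ω, disagreement (r.x p W k ω) ∂P

/-- `e_{3,k} = E‖y_k - 1 ȳ_k‖²`. -/
def e3 (k : ℕ) : ℝ := ∫ ω, disagreement (r.y p W k ω) ∂P

end Run

end Algorithm

section Constants

variable (p : Par) {m : ℕ} (W : Matrix (Fin m) (Fin m) ℝ) (M B : ℝ)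

def θ₁ : ℝ := 0.5 * p.μf

def θ₂ (m : ℕ) : ℝ :=
  p.L 0 ^ 2 * p.step 0 * (1 + p.μf * p.lam * p.γ) / (m * p.reg 0 * p.μf)

def θ₃ (m : ℕ) : ℝ :=
  2 * (p.νF ^ 2 * p.Γ ^ (2 * p.b) + p.lam ^ 2 * p.νf ^ 2) / (m * p.Γ ^ (2 * p.b))
    + 2 * M ^ 2 / (p.μf ^ 3 * p.lam * p.γ ^ 3 * p.Γ ^ (2 - 3 * p.a - p.b))

def θ₄ : ℝ := (1 - rho W ^ 2) / 2

def θ₅ : ℝ := (1 + rho W ^ 2) * rho W ^ 2 / (1 - rho W ^ 2)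

def θ₆ : ℝ :=
  1 - ((1 + p.ζ⁻¹) * (4 * p.L 0 ^ 2 * p.step 0 ^ 2) + p.ζ + 1) * rho W ^ 2

def θ₇ (m : ℕ) : ℝ := (1 + p.ζ⁻¹) * 12 * m * p.L 0 ^ 2 * (4 / p.Γ ^ 2 + 1)

def θ₈ : ℝ :=
  (1 + p.ζ⁻¹) * 4 * p.L 0 ^ 2 *
    (6 * (1 / p.Γ ^ 2) * p.L 0 ^ 2 + frobSq (W - 1) + 1.5 * (p.γ ^ 2 / p.Γ ^ (2 * p.a)))

def θ₉ (m : ℕ) : ℝ :=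
  (1 + p.ζ⁻¹) * 12 * (p.νF ^ 2 + p.lam ^ 2 / p.Γ ^ 2 * p.νf ^ 2)
    + (1 + p.ζ⁻¹) * 6 * (1 / p.Γ ^ 2) * B ^ 2
    + 4 * m * (p.νF ^ 2 + p.lam ^ 2 / p.Γ ^ 2 * p.νf ^ 2)
    + 4 * m * (p.νF ^ 2 + p.lam ^ 2 / p.Γ ^ 2 * p.νf ^ 2)
    + 4 * (p.νF ^ 2 + p.lam ^ 2 / p.Γ ^ 2 * p.νf ^ 2)
    + (1 + p.ζ⁻¹) * 12 * m * p.L 0 ^ 2 * (M ^ 2 / p.μf ^ 2) * (4 / p.Γ ^ 2 + 1) * (1 / p.Γ ^ 2)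

/-! In the following, `e10` and `e20` stand for `e_{1,0}` and `e_{2,0}`. -/

variable (e10 e20 : ℝ)

def C₁ (m : ℕ) : ℝ := θ₂ p m * e20

def C₂ (m : ℕ) : ℝ := θ₃ p M m * p.γ ^ 2

def C₃ : ℝ := (p.γ * p.lam * θ₁ p - 1) * e10

def C₄ : ℝ := 6 * θ₉ p M B m * θ₅ W * p.γ ^ 2 / (e20 * θ₄ W * θ₆ p W)

def C₅ (m : ℕ) : ℝ := θ₇ p m * e10 / θ₉ p M B m

def C₆ : ℝ := θ₈ p W * e20 / θ₉ p M B m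

def n₁ : ℝ :=
  2 * C₂ p M m /
    (C₃ p e10 * p.Γ ^ (p.a - p.b) - 2 * C₁ p e20 m * C₄ p W M B e20 * C₅ p M B e10 m)

def n₂ : ℝ :=
  2 * C₄ p W M B e20 * C₅ p M B e10 m / p.Γ ^ (2 * p.a) * n₁ p W M B e10 e20

def n₃ : ℝ := C₅ p M B e10 m / p.Γ ^ (2 * p.a) * n₁ p W M B e10 e20

def eHat₁ : ℝ := p.Γ ^ (p.a - p.b) * e10 * n₁ p W M B e10 e20

def eHat₂ : ℝ := p.Γ ^ (2 * p.a) * e20 * n₂ p W M B e10 e20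

def eHat₃ : ℝ := p.Γ ^ (2 * p.a) * (3 * θ₉ p M B m / θ₆ p W) * n₃ p W M B e10 e20

/-- The additional conditions on `γ`, `λ` and `Γ` for the explicit error bounds. The initial
errors and `rho W` have to be nonzero and the second lower bound on `Γ` strict, since otherwise
one of the scalars above has a zero denominator or fails to be positive. -/
structure BoundCond : Prop where
  e10_pos : 0 < e10
  e20_pos : 0 < e20
  rho_pos : 0 < rho W
  γlam : 1 / θ₁ p < p.γ * p.lam
  Γ_ge₁ : (2 * C₄ p W M B e20 * C₆ p W M B e20) ^ (1 / (2 * p.a)) ≤ p.Γ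
  Γ_gt₂ : (2 * C₁ p e20 m * C₄ p W M B e20 * C₅ p M B e10 m / C₃ p e10)
    ^ (1 / (p.a - p.b)) < p.Γ
  Γ_ge₃ : 1 / (1 - (1 - 0.5 * θ₄ W) ^ (1 / (2 * p.a))) - 1 ≤ p.Γ

end Constants

/-! The three conclusions about one run. -/

section Conclusions

variable {m n d : ℕ} {D : Problem m n d} {Ω : Type*} [MeasurableSpace Ω] {P : Measure Ω}

/-- The three coupled recursions at every iteration `k ≥ 0`. For `k = 0` the error `e_{1,0}`
involves `λ_{-1} = lam / (Γ - 1)^b`, which exists only for `Γ > 1`. -/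
def Run.Recursions (r : Run D P) (p : Par) (W : Matrix (Fin m) (Fin m) ℝ) (M B : ℝ) : Prop :=
  ∀ k : ℕ,
    ((k = 0 → 1 < p.Γ) →
      r.e1 p W (k + 1) ≤ (1 - θ₁ p * p.step k * p.reg k) * r.e1 p W k
        + θ₂ p m * r.e2 p W k + θ₃ p M m * p.step k ^ 2) ∧
    r.e2 p W (k + 1) ≤ (1 - θ₄ W) * r.e2 p W k + θ₅ W * p.step k ^ 2 * r.e3 p W k ∧
    ((k = 0 → 1 < p.Γ) →
      r.e3 p W (k + 1) ≤ (1 - θ₆ p W) * r.e3 p W k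
        + θ₇ p m * r.e1 p W k + θ₈ p W * r.e2 p W k + θ₉ p M B m)

/-- The explicit error bounds, together with positivity of the scalars in them. -/
def Run.ExplicitBounds (r : Run D P) (p : Par) (W : Matrix (Fin m) (Fin m) ℝ) (M B : ℝ) : Prop :=
  BoundCond p W M B (r.e1 p W 0) (r.e2 p W 0) →
    0 < n₁ p W M B (r.e1 p W 0) (r.e2 p W 0) ∧
    0 < n₂ p W M B (r.e1 p W 0) (r.e2 p W 0) ∧
    0 < n₃ p W M B (r.e1 p W 0) (r.e2 p W 0) ∧
    ∀ k : ℕ,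
      r.e1 p W k ≤ eHat₁ p W M B (r.e1 p W 0) (r.e2 p W 0) / (k + p.Γ) ^ (p.a - p.b) ∧
      r.e2 p W k ≤ eHat₂ p W M B (r.e1 p W 0) (r.e2 p W 0) / (k + p.Γ) ^ (2 * p.a) ∧
      r.e3 p W k ≤ eHat₃ p W M B (r.e1 p W 0) (r.e2 p W 0)

/-- The order of the three errors, with a constant `c`. -/
def Run.OrderBounds (r : Run D P) (p : Par) (W : Matrix (Fin m) (Fin m) ℝ) (c : ℝ) : Prop :=
  ∀ k : ℕ,
    ((k = 0 → 1 < p.Γ) → r.e1 p W k ≤ c / (k + p.Γ) ^ (p.a - p.b)) ∧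
    r.e2 p W k ≤ c / (k + p.Γ) ^ (2 * p.a) ∧
    r.e3 p W k ≤ c

end Conclusions

end IRDSGT

end

/-! The constants `M` and `B` are only required to be large, and they enter through `θ₃`, which is
at least `θ₃Coeff p * M ^ 2`, and `θ₉`, which is at least a multiple of `B ^ 2`. The quantitative
core is therefore a single order bound with a constant `c` depending on the run only through `R`
(`exists_orderBounds`): with t = k + Γ, e₁ is at most c t^(-(a-b)), e₂ at most c t^(-2a), e₃ at most
c. Given this, the rest is absorption. The e₃ recursion holds because `θ₉` alone exceeds c. The e₁
recursion holds because γ_k λ_k e₁ and e₂ are both O(t^(-2a)), hence bounded by a multiple of γ_k²,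
which `θ₃` dominates. In the explicit bounds `θ₉` and the initial errors cancel, and each bound
becomes a factor free of `M` and `B` times 2 θ₃ γ² / `denom`, so it exceeds c once `θ₃` is large.
Only the e₂ recursion is proved directly with its stated constants.

The order bound rests on cruder recursions valid for large k. Gradient tracking preserves averages,
so the mean iterate makes a stochastic step along (1/m)(F + λ_k ∇f). This map is strongly monotone
with modulus λ_k μ_f / m and vanishes at x*_{λ_k}; the sampling noise is orthogonal to the past.
Hence e₁ contracts by 1 - δ/2 with δ = γ_k λ_k μ_f / m, up to the motion of x*_λ, the disagreement
and a γ_k² noise term (`Run.e1_succ_le`). This factor carries a 1/m that the nominal `θ₁` lacks,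
which is why the nominal recursion is obtained by absorption. Gossip contracts disagreement because
the spectral norm `rho W` is below 1 on a connected graph (`IsWeight.rho_lt_one`). For e₃
boundedness suffices, so increments of the sampled maps are estimated by plain second moments.
`coupled_decay` turns these inequalities into rates, and the finitely many early iterations are
covered by `Run.exists_moment_bound`.

Strong monotonicity of ∇f controls the Tikhonov path: it is bounded, moves by O(1/t) per iteration,
and converges to the optimal solution. This convergence and e₁ → 0 give (c). -/

noncomputable section

namespace IRDSGT

/-! ### Monotone maps and Tikhonov regularization in a Hilbert space. -/

section Monotone

variable {E : Type*} [NormedAddCommGroup E] [InnerProductSpace ℝ E]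

/-- A Lipschitz strongly monotone map on a Hilbert space has a zero. -/
lemma exists_zero_of_strongly_monotone [CompleteSpace E] {T : E → E} {K μ : ℝ} (hμ : 0 < μ)
    (hK : 0 ≤ K) (hT : ∀ x y, ‖T x - T y‖ ≤ K * ‖x - y‖)
    (hm : ∀ x y, μ * ‖x - y‖ ^ 2 ≤ inner ℝ (T x - T y) (x - y)) : ∃ x, T x = 0 := by
  -- Enlarging the Lipschitz constant by `μ` guarantees μ ≤ L, so 1 - μ²/L² is nonnegative without
  -- comparing `K` with `μ`. The step μ/L² then makes x - τ T x a contraction.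
  set L := K + μ with hL
  have hLpos : 0 < L := by positivity
  set τ := μ / L ^ 2 with hτ
  have hτpos : 0 < τ := by positivity
  have hq : 0 ≤ 1 - μ ^ 2 / L ^ 2 := by
    rw [sub_nonneg, div_le_one (by positivity)]
    exact pow_le_pow_left₀ hμ.le (by linarith) 2
  have hq1 : 1 - μ ^ 2 / L ^ 2 < 1 := by
    have : 0 < μ ^ 2 / L ^ 2 := by positivity
    linarith
  obtain ⟨q, hqe⟩ : ∃ q : NNReal, (q : ℝ) = √(1 - μ ^ 2 / L ^ 2) :=
    ⟨Real.toNNReal (√(1 - μ ^ 2 / L ^ 2)), Real.coe_toNNReal _ (Real.sqrt_nonneg _)⟩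
  have hlip : LipschitzWith q (fun x => x - τ • T x) := by
    refine LipschitzWith.of_dist_le_mul fun x y => ?_
    rw [dist_eq_norm, dist_eq_norm, hqe]
    refine abs_le_of_sq_le_sq' ?_ (by positivity) |>.2
    rw [mul_pow, Real.sq_sqrt hq]
    have e : x - τ • T x - (y - τ • T y) = (x - y) - τ • (T x - T y) := by
      rw [smul_sub]; abel
    rw [e, norm_sub_sq_real, norm_smul, inner_smul_right, real_inner_comm, mul_pow,
      Real.norm_eq_abs, sq_abs]
    have h1 : ‖T x - T y‖ ^ 2 ≤ L ^ 2 * ‖x - y‖ ^ 2 := by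
      rw [← mul_pow]
      refine pow_le_pow_left₀ (norm_nonneg _) ((hT x y).trans ?_) 2
      gcongr; linarith
    have h2 : τ ^ 2 * ‖T x - T y‖ ^ 2 ≤ τ ^ 2 * (L ^ 2 * ‖x - y‖ ^ 2) := by gcongr
    have h3 : τ * (μ * ‖x - y‖ ^ 2) ≤ τ * inner ℝ (T x - T y) (x - y) :=
      mul_le_mul_of_nonneg_left (hm x y) hτpos.le
    have h4 : τ ^ 2 * (L ^ 2 * ‖x - y‖ ^ 2) = μ ^ 2 / L ^ 2 * ‖x - y‖ ^ 2 := by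
      rw [hτ]; field_simp
    have h5 : τ * (μ * ‖x - y‖ ^ 2) = μ ^ 2 / L ^ 2 * ‖x - y‖ ^ 2 := by
      rw [hτ]; field_simp
    linarith
  have hc : ContractingWith q (fun x => x - τ • T x) := by
    refine ⟨?_, hlip⟩
    rw [← NNReal.coe_lt_coe, hqe, NNReal.coe_one, Real.sqrt_lt' one_pos]
    simpa using hq1
  have hfix : hc.fixedPoint - τ • T hc.fixedPoint = hc.fixedPoint := hc.fixedPoint_isFixedPt
  exact ⟨hc.fixedPoint, (smul_eq_zero.1 (sub_eq_self.1 hfix)).resolve_left hτpos.ne'⟩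

lemma eq_of_strongly_monotone_of_zero {T : E → E} {μ : ℝ} (hμ : 0 < μ)
    (hm : ∀ x y, μ * ‖x - y‖ ^ 2 ≤ inner ℝ (T x - T y) (x - y)) {x y : E}
    (hx : T x = 0) (hy : T y = 0) : x = y := by
  have h := hm x y
  rw [hx, hy, sub_self, inner_zero_left] at h
  have h1 : ‖x - y‖ ^ 2 = 0 :=
    le_antisymm (by nlinarith [sq_nonneg ‖x - y‖]) (sq_nonneg _)
  exact sub_eq_zero.1 (norm_eq_zero.1 (pow_eq_zero_iff two_ne_zero |>.1 h1))

/-- Quadratic lower bound for a function with strongly monotone gradient. -/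
lemma quadratic_lower_bound [CompleteSpace E] {f : E → ℝ} {μ : ℝ} (hf : Differentiable ℝ f)
    (hm : ∀ x y, μ * ‖x - y‖ ^ 2 ≤ inner ℝ (gradient f x - gradient f y) (x - y)) (x y : E) :
    f x + inner ℝ (gradient f x) (y - x) + μ / 2 * ‖y - x‖ ^ 2 ≤ f y := by
  -- The function on the segment minus its linear part and the quadratic; strong monotonicity
  -- between x + t(y - x) and x makes the difference nondecreasing, so its values at 0 and 1 give
  -- the bound.
  set φ : ℝ → ℝ := fun t => f (x + t • (y - x)) - t * inner ℝ (gradient f x) (y - x)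
    - μ / 2 * t ^ 2 * ‖y - x‖ ^ 2 with hφ
  have hd : ∀ t : ℝ, HasDerivAt φ (inner ℝ (gradient f (x + t • (y - x))) (y - x)
      - inner ℝ (gradient f x) (y - x) - μ * t * ‖y - x‖ ^ 2) t := by
    intro t
    have h1 : HasDerivAt (fun t : ℝ => x + t • (y - x)) (y - x) t := by
      simpa using ((hasDerivAt_id t).smul_const (y - x)).const_add x
    have h2 := (hf (x + t • (y - x))).hasFDerivAt.comp_hasDerivAt t h1
    have h3 : HasDerivAt (fun t : ℝ => t * inner ℝ (gradient f x) (y - x))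
        (inner ℝ (gradient f x) (y - x)) t := by
      simpa using (hasDerivAt_id t).mul_const (inner ℝ (gradient f x) (y - x))
    have h4 : HasDerivAt (fun t : ℝ => μ / 2 * t ^ 2 * ‖y - x‖ ^ 2) (μ * t * ‖y - x‖ ^ 2) t := by
      have := ((hasDerivAt_pow 2 t).const_mul (μ / 2)).mul_const (‖y - x‖ ^ 2)
      refine this.congr_deriv ?_
      simp only [Nat.cast_ofNat, Nat.reduceSub, pow_one]; ring
    rw [inner_gradient_left]
    exact (h2.sub h3).sub h4
  have hmono : MonotoneOn φ (Set.Icc 0 1) := by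
    refine monotoneOn_of_deriv_nonneg (convex_Icc 0 1)
      (fun t _ => (hd t).continuousAt.continuousWithinAt)
      (fun t _ => (hd t).differentiableAt.differentiableWithinAt) fun t ht => ?_
    rw [interior_Icc] at ht
    rw [(hd t).deriv]
    have h := hm (x + t • (y - x)) x
    rw [add_sub_cancel_left, norm_smul, inner_smul_right, inner_sub_left, mul_pow,
      Real.norm_eq_abs, sq_abs] at h
    have : t * (μ * t * ‖y - x‖ ^ 2) ≤
      t * (inner ℝ (gradient f (x + t • (y - x))) (y - x) - inner ℝ (gradient f x) (y - x)) := by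
      linarith
    have := le_of_mul_le_mul_left this ht.1
    linarith
  have := hmono (Set.left_mem_Icc.2 zero_le_one) (Set.right_mem_Icc.2 zero_le_one) zero_le_one
  simp only [hφ, zero_smul, add_zero, zero_mul, one_smul, one_mul, add_sub_cancel, one_pow] at this
  linarith

/-- Points of the Tikhonov trajectory lie on the descent side of every solution. -/
lemma tikhonov_inner_nonpos {F g : E → E} (hF : ∀ x y, 0 ≤ inner ℝ (F x - F y) (x - y))
    {l : ℝ} (hl : 0 < l) {z y : E} (hz : F z + l • g z = 0) (hy : F y = 0) :
    inner ℝ (g z) (z - y) ≤ 0 := by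
  have h := hF z y
  rw [hy, sub_zero, eq_neg_of_add_eq_zero_left hz, inner_neg_left, inner_smul_left] at h
  simp only [conj_trivial] at h
  nlinarith

lemma tikhonov_sq_le {F g : E → E} {μ : ℝ} (hF : ∀ x y, 0 ≤ inner ℝ (F x - F y) (x - y))
    (hg : ∀ x y, μ * ‖x - y‖ ^ 2 ≤ inner ℝ (g x - g y) (x - y))
    {l : ℝ} (hl : 0 < l) {z y : E} (hz : F z + l • g z = 0) (hy : F y = 0) :
    μ * ‖z - y‖ ^ 2 ≤ - inner ℝ (g y) (z - y) := by
  have h1 := tikhonov_inner_nonpos hF hl hz hy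
  have h2 := hg z y
  rw [inner_sub_left] at h2
  linarith

/-- The bound does not involve `l`, so the whole Tikhonov path stays in one ball around any zero of
`F`. This is the source of compactness. -/
lemma tikhonov_norm_le {F g : E → E} {μ : ℝ} (hμ : 0 < μ)
    (hF : ∀ x y, 0 ≤ inner ℝ (F x - F y) (x - y))
    (hg : ∀ x y, μ * ‖x - y‖ ^ 2 ≤ inner ℝ (g x - g y) (x - y))
    {l : ℝ} (hl : 0 < l) {z y : E} (hz : F z + l • g z = 0) (hy : F y = 0) :
    ‖z - y‖ ≤ ‖g y‖ / μ := by
  have h1 := tikhonov_sq_le hF hg hl hz hy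
  have h2 : - inner ℝ (g y) (z - y) ≤ ‖g y‖ * ‖z - y‖ :=
    (neg_le_abs _).trans (abs_real_inner_le_norm _ _)
  rw [le_div_iff₀ hμ]
  rcases (norm_nonneg (z - y)).eq_or_lt with h0 | h0
  · rw [← h0]; simp
  · exact le_of_mul_le_mul_right (by nlinarith) h0

/-- Lipschitz dependence of the Tikhonov trajectory on the regularization parameter. -/
lemma tikhonov_dist_le {F g : E → E} {μ : ℝ} (hμ : 0 < μ)
    (hF : ∀ x y, 0 ≤ inner ℝ (F x - F y) (x - y))
    (hg : ∀ x y, μ * ‖x - y‖ ^ 2 ≤ inner ℝ (g x - g y) (x - y))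
    {l l' : ℝ} (hl : 0 < l) {z z' : E} (hz : F z + l • g z = 0)
    (hz' : F z' + l' • g z' = 0) : ‖z' - z‖ ≤ ‖g z'‖ / μ * |1 - l' / l| := by
  have h1 := hF z z'
  have h2 := mul_le_mul_of_nonneg_left (hg z z') hl.le
  -- Both zero equations are solved for `F`; the strongly monotone part is isolated at parameter
  -- `l`, and the mismatch l' - l multiplies only g z'.
  have e : F z - F z' = - (l • (g z - g z')) + (l' - l) • g z' := by
    rw [eq_neg_of_add_eq_zero_left hz, eq_neg_of_add_eq_zero_left hz']; module
  rw [e, inner_add_left, inner_neg_left, inner_smul_left, inner_smul_left] at h1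
  simp only [conj_trivial] at h1
  have h3 : (l' - l) * inner ℝ (g z') (z - z') ≤ |l' - l| * (‖g z'‖ * ‖z - z'‖) := by
    refine (le_abs_self _).trans ?_
    rw [abs_mul]
    exact mul_le_mul_of_nonneg_left (abs_real_inner_le_norm _ _) (abs_nonneg _)
  have h4 : |1 - l' / l| = |l' - l| / l := by
    rw [one_sub_div hl.ne', abs_div, abs_of_pos hl, abs_sub_comm]
  rw [h4, norm_sub_rev, div_mul_div_comm, le_div_iff₀ (by positivity)]
  rcases (norm_nonneg (z - z')).eq_or_lt with h0 | h0
  · rw [← h0, zero_mul]; positivity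
  · exact le_of_mul_le_mul_right (by nlinarith) h0

/-- The Tikhonov trajectory converges to a zero `x` of `F` that solves the variational inequality
of `g` on the zeros of `F`. -/
lemma exists_tikhonov_limit [ProperSpace E] {F g : E → E} {μ : ℝ} (hμ : 0 < μ)
    (hFc : Continuous F) (hgc : Continuous g)
    (hF : ∀ x y, 0 ≤ inner ℝ (F x - F y) (x - y))
    (hg : ∀ x y, μ * ‖x - y‖ ^ 2 ≤ inner ℝ (g x - g y) (x - y))
    {z : ℝ → E} (hz : ∀ l, 0 < l → F (z l) + l • g (z l) = 0) {y₀ : E} (hy₀ : F y₀ = 0) :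
    ∃ x, F x = 0 ∧ (∀ y, F y = 0 → inner ℝ (g x) (x - y) ≤ 0) ∧
      Tendsto z (𝓝[>] 0) (𝓝 x) := by
  -- Compactness gives cluster points along any positive sequence tending to 0. Passing to the limit
  -- in the zero equation, where the regularizing term vanishes, and in `tikhonov_inner_nonpos`
  -- identifies them.
  have hcl : ∀ u : ℕ → ℝ, (∀ k, 0 < u k) → Tendsto u atTop (𝓝 0) →
      ∃ x, F x = 0 ∧ (∀ y, F y = 0 → inner ℝ (g x) (x - y) ≤ 0) ∧
        ∃ φ : ℕ → ℕ, StrictMono φ ∧ Tendsto (fun k => z (u (φ k))) atTop (𝓝 x) := by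
    intro u hu hu0
    obtain ⟨x, -, φ, hφ, hx⟩ := (isCompact_closedBall y₀ (‖g y₀‖ / μ)).tendsto_subseq
      (x := fun k => z (u k)) (fun k => by
        rw [Metric.mem_closedBall, dist_eq_norm]
        exact tikhonov_norm_le hμ hF hg (hu k) (hz _ (hu k)) hy₀)
    refine ⟨x, ?_, fun y hy => ?_, φ, hφ, hx⟩
    · have h1 : Tendsto (fun k => F (z (u (φ k))) + u (φ k) • g (z (u (φ k)))) atTop
          (𝓝 (F x + (0 : ℝ) • g x)) :=
        ((hFc.tendsto x).comp hx).add
          ((hu0.comp hφ.tendsto_atTop).smul ((hgc.tendsto x).comp hx))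
      have h2 : (fun k => F (z (u (φ k))) + u (φ k) • g (z (u (φ k)))) = fun _ => 0 :=
        funext fun k => hz _ (hu _)
      rw [h2, zero_smul, add_zero] at h1
      exact (tendsto_nhds_unique tendsto_const_nhds h1).symm
    · have h1 : Tendsto (fun k => inner ℝ (g (z (u (φ k)))) (z (u (φ k)) - y)) atTop
          (𝓝 (inner ℝ (g x) (x - y))) :=
        ((hgc.tendsto x).comp hx).inner (hx.sub_const y)
      exact le_of_tendsto' h1 fun k => tikhonov_inner_nonpos hF (hu _) (hz _ (hu _)) hy
  obtain ⟨x, hx, hxv, -⟩ := hcl (fun k => 1 / ((k : ℝ) + 1)) (fun k => by positivity)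
    tendsto_one_div_add_atTop_nhds_zero_nat
  refine ⟨x, hx, hxv, ?_⟩
  refine tendsto_of_subseq_tendsto fun u hu => ?_
  rw [tendsto_nhdsWithin_iff] at hu
  obtain ⟨N, hN⟩ := eventually_atTop.1 hu.2
  -- The sequence is positive only eventually, hence the shift by `N`.
  obtain ⟨x', hx', hxv', φ, hφ, hl⟩ := hcl (fun k => u (k + N))
    (fun k => hN _ (by omega)) (hu.1.comp (tendsto_add_atTop_nat N))
  refine ⟨fun k => φ k + N, ?_⟩
  -- Each of the two points is tested in the variational inequality of the other; strong
  -- monotonicity of `g` leaves no distance between them.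
  have e : x' = x := by
    have h1 := hxv x' hx'
    have h2 := hxv' x hx
    have h3 := hg x' x
    rw [inner_sub_left] at h3
    have h4 : inner ℝ (g x) (x' - x) = - inner ℝ (g x) (x - x') := by
      rw [← inner_neg_right, neg_sub]
    have h5 : ‖x' - x‖ ^ 2 = 0 :=
      le_antisymm (by nlinarith [sq_nonneg ‖x' - x‖]) (sq_nonneg _)
    exact sub_eq_zero.1 (norm_eq_zero.1 (pow_eq_zero_iff two_ne_zero |>.1 h5))
  rw [← e]; exact hl

end Monotone

/-! ### Well-posedness of the regularized problems and of the optimal solution. -/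

namespace Problem

variable {m n d : ℕ} {D : Problem m n d} {p : Par}

/-- On the whole space the test point y = x - F x turns the inequality into -‖F x‖² ≥ 0. -/
lemma VISol_univ {F : Vec n → Vec n} {x : Vec n} : x ∈ VISol Set.univ F ↔ F x = 0 := by
  refine ⟨fun h => ?_, fun h => ⟨Set.mem_univ _, fun y _ => by rw [h, inner_zero_left]⟩⟩
  have := h.2 (x - F x) (Set.mem_univ _)
  rw [sub_sub_cancel_left, inner_neg_right, real_inner_self_eq_norm_sq] at this
  have h5 : ‖F x‖ ^ 2 = 0 := le_antisymm (by linarith) (sq_nonneg _)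
  exact norm_eq_zero.1 (pow_eq_zero_iff two_ne_zero |>.1 h5)

lemma mem_sol {x : Vec n} : x ∈ D.sol ↔ D.FTot x = 0 := VISol_univ

lemma mem_regSol {l : ℝ} {x : Vec n} :
    x ∈ D.regSol l ↔ D.FTot x + l • gradient D.fTot x = 0 := VISol_univ

namespace Assumptions

variable (hD : D.Assumptions p)
include hD

lemma hasGradientAt_fTot (x : Vec n) :
    HasGradientAt D.fTot (∑ i, gradient (D.fLoc i) x) x := by
  have h : ∀ i ∈ Finset.univ, HasFDerivAt (D.fLoc i) (fderiv ℝ (D.fLoc i) x) x :=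
    fun i _ => (hD.diff_f i x).hasFDerivAt
  rw [hasGradientAt_iff_hasFDerivAt, map_sum]
  simp only [toDual_gradient]
  exact HasFDerivAt.fun_sum h

lemma gradient_fTot (x : Vec n) : gradient D.fTot x = ∑ i, gradient (D.fLoc i) x :=
  (hD.hasGradientAt_fTot x).gradient

lemma differentiable_fTot : Differentiable ℝ D.fTot :=
  fun x => (hD.hasGradientAt_fTot x).differentiableAt

lemma norm_gradient_fTot_sub_le (x y : Vec n) :
    ‖gradient D.fTot x - gradient D.fTot y‖ ≤ m * p.Lf * ‖x - y‖ := by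
  rw [hD.gradient_fTot, hD.gradient_fTot, ← Finset.sum_sub_distrib]
  refine (norm_sum_le_of_le _ fun i _ => hD.smooth_f i x y).trans_eq ?_
  simp [mul_assoc]

lemma norm_FTot_sub_le (x y : Vec n) :
    ‖D.FTot x - D.FTot y‖ ≤ m * p.LF * ‖x - y‖ := by
  rw [FTot, FTot, ← Finset.sum_sub_distrib]
  refine (norm_sum_le_of_le _ fun i _ => hD.lip_F i x y).trans_eq ?_
  simp [mul_assoc]

lemma continuous_FTot : Continuous D.FTot := by
  refine (LipschitzWith.of_dist_le_mul (K := ⟨m * p.LF, ?_⟩) fun x y => ?_).continuous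
  · have := hD.LF_pos; positivity
  · rw [dist_eq_norm, dist_eq_norm]; exact hD.norm_FTot_sub_le x y

lemma continuous_gradient_fTot : Continuous (gradient D.fTot) := by
  refine (LipschitzWith.of_dist_le_mul (K := ⟨m * p.Lf, ?_⟩) fun x y => ?_).continuous
  · have := hD.Lf_pos; positivity
  · rw [dist_eq_norm, dist_eq_norm]; exact hD.norm_gradient_fTot_sub_le x y

lemma strongly_monotone_reg {l : ℝ} (hl : 0 < l) (x y : Vec n) :
    l * p.μf * ‖x - y‖ ^ 2 ≤ inner ℝ ((D.FTot x + l • gradient D.fTot x)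
      - (D.FTot y + l • gradient D.fTot y)) (x - y) := by
  have e : (D.FTot x + l • gradient D.fTot x) - (D.FTot y + l • gradient D.fTot y)
      = (D.FTot x - D.FTot y) + l • (gradient D.fTot x - gradient D.fTot y) := by module
  rw [e, inner_add_left, inner_smul_left]
  have h1 := hD.mono_F x y
  have h2 := mul_le_mul_of_nonneg_left (hD.strong_f x y) hl.le
  simp only [conj_trivial]
  linarith

lemma regSol_eq {l : ℝ} (hl : 0 < l) : D.regSol l = {D.tik l} := by
  have hLf := hD.Lf_pos
  have hLF := hD.LF_pos
  have hμ : 0 < l * p.μf := mul_pos hl hD.μf_pos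
  obtain ⟨x, hx⟩ := exists_zero_of_strongly_monotone
    (T := fun x => D.FTot x + l • gradient D.fTot x) (K := m * p.LF + l * (m * p.Lf)) hμ
    (by positivity) (fun x y => by
      have e : (D.FTot x + l • gradient D.fTot x) - (D.FTot y + l • gradient D.fTot y)
          = (D.FTot x - D.FTot y) + l • (gradient D.fTot x - gradient D.fTot y) := by module
      rw [e, add_mul, mul_assoc l]
      refine norm_add_le_of_le (hD.norm_FTot_sub_le x y) ?_
      rw [norm_smul, Real.norm_of_nonneg hl.le]
      gcongr
      exact hD.norm_gradient_fTot_sub_le x y)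
    (hD.strongly_monotone_reg hl)
  have ht : D.tik l ∈ D.regSol l := Classical.epsilon_spec ⟨x, mem_regSol.2 hx⟩
  refine Set.eq_singleton_iff_unique_mem.2 ⟨ht, fun y hy => ?_⟩
  exact eq_of_strongly_monotone_of_zero hμ (hD.strongly_monotone_reg hl) (mem_regSol.1 hy)
    (mem_regSol.1 ht)

lemma tik_spec {l : ℝ} (hl : 0 < l) : D.FTot (D.tik l) + l • gradient D.fTot (D.tik l) = 0 :=
  mem_regSol.1 (hD.regSol_eq hl ▸ Set.mem_singleton _)

/-- The optimal solution exists, is unique, and is the limit of the Tikhonov trajectory. -/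
lemma exists_optSet_eq (hsol : D.sol.Nonempty) :
    ∃ xs, D.optSet = {xs} ∧ D.FTot xs = 0 ∧ Tendsto D.tik (𝓝[>] 0) (𝓝 xs) := by
  obtain ⟨y₀, hy₀⟩ := hsol
  obtain ⟨x, hx, hxv, hlim⟩ := exists_tikhonov_limit hD.μf_pos hD.continuous_FTot
    hD.continuous_gradient_fTot hD.mono_F hD.strong_f (fun l hl => hD.tik_spec hl)
    (mem_sol.1 hy₀)
  -- First-order optimality on the zeros of F together with strong convexity gives quadratic growth,
  -- hence both optimality and uniqueness.
  have hq : ∀ y ∈ D.sol, D.fTot x + p.μf / 2 * ‖y - x‖ ^ 2 ≤ D.fTot y := by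
    intro y hy
    have h1 := quadratic_lower_bound hD.differentiable_fTot hD.strong_f x y
    have h2 := hxv y (mem_sol.1 hy)
    rw [← neg_sub y x, inner_neg_right] at h2
    linarith
  have hμ := hD.μf_pos
  refine ⟨x, Set.eq_singleton_iff_unique_mem.2 ⟨⟨mem_sol.2 hx, fun y hy => ?_⟩,
    fun z hz => ?_⟩, hx, hlim⟩
  · have := hq y hy
    have : 0 ≤ p.μf / 2 * ‖y - x‖ ^ 2 := by positivity
    linarith
  · have h1 := hq z hz.1
    have h2 := hz.2 x (mem_sol.2 hx)
    have h5 : ‖z - x‖ ^ 2 = 0 := le_antisymm (by nlinarith) (sq_nonneg _)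
    exact sub_eq_zero.1 (norm_eq_zero.1 (pow_eq_zero_iff two_ne_zero |>.1 h5))

/-- One constant serves every regularization parameter. The bound on the points enters the moment
estimates, the bound on the gradients the drift of the path. -/
lemma exists_norm_tik_le (hsol : D.sol.Nonempty) :
    ∃ T, 0 < T ∧ ∀ l, 0 < l → ‖D.tik l‖ ≤ T ∧ ‖gradient D.fTot (D.tik l)‖ ≤ T := by
  obtain ⟨y₀, hy₀⟩ := hsol
  have hLf := hD.Lf_pos
  have hμ := hD.μf_pos
  set r := ‖gradient D.fTot y₀‖ / p.μf with hr
  have hr0 : 0 ≤ r := by positivity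
  refine ⟨1 + (‖y₀‖ + r) + (‖gradient D.fTot y₀‖ + m * p.Lf * r), by positivity, fun l hl => ?_⟩
  have h1 := tikhonov_norm_le hD.μf_pos hD.mono_F hD.strong_f hl (hD.tik_spec hl)
    (mem_sol.1 hy₀)
  have h2 : ‖gradient D.fTot (D.tik l) - gradient D.fTot y₀‖ ≤ m * p.Lf * r :=
    (hD.norm_gradient_fTot_sub_le _ _).trans (by gcongr)
  have h3 := norm_le_norm_add_norm_sub' (D.tik l) y₀
  have h4 := norm_le_norm_add_norm_sub' (gradient D.fTot (D.tik l)) (gradient D.fTot y₀)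
  have h5 : 0 ≤ m * p.Lf * r := by positivity
  constructor <;> linarith [norm_nonneg y₀, norm_nonneg (gradient D.fTot y₀)]

lemma norm_tik_sub_le {T l l' : ℝ} (hl : 0 < l) (hl' : 0 < l')
    (hT : ‖gradient D.fTot (D.tik l')‖ ≤ T) :
    ‖D.tik l' - D.tik l‖ ≤ T / p.μf * |1 - l' / l| := by
  have hμ := hD.μf_pos
  refine (tikhonov_dist_le hD.μf_pos hD.mono_F hD.strong_f hl (hD.tik_spec hl)
    (hD.tik_spec hl')).trans ?_
  gcongr

end Assumptions

end Problem

section Mixing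

variable {m n : ℕ}

/-! ### Averages and disagreement -/

lemma avg_add (v w : Fin m → Vec n) : avg (fun i => v i + w i) = avg v + avg w := by
  simp [avg, Finset.sum_add_distrib]

lemma avg_sub (v w : Fin m → Vec n) : avg (fun i => v i - w i) = avg v - avg w := by
  simp [avg, Finset.sum_sub_distrib, smul_sub]

lemma avg_smul (c : ℝ) (v : Fin m → Vec n) : avg (fun i => c • v i) = c • avg v := by
  simp only [avg, ← Finset.smul_sum]; rw [smul_comm]

lemma sum_eq_smul_avg (hm : 0 < m) (v : Fin m → Vec n) : ∑ i, v i = (m : ℝ) • avg v := by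
  rw [avg, smul_smul, mul_one_div_cancel (by positivity), one_smul]

lemma sq_norm_sum_le {ι E : Type*} [Fintype ι] [SeminormedAddCommGroup E] (v : ι → E) :
    ‖∑ i, v i‖ ^ 2 ≤ Fintype.card ι * ∑ i, ‖v i‖ ^ 2 := by
  calc ‖∑ i, v i‖ ^ 2 ≤ (∑ i, ‖v i‖) ^ 2 := by gcongr; exact norm_sum_le _ _
    _ ≤ _ := by simpa using sq_sum_le_card_mul_sum_sq (s := Finset.univ) (f := fun i => ‖v i‖)

lemma sq_norm_avg_le (v : Fin m → Vec n) : ‖avg v‖ ^ 2 ≤ (1 / (m : ℝ)) * ∑ i, ‖v i‖ ^ 2 := by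
  rcases Nat.eq_zero_or_pos m with rfl | hm
  · simp [avg]
  rw [avg, norm_smul, mul_pow, Real.norm_eq_abs, sq_abs]
  have h := sq_norm_sum_le v
  rw [Fintype.card_fin] at h
  calc (1 / (m : ℝ)) ^ 2 * ‖∑ i, v i‖ ^ 2 ≤ (1 / (m : ℝ)) ^ 2 * (m * ∑ i, ‖v i‖ ^ 2) := by gcongr
    _ = _ := by field_simp

lemma disagreement_nonneg (v : Fin m → Vec n) : 0 ≤ disagreement v :=
  Finset.sum_nonneg fun _ _ => sq_nonneg _

/-- The deviations from the average sum to zero, so the cross term of the expansion vanishes. -/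
lemma sum_norm_sub_sq (hm : 0 < m) (v : Fin m → Vec n) (z : Vec n) :
    ∑ i, ‖v i - z‖ ^ 2 = disagreement v + m * ‖avg v - z‖ ^ 2 := by
  have h : ∀ i, ‖v i - z‖ ^ 2 = ‖v i - avg v‖ ^ 2 + 2 * inner ℝ (v i - avg v) (avg v - z)
      + ‖avg v - z‖ ^ 2 := fun i => by
    rw [← norm_add_sq_real, sub_add_sub_cancel]
  have h0 : ∑ i, (v i - avg v) = 0 := by
    rw [Finset.sum_sub_distrib, sum_eq_smul_avg hm]
    simp [← Nat.cast_smul_eq_nsmul ℝ]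
  simp only [h, Finset.sum_add_distrib, ← Finset.mul_sum, ← sum_inner, h0, inner_zero_left]
  simp [disagreement]

lemma disagreement_le_sum (v : Fin m → Vec n) : disagreement v ≤ ∑ i, ‖v i‖ ^ 2 := by
  rcases Nat.eq_zero_or_pos m with rfl | hm
  · simp [disagreement]
  have h := sum_norm_sub_sq hm v 0
  simp only [sub_zero] at h
  rw [h]
  have : 0 ≤ (m : ℝ) * ‖avg v‖ ^ 2 := by positivity
  linarith

/-- Young's inequality in the form (η‖x‖ - ‖y‖)² ≥ 0; the free `η` decides how much of a contraction
is spent on the perturbation. -/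
lemma sq_norm_add_le {E : Type*} [SeminormedAddCommGroup E] {η : ℝ} (hη : 0 < η) (x y : E) :
    ‖x + y‖ ^ 2 ≤ (1 + η) * ‖x‖ ^ 2 + (1 + η⁻¹) * ‖y‖ ^ 2 := by
  have h1 : ‖x + y‖ ^ 2 ≤ (‖x‖ + ‖y‖) ^ 2 := by gcongr; exact norm_add_le _ _
  have h2 : 0 ≤ η⁻¹ * (η * ‖x‖ - ‖y‖) ^ 2 := by positivity
  have h3 : η⁻¹ * (η * ‖x‖ - ‖y‖) ^ 2 = η * ‖x‖ ^ 2 - 2 * ‖x‖ * ‖y‖ + η⁻¹ * ‖y‖ ^ 2 := by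
    field_simp; ring
  linarith

lemma disagreement_add_le {η : ℝ} (hη : 0 < η) (v w : Fin m → Vec n) :
    disagreement (fun i => v i + w i) ≤ (1 + η) * disagreement v + (1 + η⁻¹) * disagreement w := by
  simp only [disagreement, avg_add, Finset.mul_sum]
  rw [← Finset.sum_add_distrib]
  refine Finset.sum_le_sum fun i _ => ?_
  rw [add_sub_add_comm]
  exact sq_norm_add_le hη _ _

lemma disagreement_smul (c : ℝ) (v : Fin m → Vec n) :
    disagreement (fun i => c • v i) = c ^ 2 * disagreement v := by
  simp only [disagreement, avg_smul, Finset.mul_sum, ← smul_sub, norm_smul, mul_pow,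
    Real.norm_eq_abs, sq_abs]

/-! ### The mixing matrix -/

/-- One gossip step. -/
def mix (W : Matrix (Fin m) (Fin m) ℝ) (v : Fin m → Vec n) : Fin m → Vec n :=
  fun i => ∑ j, W i j • v j

variable {W : Matrix (Fin m) (Fin m) ℝ} {G : SimpleGraph (Fin m)}

lemma rho_nonneg (W : Matrix (Fin m) (Fin m) ℝ) : 0 ≤ rho W := norm_nonneg _

lemma θ₄_lt_one (W : Matrix (Fin m) (Fin m) ℝ) : θ₄ W < 1 := by
  have := sq_nonneg (rho W); unfold θ₄; linarith

namespace IsWeight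

variable (hW : IsWeight G W)
include hW

lemma pos : 0 < m := by
  have := hW.connected.nonempty
  exact Fin.pos_iff_nonempty.2 this

lemma nonneg (i j : Fin m) : 0 ≤ W i j := (mem_doublyStochastic_iff_sum.1 hW.stochastic).1 i j

lemma row_sum (i : Fin m) : ∑ j, W i j = 1 := (mem_doublyStochastic_iff_sum.1 hW.stochastic).2.1 i

lemma col_sum (j : Fin m) : ∑ i, W i j = 1 := (mem_doublyStochastic_iff_sum.1 hW.stochastic).2.2 j

lemma avg_mix (v : Fin m → Vec n) : avg (mix W v) = avg v := by
  simp only [avg, mix]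
  rw [Finset.sum_comm]
  simp only [← Finset.sum_smul, hW.col_sum, one_smul]

/-- Variance identity for the probability weights in one row; it supplies Jensen's inequality
together with its equality case. -/
lemma sq_sum_eq (v : Fin m → ℝ) (i : Fin m) :
    ∑ j, W i j * (v j - ∑ k, W i k * v k) ^ 2
      = ∑ j, W i j * v j ^ 2 - (∑ j, W i j * v j) ^ 2 := by
  set c := ∑ k, W i k * v k with hc
  have : ∀ j, W i j * (v j - c) ^ 2 = W i j * v j ^ 2 - 2 * c * (W i j * v j) + c ^ 2 * W i j :=
    fun j => by ring
  simp only [this, Finset.sum_add_distrib, Finset.sum_sub_distrib, ← Finset.mul_sum,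
    hW.row_sum, ← hc]
  ring

lemma sq_sum_le (v : Fin m → ℝ) (i : Fin m) : (∑ j, W i j * v j) ^ 2 ≤ ∑ j, W i j * v j ^ 2 := by
  have := Finset.sum_nonneg (s := Finset.univ)
    (f := fun j => W i j * (v j - ∑ k, W i k * v k) ^ 2)
    fun j _ => mul_nonneg (hW.nonneg i j) (sq_nonneg _)
  rw [hW.sq_sum_eq] at this
  linarith

lemma sum_sum_sq (v : Fin m → ℝ) : ∑ i, ∑ j, W i j * v j ^ 2 = ∑ j, v j ^ 2 := by
  rw [Finset.sum_comm]
  simp only [← Finset.sum_mul, hW.col_sum, one_mul]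

/-- A vector whose norm is preserved by the mixing matrix is a consensus. -/
lemma eq_of_norm_le {v : Fin m → ℝ}
    (h : ∑ j, v j ^ 2 ≤ ∑ i, (∑ j, W i j * v j) ^ 2) (i j : Fin m) : v i = v j := by
  -- Column sums equal to 1 make the total of all row variances the loss of squared norm, which the
  -- hypothesis forces to be zero.
  have hz : ∑ i, ∑ j, W i j * (v j - ∑ k, W i k * v k) ^ 2 = 0 := by
    refine le_antisymm ?_ (Finset.sum_nonneg fun i _ => Finset.sum_nonneg fun j _ =>
      mul_nonneg (hW.nonneg i j) (sq_nonneg _))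
    simp only [hW.sq_sum_eq, Finset.sum_sub_distrib]
    rw [hW.sum_sum_sq]; linarith
  have hzero : ∀ i j, 0 < W i j → v j = ∑ k, W i k * v k := by
    intro i j hij
    have h1 := (Finset.sum_eq_zero_iff_of_nonneg (fun i _ => Finset.sum_nonneg fun j _ =>
      mul_nonneg (hW.nonneg i j) (sq_nonneg _))).1 hz i (Finset.mem_univ _)
    have h2 := (Finset.sum_eq_zero_iff_of_nonneg (fun j _ =>
      mul_nonneg (hW.nonneg i j) (sq_nonneg _))).1 h1 j (Finset.mem_univ _)
    have h3 := (mul_eq_zero.1 h2).resolve_left hij.ne'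
    exact sub_eq_zero.1 (pow_eq_zero_iff two_ne_zero |>.1 h3)
  -- The positive diagonal entry puts `v i` itself at the mean of row `i`, and the edge puts `v j`
  -- at the same mean. Connectedness then spreads the equality.
  have hadj : ∀ i j, G.Adj i j → v i = v j := fun i j hij => by
    rw [hzero i i (hW.diag_pos i), hzero i j ((hW.adj_iff i j hij.ne).1 hij)]
  obtain ⟨w⟩ := hW.connected.preconnected i j
  induction w with
  | nil => rfl
  | cons hij _ ih => exact (hadj _ _ hij).trans ih

/-- The matrix sends v to W(v - c1), with c the mean of v. Removing the mean and averaging by W both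
do not increase the norm; if neither decreases it, then v - c1 is a consensus and c = 0, so v is
constant with mean zero, that is v = 0. -/
lemma norm_toEuclideanCLM_lt {v : EuclideanSpace ℝ (Fin m)} (hv : v ≠ 0) :
    ‖Matrix.toEuclideanCLM (n := Fin m) (𝕜 := ℝ) (W - Matrix.of (fun _ _ => 1 / (m : ℝ))) v‖
      < ‖v‖ := by
  have hm : (0 : ℝ) < m := by exact_mod_cast hW.pos
  set c := (1 / (m : ℝ)) * ∑ j, v j with hc
  have hcoord : ∀ i, (Matrix.toEuclideanCLM (n := Fin m) (𝕜 := ℝ)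
      (W - Matrix.of (fun _ _ => 1 / (m : ℝ))) v) i = ∑ j, W i j * (v j - c) := by
    intro i
    rw [Matrix.ofLp_toEuclideanCLM]
    simp only [Matrix.mulVec, dotProduct, Matrix.sub_apply, Matrix.of_apply, sub_mul, mul_sub,
      Finset.sum_sub_distrib, ← Finset.mul_sum, ← Finset.sum_mul, hW.row_sum, one_mul, hc]
  have hsum : ∑ j, (v j - c) ^ 2 = ∑ j, v j ^ 2 - m * c ^ 2 := by
    have h1 : ∀ j, (v j - c) ^ 2 = v j ^ 2 - 2 * c * v j + c ^ 2 := fun j => by ring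
    have h2 : ∑ j, v j = m * c := by rw [hc]; field_simp
    simp only [h1, Finset.sum_add_distrib, Finset.sum_sub_distrib, ← Finset.mul_sum, h2]
    simp; ring
  refine lt_of_pow_lt_pow_left₀ 2 (norm_nonneg _) ?_
  rw [EuclideanSpace.real_norm_sq_eq, EuclideanSpace.real_norm_sq_eq]
  simp only [hcoord]
  have h1 : ∑ i, (∑ j, W i j * (v j - c)) ^ 2 ≤ ∑ j, (v j - c) ^ 2 := by
    rw [← hW.sum_sum_sq (fun j => v j - c)]
    exact Finset.sum_le_sum fun i _ => hW.sq_sum_le _ i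
  have h2 : 0 ≤ (m : ℝ) * c ^ 2 := by positivity
  by_contra! hcon
  have heq := hW.eq_of_norm_le (v := fun j => v j - c) (by linarith)
  have hc0 : c = 0 := by
    have : (m : ℝ) * c ^ 2 = 0 := le_antisymm (by linarith) h2
    exact pow_eq_zero_iff two_ne_zero |>.1 ((mul_eq_zero.1 this).resolve_left hm.ne')
  refine hv (PiLp.ext fun i => ?_)
  have h4 : ∀ j, v j = v i := fun j => by
    have := heq j i
    linarith
  have h5 : c = v i := by
    rw [hc]; simp only [h4]; simp; field_simp
  simpa [hc0] using h5.symm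

/-- In finite dimension the operator norm is controlled by the maximum on the compact unit sphere,
where the strict inequality holds pointwise. -/
lemma rho_lt_one : rho W < 1 := by
  set A := Matrix.toEuclideanCLM (n := Fin m) (𝕜 := ℝ) (W - Matrix.of (fun _ _ => 1 / (m : ℝ)))
    with hA
  have hcpt : IsCompact (Metric.sphere (0 : EuclideanSpace ℝ (Fin m)) 1) := isCompact_sphere _ _
  have hne : (Metric.sphere (0 : EuclideanSpace ℝ (Fin m)) 1).Nonempty :=
    ⟨EuclideanSpace.single ⟨0, hW.pos⟩ 1, by simp⟩
  obtain ⟨u, hu, hmax⟩ := hcpt.exists_isMaxOn hne (f := fun v => ‖A v‖) (by fun_prop)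
  have hu1 : ‖u‖ = 1 := by simpa using hu
  have hlt : ‖A u‖ < 1 := hu1 ▸ hW.norm_toEuclideanCLM_lt (by
    rintro rfl; simp at hu1)
  refine lt_of_le_of_lt ?_ hlt
  refine ContinuousLinearMap.opNorm_le_bound _ (norm_nonneg _) fun v => ?_
  rcases eq_or_ne v 0 with rfl | hv
  · simp
  have hv' : 0 < ‖v‖ := norm_pos_iff.2 hv
  have h := hmax (a := ‖v‖⁻¹ • v) (by simp [norm_smul, hv'.ne'])
  simp only [Set.mem_ofPred_eq, map_smul, norm_smul, norm_inv, norm_norm] at h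
  rwa [inv_mul_le_iff₀ hv', mul_comm] at h

/-- The deviations from the average have zero sum in every coordinate, so subtracting (1/m)11ᵀ does
not change the action of W on them; the operator norm bound is then applied coordinate by
coordinate. -/
lemma disagreement_mix_le (v : Fin m → Vec n) :
    disagreement (mix W v) ≤ rho W ^ 2 * disagreement v := by
  set u : Fin m → Vec n := fun i => v i - avg v with hu
  have hu0 : ∑ i, u i = 0 := by
    simp only [hu]
    rw [Finset.sum_sub_distrib, sum_eq_smul_avg hW.pos]
    simp [← Nat.cast_smul_eq_nsmul ℝ]
  have hmix : ∀ i, mix W v i - avg (mix W v) = mix W u i := fun i => by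
    rw [hW.avg_mix]
    simp only [mix, hu, smul_sub, Finset.sum_sub_distrib, ← Finset.sum_smul, hW.row_sum, one_smul]
  simp only [disagreement, hmix, EuclideanSpace.real_norm_sq_eq]
  rw [Finset.sum_comm, Finset.sum_comm (s := Finset.univ) (t := Finset.univ)
    (f := fun x x_1 => ((v x - avg v).ofLp x_1) ^ 2), Finset.mul_sum]
  refine Finset.sum_le_sum fun c _ => ?_
  set w : EuclideanSpace ℝ (Fin m) := WithLp.toLp 2 (fun i => u i c) with hw
  have h := ContinuousLinearMap.le_opNorm (Matrix.toEuclideanCLM (n := Fin m) (𝕜 := ℝ)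
    (W - Matrix.of (fun _ _ => 1 / (m : ℝ)))) w
  have h2 := pow_le_pow_left₀ (norm_nonneg _) h 2
  rw [mul_pow, EuclideanSpace.real_norm_sq_eq, EuclideanSpace.real_norm_sq_eq] at h2
  change _ ≤ rho W ^ 2 * _ at h2
  refine (Finset.sum_congr rfl fun i _ => ?_).trans_le h2
  congr 1
  rw [Matrix.ofLp_toEuclideanCLM]
  have h3 : ∑ j, (u j) c = 0 := by
    have := congrArg (fun z : Vec n => z c) hu0
    simpa using this
  simp only [Matrix.mulVec, dotProduct, Matrix.sub_apply, Matrix.of_apply, sub_mul,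
      Finset.sum_sub_distrib, ← Finset.mul_sum, hw, h3, mul_zero, sub_zero, mix]
  simp

lemma sum_norm_sq_mix_le (v : Fin m → Vec n) : ∑ i, ‖mix W v i‖ ^ 2 ≤ ∑ i, ‖v i‖ ^ 2 := by
  have h1 := sum_norm_sub_sq hW.pos (mix W v) 0
  have h2 := sum_norm_sub_sq hW.pos v 0
  simp only [sub_zero] at h1 h2
  rw [h1, h2, hW.avg_mix]
  have h3 := hW.disagreement_mix_le v
  have h4 : rho W ^ 2 ≤ 1 := pow_le_one₀ (norm_nonneg _) hW.rho_lt_one.le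
  have := disagreement_nonneg v
  nlinarith

lemma rho_sq_lt_one : rho W ^ 2 < 1 := pow_lt_one₀ (norm_nonneg _) hW.rho_lt_one two_ne_zero

lemma θ₄_pos : 0 < θ₄ W := by
  have := hW.rho_sq_lt_one; unfold θ₄; linarith

lemma θ₅_nonneg : 0 ≤ θ₅ W := by
  have := hW.rho_sq_lt_one
  have h : 0 ≤ 1 - rho W ^ 2 := by linarith
  unfold θ₅; positivity

lemma θ₅_pos (h : 0 < rho W) : 0 < θ₅ W := by
  have := hW.rho_sq_lt_one
  have h : 0 < 1 - rho W ^ 2 := by linarith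
  unfold θ₅; positivity

/-- Consensus error after a gossip step on `v - c w`. -/
lemma disagreement_mix_sub_smul_le (c : ℝ) (v w : Fin m → Vec n) :
    disagreement (mix W fun i => v i - c • w i)
      ≤ (1 - θ₄ W) * disagreement v + θ₅ W * c ^ 2 * disagreement w := by
  have h := hW.disagreement_mix_le (fun i => v i + (-c) • w i)
  have e : (fun i => v i - c • w i) = fun i => v i + (-c) • w i := by
    funext i; rw [neg_smul, sub_eq_add_neg]
  rw [e]
  refine h.trans ?_
  have h1 := hW.rho_sq_lt_one
  -- If ρ = 0, one gossip step removes all disagreement, while the Young parameter below would have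
  -- a zero denominator.
  rcases (rho_nonneg W).eq_or_lt with h0 | h0
  · have hv := disagreement_nonneg v
    have hw := disagreement_nonneg w
    have h5 := hW.θ₅_nonneg
    have h4 := θ₄_lt_one W
    rw [← h0, zero_pow two_ne_zero, zero_mul]
    have : 0 ≤ 1 - θ₄ W := by linarith
    positivity
  · set r := rho W with hr
    have hr2 : 0 < 1 - r ^ 2 := by linarith
    -- With this parameter ρ²(1 + η) = (1 + ρ²)/2 = 1 - θ₄ and ρ²(1 + η⁻¹) = θ₅ exactly.
    have hη : 0 < (1 - r ^ 2) / (2 * r ^ 2) := by positivity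
    have h2 := disagreement_add_le hη v (fun i => (-c) • w i)
    rw [disagreement_smul] at h2
    refine (mul_le_mul_of_nonneg_left h2 (sq_nonneg r)).trans_eq ?_
    simp only [θ₄, θ₅, ← hr]
    field_simp
    ring

lemma disagreement_mix_add_le : ∃ C, 0 ≤ C ∧ ∀ v w : Fin m → Vec n,
    disagreement (fun i => mix W v i + w i)
      ≤ (1 - θ₄ W) * disagreement v + C * ∑ i, ‖w i‖ ^ 2 := by
  have h1 := hW.rho_sq_lt_one
  -- For this η the number (1 + η)ρ² is still at most (1 + ρ²)/2 = 1 - θ₄, and η stays finite when ρ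
  -- = 0.
  set η := (1 - rho W ^ 2) / 2 with hη
  have hη0 : 0 < η := by rw [hη]; linarith
  refine ⟨1 + η⁻¹, by positivity, fun v w => ?_⟩
  refine (disagreement_add_le hη0 _ _).trans (add_le_add ?_ ?_)
  · refine (mul_le_mul_of_nonneg_left (hW.disagreement_mix_le v) (by positivity)).trans ?_
    rw [← mul_assoc]
    refine mul_le_mul_of_nonneg_right ?_ (disagreement_nonneg v)
    simp only [θ₄, hη]
    nlinarith [sq_nonneg (rho W)]
  · exact mul_le_mul_of_nonneg_left (disagreement_le_sum w) (by positivity)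

end IsWeight

end Mixing

/-! ### Independence and conditionally centered noise -/

lemma integrable_inner_of_memLp {Ω E : Type*} [MeasurableSpace Ω] [NormedAddCommGroup E]
    [InnerProductSpace ℝ E] {P : Measure Ω} {f g : Ω → E} (hf : MemLp f 2 P) (hg : MemLp g 2 P) :
    Integrable (fun ω => inner ℝ (f ω) (g ω)) P := by
  refine ((hf.integrable_norm_pow two_ne_zero).add
    (hg.integrable_norm_pow two_ne_zero)).mono' (hf.1.inner hg.1)
    (Eventually.of_forall fun ω => ?_)
  have h1 : ‖inner ℝ (f ω) (g ω)‖ ≤ ‖f ω‖ * ‖g ω‖ := norm_inner_le_norm _ _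
  simp only [Pi.add_apply]
  nlinarith [sq_nonneg (‖f ω‖ - ‖g ω‖), sq_nonneg (‖f ω‖ + ‖g ω‖)]

section Independence

variable {Ω α β δ : Type*} [MeasurableSpace Ω] [MeasurableSpace α] [MeasurableSpace β]
  [MeasurableSpace δ] {P : Measure Ω} [IsProbabilityMeasure P]

/-- Associativity of product measures: the joint law is a triple product, which may be bracketed
either way. It merges initial points and earlier samples into one past that is independent of the
current sample. -/
lemma indepFun_prodMk_of_indepFun_prodMk {U : Ω → α} {A : Ω → β} {B : Ω → δ}
    (hU : Measurable U) (hA : Measurable A) (hB : Measurable B)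
    (h : IndepFun U (fun ω => (A ω, B ω)) P) (hAB : IndepFun A B P) :
    IndepFun (fun ω => (U ω, A ω)) B P := by
  have := Measure.isProbabilityMeasure_map hU.aemeasurable (μ := P)
  have := Measure.isProbabilityMeasure_map hA.aemeasurable (μ := P)
  have := Measure.isProbabilityMeasure_map hB.aemeasurable (μ := P)
  have hUA : IndepFun U A P := h.comp measurable_id measurable_fst
  rw [indepFun_iff_map_prod_eq_prod_map_map (hU.prodMk hA).aemeasurable hB.aemeasurable,
    hUA.map_prod_eq_prod_map_map hU.aemeasurable hA.aemeasurable]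
  have h1 := h.map_prod_eq_prod_map_map hU.aemeasurable (hA.prodMk hB).aemeasurable
  rw [hAB.map_prod_eq_prod_map_map hA.aemeasurable hB.aemeasurable,
    ← Measure.prodAssoc_prod] at h1
  have h2 := congrArg (Measure.map MeasurableEquiv.prodAssoc.symm) h1
  rw [Measure.map_map (by fun_prop) (by fun_prop), Measure.map_map (by fun_prop) (by fun_prop),
    MeasurableEquiv.symm_comp_self, Measure.map_id] at h2
  exact h2

variable {E : Type*} [NormedAddCommGroup E] [InnerProductSpace ℝ E] [FiniteDimensional ℝ E]
  [MeasurableSpace E] [BorelSpace E]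

/-- Integrating out an independent sample: second moment of conditionally centered noise, and its
orthogonality to the past. -/
lemma noise_of_indepFun {Z : Ω → α} {ξ : Ω → δ} (hZ : Measurable Z) (hξ : Measurable ξ)
    (hind : IndepFun Z ξ P) {h : α → δ → E} (hh : Measurable fun q : α × δ => h q.1 q.2)
    {N : ℝ} (hL : ∀ z, MemLp (h z) 2 (P.map ξ)) (h0 : ∀ z, ∫ s, h z s ∂(P.map ξ) = 0)
    (hN : ∀ z, ∫ s, ‖h z s‖ ^ 2 ∂(P.map ξ) ≤ N) :
    MemLp (fun ω => h (Z ω) (ξ ω)) 2 P ∧ ∫ ω, ‖h (Z ω) (ξ ω)‖ ^ 2 ∂P ≤ N ∧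
      ∀ A : α → E, Measurable A → MemLp (fun ω => A (Z ω)) 2 P →
        ∫ ω, inner ℝ (A (Z ω)) (h (Z ω) (ξ ω)) ∂P = 0 := by
  have := Measure.isProbabilityMeasure_map hZ.aemeasurable (μ := P)
  have := Measure.isProbabilityMeasure_map hξ.aemeasurable (μ := P)
  have hpair : Measurable fun ω => (Z ω, ξ ω) := hZ.prodMk hξ
  have hQ := hind.map_prod_eq_prod_map_map hZ.aemeasurable hξ.aemeasurable
  have hcomp : Measurable fun ω => h (Z ω) (ξ ω) := hh.comp hpair
  obtain ⟨z₀⟩ : Nonempty α := by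
    obtain ⟨ω⟩ := P.nonempty_of_neZero
    exact ⟨Z ω⟩
  have hN0 : 0 ≤ N := (integral_nonneg fun _ => sq_nonneg _).trans (hN z₀)
  -- Square-integrability of the composite is not known in advance, so the bound is first obtained
  -- for lower integrals, where Tonelli needs none.
  have hlin : ∫⁻ ω, ENNReal.ofReal (‖h (Z ω) (ξ ω)‖ ^ 2) ∂P ≤ ENNReal.ofReal N := by
    have e : ∫⁻ ω, ENNReal.ofReal (‖h (Z ω) (ξ ω)‖ ^ 2) ∂P
        = ∫⁻ q, ENNReal.ofReal (‖h q.1 q.2‖ ^ 2) ∂(P.map fun ω => (Z ω, ξ ω)) :=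
      (lintegral_map (hh.norm.pow_const 2).ennreal_ofReal hpair).symm
    rw [e, hQ, lintegral_prod _ (hh.norm.pow_const 2).ennreal_ofReal.aemeasurable]
    calc ∫⁻ z, ∫⁻ s, ENNReal.ofReal (‖h z s‖ ^ 2) ∂(P.map ξ) ∂(P.map Z)
        ≤ ∫⁻ _, ENNReal.ofReal N ∂(P.map Z) := by
          refine lintegral_mono fun z => ?_
          rw [← ofReal_integral_eq_lintegral_ofReal ((hL z).integrable_norm_pow two_ne_zero)
            (Eventually.of_forall fun _ => sq_nonneg _)]
          exact ENNReal.ofReal_le_ofReal (hN z)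
      _ = ENNReal.ofReal N := by simp
  have hM : MemLp (fun ω => h (Z ω) (ξ ω)) 2 P := by
    rw [memLp_two_iff_integrable_sq_norm hcomp.aestronglyMeasurable]
    refine ⟨(hcomp.norm.pow_const 2).aestronglyMeasurable, ?_⟩
    rw [hasFiniteIntegral_iff_ofReal (Eventually.of_forall fun _ => sq_nonneg _)]
    exact hlin.trans_lt ENNReal.ofReal_lt_top
  refine ⟨hM, ?_, fun A hA hAL => ?_⟩
  · rw [integral_eq_lintegral_of_nonneg_ae (Eventually.of_forall fun _ => sq_nonneg _)
      (hcomp.norm.pow_const 2).aestronglyMeasurable]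
    exact ENNReal.toReal_le_of_le_ofReal hN0 hlin
  · have hmeas : Measurable fun q : α × δ => inner ℝ (A q.1) (h q.1 q.2) :=
      (hA.comp measurable_fst).inner hh
    have hint : Integrable (fun ω => inner ℝ (A (Z ω)) (h (Z ω) (ξ ω))) P := integrable_inner_of_memLp hAL hM
    have hint' : Integrable (fun q : α × δ => inner ℝ (A q.1) (h q.1 q.2))
        ((P.map Z).prod (P.map ξ)) := by
      rw [← hQ, integrable_map_measure hmeas.aestronglyMeasurable hpair.aemeasurable]
      exact hint
    have e : ∫ ω, inner ℝ (A (Z ω)) (h (Z ω) (ξ ω)) ∂P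
        = ∫ q, inner ℝ (A q.1) (h q.1 q.2) ∂(P.map fun ω => (Z ω, ξ ω)) :=
      (integral_map hpair.aemeasurable hmeas.aestronglyMeasurable).symm
    -- Fubini with the past frozen: the inner integral pairs the fixed vector A z with a mean-zero
    -- noise.
    rw [e, hQ, integral_prod _ hint']
    refine integral_eq_zero_of_ae (Eventually.of_forall fun z => ?_)
    change ∫ s, inner ℝ (A z) (h z s) ∂(P.map ξ) = 0
    rw [integral_inner ((hL z).integrable one_le_two), h0, inner_zero_right]

end Independence

/-! ### Step sizes -/

namespace Par.Valid

variable {m : ℕ} {p : Par} {W : Matrix (Fin m) (Fin m) ℝ} (hp : p.Valid W)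
include hp

lemma Γ_pos : 0 < p.Γ := one_pos.trans_le hp.one_le_Γ

lemma a_pos : 0 < p.a := hp.b_pos.trans hp.b_lt_a

lemma add_Γ_pos (k : ℕ) : 0 < (k : ℝ) + p.Γ := by have := hp.Γ_pos; positivity

lemma step_pos (k : ℕ) : 0 < p.step k :=
  div_pos hp.γ_pos (Real.rpow_pos_of_pos (hp.add_Γ_pos k) _)

lemma reg_pos (k : ℕ) : 0 < p.reg k :=
  div_pos hp.lam_pos (Real.rpow_pos_of_pos (hp.add_Γ_pos k) _)

lemma step_anti {j k : ℕ} (h : j ≤ k) : p.step k ≤ p.step j := by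
  have := hp.add_Γ_pos j
  have h1 : (j : ℝ) ≤ k := by exact_mod_cast h
  exact div_le_div_of_nonneg_left hp.γ_pos.le (Real.rpow_pos_of_pos (hp.add_Γ_pos j) _)
    (Real.rpow_le_rpow this.le (by linarith) hp.a_pos.le)

lemma reg_anti {j k : ℕ} (h : j ≤ k) : p.reg k ≤ p.reg j := by
  have := hp.add_Γ_pos j
  have h1 : (j : ℝ) ≤ k := by exact_mod_cast h
  exact div_le_div_of_nonneg_left hp.lam_pos.le (Real.rpow_pos_of_pos (hp.add_Γ_pos j) _)
    (Real.rpow_le_rpow this.le (by linarith) hp.b_pos.le)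

lemma step_le (k : ℕ) : p.step k ≤ p.step 0 := by
  simpa using hp.step_anti (Nat.zero_le k)

lemma reg_le (k : ℕ) : p.reg k ≤ p.reg 0 := by
  simpa using hp.reg_anti (Nat.zero_le k)

end Par.Valid

/-! ### The expected local maps and the noise -/

section Noise

variable {m n d : ℕ}

/-- Expected regularized map of agent `i` at iteration `k`. -/
def gLoc (D : Problem m n d) (p : Par) (k : ℕ) (i : Fin m) (x : Vec n) : Vec n :=
  D.FLoc i x + p.reg k • gradient (D.fLoc i) x

/-- Sampling error of the regularized map. -/
def noise (D : Problem m n d) (p : Par) (k : ℕ) (i : Fin m) (x : Vec n) (s : Vec d) : Vec n :=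
  (D.F i x s - D.FLoc i x) + p.reg k • (D.gradS i x s - gradient (D.fLoc i) x)

variable {D : Problem m n d} {p : Par}

lemma gMap_eq (k : ℕ) (i : Fin m) (x : Vec n) (s : Vec d) :
    gMap D p k i x s = gLoc D p k i x + noise D p k i x s := by
  simp only [gMap, gLoc, noise, smul_sub]; abel

/-- A uniform bound for the variance of the sampled regularized maps. -/
def Par.var (p : Par) : ℝ := 2 * p.νF ^ 2 + 2 * p.reg 0 ^ 2 * p.νf ^ 2

lemma Par.var_nonneg (p : Par) : 0 ≤ p.var := by unfold Par.var; positivity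

variable {W : Matrix (Fin m) (Fin m) ℝ} (hD : D.Assumptions p) (hp : p.Valid W)

include hD in
lemma continuous_FLoc (i : Fin m) : Continuous (D.FLoc i) := by
  refine (LipschitzWith.of_dist_le_mul (K := ⟨p.LF, hD.LF_pos.le⟩) fun x y => ?_).continuous
  rw [dist_eq_norm, dist_eq_norm]; exact hD.lip_F i x y

include hD in
lemma continuous_gradient_fLoc (i : Fin m) : Continuous (gradient (D.fLoc i)) := by
  refine (LipschitzWith.of_dist_le_mul (K := ⟨p.Lf, hD.Lf_pos.le⟩) fun x y => ?_).continuous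
  rw [dist_eq_norm, dist_eq_norm]; exact hD.smooth_f i x y

include hD in
lemma continuous_gLoc (k : ℕ) (i : Fin m) : Continuous (gLoc D p k i) :=
  (continuous_FLoc hD i).add ((continuous_gradient_fLoc hD i).fun_const_smul _)

include hD in
lemma measurable_noise (k : ℕ) (i : Fin m) :
    Measurable fun q : Vec n × Vec d => noise D p k i q.1 q.2 :=
  ((hD.meas_F i).sub ((continuous_FLoc hD i).measurable.comp measurable_fst)).add
    (((hD.meas_grad i).fun_sub
      ((continuous_gradient_fLoc hD i).measurable.comp measurable_fst)).fun_const_smul _)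

include hD in
lemma measurable_gMap (k : ℕ) (i : Fin m) :
    Measurable fun q : Vec n × Vec d => gMap D p k i q.1 q.2 :=
  (hD.meas_F i).add ((hD.meas_grad i).fun_const_smul _)

include hD in
lemma memLp_noise (k : ℕ) (i : Fin m) (x : Vec n) : MemLp (noise D p k i x) 2 (D.law i) := by
  have := hD.prob i
  exact ((hD.memLp_F i x).sub (memLp_const _)).add
    (((hD.memLp_grad i x).sub (memLp_const (gradient (D.fLoc i) x))).const_smul (p.reg k))

include hD in
lemma integral_noise (k : ℕ) (i : Fin m) (x : Vec n) :
    ∫ s, noise D p k i x s ∂(D.law i) = 0 := by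
  have := hD.prob i
  have h1 := (hD.memLp_F i x).integrable one_le_two
  have h2 := (hD.memLp_grad i x).integrable one_le_two
  simp only [noise]
  have h3 : Integrable (fun s => p.reg k • (D.gradS i x s - gradient (D.fLoc i) x)) (D.law i) :=
    (h2.sub (integrable_const (gradient (D.fLoc i) x))).smul (p.reg k)
  have h4 : Integrable (fun s => D.F i x s - D.FLoc i x) (D.law i) := h1.sub (integrable_const _)
  rw [integral_add h4 h3, integral_smul, integral_sub h1 (integrable_const _), integral_sub h2 (integrable_const _),
    hD.unbiased_F, hD.unbiased_grad]
  simp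

include hD hp in
lemma integral_norm_sq_noise_le (k : ℕ) (i : Fin m) (x : Vec n) :
    ∫ s, ‖noise D p k i x s‖ ^ 2 ∂(D.law i) ≤ p.var := by
  have := hD.prob i
  have h1 := ((hD.memLp_F i x).sub (memLp_const (D.FLoc i x))).integrable_norm_pow two_ne_zero
  have h2 := ((hD.memLp_grad i x).sub
    (memLp_const (gradient (D.fLoc i) x))).integrable_norm_pow two_ne_zero
  simp only [Pi.sub_apply] at h1 h2
  have hle : ∀ s, ‖noise D p k i x s‖ ^ 2 ≤ 2 * ‖D.F i x s - D.FLoc i x‖ ^ 2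
      + 2 * p.reg 0 ^ 2 * ‖D.gradS i x s - gradient (D.fLoc i) x‖ ^ 2 := by
    intro s
    have h := sq_norm_add_le one_pos (D.F i x s - D.FLoc i x)
      (p.reg k • (D.gradS i x s - gradient (D.fLoc i) x))
    rw [norm_smul, mul_pow, Real.norm_eq_abs, sq_abs] at h
    have h3 : p.reg k ^ 2 ≤ p.reg 0 ^ 2 := pow_le_pow_left₀ (hp.reg_pos k).le (hp.reg_le k) 2
    have h4 := mul_le_mul_of_nonneg_right h3
      (sq_nonneg ‖D.gradS i x s - gradient (D.fLoc i) x‖)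
    simp only [noise]
    norm_num at h
    linarith
  have hi : Integrable (fun s => 2 * ‖D.F i x s - D.FLoc i x‖ ^ 2
      + 2 * p.reg 0 ^ 2 * ‖D.gradS i x s - gradient (D.fLoc i) x‖ ^ 2) (D.law i) :=
    (h1.const_mul _).add (h2.const_mul _)
  refine (integral_mono ((memLp_noise hD k i x).integrable_norm_pow two_ne_zero) hi hle).trans ?_
  rw [integral_add (h1.const_mul _) (h2.const_mul _), integral_const_mul, integral_const_mul]
  have h5 := hD.var_F i x
  have h6 := mul_le_mul_of_nonneg_left (hD.var_grad i x)
    (show 0 ≤ 2 * p.reg 0 ^ 2 by positivity)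
  unfold Par.var
  linarith

end Noise

/-! ### Measurability of the iterates -/

section Iter

variable {m n d : ℕ} {D : Problem m n d} {p : Par} {W : Matrix (Fin m) (Fin m) ℝ}

lemma iter_succ_fst (x0 : Fin m → Vec n) (s : ℕ → Fin m → Vec d) (k : ℕ) :
    (iter D p W x0 s (k + 1)).1 = fun i => ∑ j, W i j •
      ((iter D p W x0 s k).1 j - p.step k • (iter D p W x0 s k).2 j) := rfl

lemma iter_succ_snd (x0 : Fin m → Vec n) (s : ℕ → Fin m → Vec d) (k : ℕ) :
    (iter D p W x0 s (k + 1)).2 = fun i => ∑ j, W i j • (iter D p W x0 s k).2 j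
      + gMap D p (k + 1) i ((iter D p W x0 s (k + 1)).1 i) (s (k + 1) i)
      - gMap D p k i ((iter D p W x0 s k).1 i) (s k i) := rfl

/-- Causality with its off-by-one: the local copies at `k` use samples strictly before `k`, the
trackers also those at `k`. -/
lemma iter_congr (x0 : Fin m → Vec n) {s s' : ℕ → Fin m → Vec d} (k : ℕ) :
    ((∀ j < k, s j = s' j) → (iter D p W x0 s k).1 = (iter D p W x0 s' k).1) ∧
    ((∀ j ≤ k, s j = s' j) → (iter D p W x0 s k).2 = (iter D p W x0 s' k).2) := by
  induction k with
  | zero => exact ⟨fun _ => rfl, fun h => by simp [iter, h 0 le_rfl]⟩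
  | succ k ih =>
    have h1 : (∀ j < k + 1, s j = s' j) →
        (iter D p W x0 s (k + 1)).1 = (iter D p W x0 s' (k + 1)).1 := fun h => by
      rw [iter_succ_fst, iter_succ_fst, ih.1 fun j hj => h j (by omega),
        ih.2 fun j hj => h j (by omega)]
    refine ⟨h1, fun h => ?_⟩
    rw [iter_succ_snd, iter_succ_snd, h1 fun j hj => h j hj.le, ih.1 fun j hj => h j (by omega),
      ih.2 fun j hj => h j (by omega), h k (by omega), h (k + 1) le_rfl]

lemma measurable_iter (hD : D.Assumptions p) (k : ℕ) :
    (∀ i, Measurable fun q : (Fin m → Vec n) × (ℕ → Fin m → Vec d) =>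
      (iter D p W q.1 q.2 k).1 i) ∧
    (∀ i, Measurable fun q : (Fin m → Vec n) × (ℕ → Fin m → Vec d) =>
      (iter D p W q.1 q.2 k).2 i) := by
  have hs : ∀ k i, Measurable fun q : (Fin m → Vec n) × (ℕ → Fin m → Vec d) => q.2 k i :=
    fun k i => by fun_prop
  induction k with
  | zero =>
    refine ⟨fun i => (measurable_pi_apply i).comp measurable_fst, fun i => ?_⟩
    exact (measurable_gMap hD 0 i).comp
      (((measurable_pi_apply i).comp measurable_fst).prodMk (hs 0 i))
  | succ k ih =>
    have h1 : ∀ i, Measurable fun q : (Fin m → Vec n) × (ℕ → Fin m → Vec d) =>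
        (iter D p W q.1 q.2 (k + 1)).1 i := fun i => by
      simp only [iter_succ_fst]
      exact Finset.measurable_fun_sum _ fun j _ =>
        (((ih.1 j).fun_sub ((ih.2 j).fun_const_smul _)).fun_const_smul _)
    refine ⟨h1, fun i => ?_⟩
    simp only [iter_succ_snd]
    exact ((Finset.measurable_fun_sum _ fun j _ => (ih.2 j).fun_const_smul _).fun_add
      ((measurable_gMap hD (k + 1) i).comp ((h1 i).prodMk (hs (k + 1) i)))).fun_sub
      ((measurable_gMap hD k i).comp ((ih.1 i).prodMk (hs k i)))

end Iter

/-! ### Average dynamics and conditionally centered noise along a run. -/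

namespace Run

variable {m n d : ℕ} {D : Problem m n d} {Ω : Type*} [MeasurableSpace Ω] {P : Measure Ω}
variable (r : Run D P) (p : Par) (W : Matrix (Fin m) (Fin m) ℝ)

/-- The sampled regularized map of agent `i` along the run. -/
def g (k : ℕ) (ω : Ω) (i : Fin m) : Vec n := gMap D p k i (r.x p W k ω i) (r.ξ k i ω)

/-- The sampling error of agent `i` along the run. -/
def err (k : ℕ) (ω : Ω) (i : Fin m) : Vec n := noise D p k i (r.x p W k ω i) (r.ξ k i ω)

lemma x_succ (k : ℕ) (ω : Ω) :
    r.x p W (k + 1) ω = mix W fun j => r.x p W k ω j - p.step k • r.y p W k ω j := rfl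

lemma y_succ (k : ℕ) (ω : Ω) : r.y p W (k + 1) ω
    = fun i => mix W (r.y p W k ω) i + (r.g p W (k + 1) ω i - r.g p W k ω i) := by
  funext i
  rw [← add_sub_assoc]
  rfl

lemma g_eq (k : ℕ) (ω : Ω) (i : Fin m) :
    r.g p W k ω i = gLoc D p k i (r.x p W k ω i) + r.err p W k ω i := gMap_eq _ _ _ _

variable {p W} {G : SimpleGraph (Fin m)}

/-- The trackers preserve the average of the sampled maps. -/
lemma avg_y (hW : IsWeight G W) (k : ℕ) (ω : Ω) : avg (r.y p W k ω) = avg (r.g p W k ω) := by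
  induction k with
  | zero => rfl
  | succ k ih =>
    rw [y_succ, avg_add, hW.avg_mix, ih, avg_sub, add_sub_cancel]

lemma avg_x_succ (hW : IsWeight G W) (k : ℕ) (ω : Ω) : avg (r.x p W (k + 1) ω)
    = avg (r.x p W k ω) - p.step k • avg (r.g p W k ω) := by
  rw [x_succ, hW.avg_mix, avg_sub, avg_smul, r.avg_y hW]

lemma measurable_x (hD : D.Assumptions p) (k : ℕ) : Measurable (r.x p W k) := by
  refine measurable_pi_lambda _ fun i => ?_
  exact ((measurable_iter hD k).1 i).comp ((measurable_pi_lambda _ r.meas_x0).prodMk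
    (measurable_pi_lambda _ fun k => measurable_pi_lambda _ fun i => r.meas_ξ k i))

variable [IsProbabilityMeasure P]

/-- The local copies at iteration `k` are independent of the samples at iteration `k`. -/
lemma indepFun_x (hD : D.Assumptions p) (k : ℕ) (i : Fin m) :
    IndepFun (r.x p W k) (r.ξ k i) P := by
  classical
  set S : Finset (ℕ × Fin m) := Finset.range k ×ˢ Finset.univ with hS
  have hmem : ∀ {j : ℕ} {l : Fin m}, j < k → (j, l) ∈ S := fun h => by simp [hS, h]
  have hST : Disjoint S {(k, i)} := by simp [hS]
  have hAB : IndepFun (fun ω (q : S) => r.ξ q.1.1 q.1.2 ω) (r.ξ k i) P := by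
    have h := r.indep.indepFun_finset S {(k, i)} hST fun q => r.meas_ξ q.1 q.2
    exact h.comp (φ := id)
      (ψ := fun v : (({(k, i)} : Finset (ℕ × Fin m)) → Vec d) =>
        v ⟨(k, i), Finset.mem_singleton_self _⟩)
      measurable_id (measurable_pi_apply _)
  have hU : IndepFun (fun ω i => r.x0 i ω)
      (fun ω => ((fun (q : S) => r.ξ q.1.1 q.1.2 ω), r.ξ k i ω)) P :=
    r.indep_x0.comp (φ := id) (ψ := fun v : (ℕ × Fin m → Vec d) => ((fun q : S => v q.1), v (k, i)))
      measurable_id (by fun_prop)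
  have h := indepFun_prodMk_of_indepFun_prodMk (measurable_pi_lambda _ r.meas_x0)
    (measurable_pi_lambda _ fun q : S => r.meas_ξ q.1.1 q.1.2) (r.meas_ξ k i) hU hAB
  -- A finite past is padded by zeros to a full sample path; by `iter_congr` the padding does not
  -- affect the local copies at `k`, which thus become a measurable function of the past alone.
  set ext : (S → Vec d) → ℕ → Fin m → Vec d :=
    fun v j l => if hj : j < k then v ⟨(j, l), hmem hj⟩ else 0 with hext
  have hmeas : Measurable ext := by
    refine measurable_pi_lambda _ fun j => measurable_pi_lambda _ fun l => ?_
    by_cases hj : j < k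
    · simp only [hext, hj, dite_true]; exact measurable_pi_apply _
    · simp only [hext, hj, dite_false]; exact measurable_const
  have hφ : Measurable fun q : (Fin m → Vec n) × (S → Vec d) =>
      (iter D p W q.1 (ext q.2) k).1 :=
    measurable_pi_lambda _ fun i => ((measurable_iter hD k).1 i).comp
      (measurable_fst.prodMk (hmeas.comp measurable_snd))
  have h' := h.comp (ψ := id) hφ measurable_id
  have e : r.x p W k = (fun q : (Fin m → Vec n) × (S → Vec d) =>
      (iter D p W q.1 (ext q.2) k).1) ∘
        fun ω => ((fun i => r.x0 i ω), fun (q : S) => r.ξ q.1.1 q.1.2 ω) := by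
    funext ω
    refine (iter_congr (fun i => r.x0 i ω) k).1 fun j hj => ?_
    funext l
    simp only [hext, hj, dite_true]
  rw [e]
  exact h'

/-- The past is frozen as the whole vector of local copies, not only the copy of agent `i`, so that
the noise is orthogonal to functions coupling all agents, as the averaged step requires. -/
lemma err_props (hD : D.Assumptions p) (hp : p.Valid W) (k : ℕ) (i : Fin m) :
    MemLp (fun ω => r.err p W k ω i) 2 P ∧ ∫ ω, ‖r.err p W k ω i‖ ^ 2 ∂P ≤ p.var ∧
      ∀ A : (Fin m → Vec n) → Vec n, Measurable A → MemLp (fun ω => A (r.x p W k ω)) 2 P →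
        ∫ ω, inner ℝ (A (r.x p W k ω)) (r.err p W k ω i) ∂P = 0 := by
  have hlaw := r.law_ξ k i
  have hh : Measurable fun q : (Fin m → Vec n) × Vec d => noise D p k i (q.1 i) q.2 := by
    have hz : Measurable fun q : (Fin m → Vec n) × Vec d => (q.1 i, q.2) := by fun_prop
    exact (measurable_noise hD k i).comp hz
  have h1 : ∀ z : Fin m → Vec n, MemLp (noise D p k i (z i)) 2 (P.map (r.ξ k i)) :=
    fun z => hlaw ▸ memLp_noise hD k i _
  have h2 : ∀ z : Fin m → Vec n, ∫ s, noise D p k i (z i) s ∂(P.map (r.ξ k i)) = 0 :=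
    fun z => hlaw ▸ integral_noise hD k i _
  have h3 : ∀ z : Fin m → Vec n,
      ∫ s, ‖noise D p k i (z i) s‖ ^ 2 ∂(P.map (r.ξ k i)) ≤ p.var :=
    fun z => hlaw ▸ integral_norm_sq_noise_le hD hp k i _
  have hx : Measurable (r.x p W k) := r.measurable_x hD k
  have hind : IndepFun (r.x p W k) (r.ξ k i) P := r.indepFun_x hD k i
  have hξ := r.meas_ξ k i
  have H := noise_of_indepFun hx hξ hind (h := fun z s => noise D p k i (z i) s) hh h1 h2 h3
  exact H

end Run

/-! ### Coupled scalar recursions -/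

lemma tendsto_rpow_neg_nat_add (Γ : ℝ) {s : ℝ} (hs : 0 < s) :
    Tendsto (fun k : ℕ => ((k : ℝ) + Γ) ^ (-s)) atTop (𝓝 0) :=
  (tendsto_rpow_neg_atTop hs).comp
    (tendsto_atTop_add_const_right _ _ tendsto_natCast_atTop_atTop)

/-- For a base t/(t+1) below 1 and s ≤ 1 the power s is at least the base itself, so the relative
loss is at most 1/(t+1). -/
lemma rpow_neg_sub_rpow_neg_le {t s : ℝ} (ht : 0 < t) (hs1 : s ≤ 1) :
    t ^ (-s) - (t + 1) ^ (-s) ≤ t ^ (-s) * t ^ (-1 : ℝ) := by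
  have h1 : (t + 1) ^ (-s) = t ^ (-s) * (t / (t + 1)) ^ s := by
    rw [Real.div_rpow ht.le (by linarith), Real.rpow_neg ht.le, Real.rpow_neg (by linarith)]
    have : t ^ s ≠ 0 := (Real.rpow_pos_of_pos ht _).ne'
    field_simp
  have h2 : t / (t + 1) ≤ (t / (t + 1)) ^ s := by
    have h0 : 0 < t / (t + 1) := by positivity
    have := Real.rpow_le_rpow_of_exponent_ge h0 (by rw [div_le_one (by linarith)]; linarith) hs1
    simpa using this
  have h3 : 1 - t / (t + 1) ≤ t ^ (-1 : ℝ) := by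
    rw [Real.rpow_neg_one, one_sub_div (by linarith), inv_eq_one_div]
    gcongr <;> linarith
  rw [h1, ← mul_one_sub]
  exact mul_le_mul_of_nonneg_left (by linarith) (Real.rpow_pos_of_pos ht _).le

/-- Since s ≤ 2, the ratio of consecutive terms is at least (1 - 1/(t+1))², which exceeds 1 - 2/t; a
target rate thus decays slower than the contraction 1 - θ/2. -/
lemma rpow_neg_succ_ge {t s θ : ℝ} (ht : 0 < t) (hs : s ≤ 2) (hθ : 4 * t ^ (-1 : ℝ) ≤ θ) :
    (1 - θ / 2) * t ^ (-s) ≤ (t + 1) ^ (-s) := by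
  have h1 : (t + 1) ^ (-s) = t ^ (-s) * (t / (t + 1)) ^ s := by
    rw [Real.div_rpow ht.le (by linarith), Real.rpow_neg ht.le, Real.rpow_neg (by linarith)]
    have : t ^ s ≠ 0 := (Real.rpow_pos_of_pos ht _).ne'
    field_simp
  have h0 : 0 < t / (t + 1) := by positivity
  have h2 : (t / (t + 1)) ^ (2 : ℝ) ≤ (t / (t + 1)) ^ s :=
    Real.rpow_le_rpow_of_exponent_ge h0 (by rw [div_le_one (by linarith)]; linarith) hs
  rw [Real.rpow_two] at h2
  have h3 : 1 - t / (t + 1) ≤ t ^ (-1 : ℝ) := by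
    rw [Real.rpow_neg_one, one_sub_div (by linarith), inv_eq_one_div]
    gcongr <;> linarith
  have h4 : 1 - θ / 2 ≤ (t / (t + 1)) ^ 2 := by nlinarith [sq_nonneg (1 - t / (t + 1))]
  rw [h1, mul_comm]
  exact mul_le_mul_of_nonneg_left (by linarith) (Real.rpow_pos_of_pos ht _).le

lemma eventually_const_mul_le {f : ℕ → ℝ} (hf : Tendsto f atTop (𝓝 0)) (c : ℝ) {ε : ℝ}
    (hε : 0 < ε) : ∀ᶠ k in atTop, c * f k ≤ ε := by
  have h := hf.const_mul c
  rw [mul_zero] at h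
  exact h.eventually (ge_mem_nhds hε)

set_option maxHeartbeats 1000000 in
/-- Rates for three coupled recursions with stepsizes of order `t⁻ᵃ` and regularization of
order `t⁻ᵇ`, uniformly over all sequences bounded by `S` at the starting index. -/
theorem coupled_decay {a b Γ α θ C : ℝ} (hb : 0 < b) (hab : b < a) (h3 : 3 * a + b < 2)
    (hΓ : 1 ≤ Γ) (hα : 0 < α) (hθ : 0 < θ)
    (hθ1 : θ ≤ 1) (hC : 0 ≤ C) :
    ∃ K₀ : ℕ, ∀ K ≥ K₀, ∀ S : ℝ, ∃ c > 0, ∀ u v w : ℕ → ℝ,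
      (∀ k, 0 ≤ u k) → (∀ k, 0 ≤ v k) → (∀ k, 0 ≤ w k) → u K ≤ S → v K ≤ S → w K ≤ S →
      (∀ k ≥ K, u (k + 1) ≤ (1 - α * ((k : ℝ) + Γ) ^ (-(a + b))) * u k + C * v k
        + C * ((k : ℝ) + Γ) ^ (-(2 * a))) →
      (∀ k ≥ K, v (k + 1) ≤ (1 - θ) * v k + C * ((k : ℝ) + Γ) ^ (-(2 * a)) * w k) →
      (∀ k ≥ K, w (k + 1) ≤ (1 - θ) * w k + C * (1 + u k + v k)
        + C * ((k : ℝ) + Γ) ^ (-(2 * a)) * w k) →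
      ∀ k ≥ K, u k ≤ c * ((k : ℝ) + Γ) ^ (-(a - b)) ∧ v k ≤ c * ((k : ℝ) + Γ) ^ (-(2 * a)) ∧
        w k ≤ c := by
  have ha : 0 < a := hb.trans hab
  -- The half contraction θ/2 times `C1` pays for the forcing 2C in the third recursion, and θ/2
  -- times `C2` pays for C · C1 in the second. The added 1 makes both at least 1, as the base case
  -- needs.
  set C1 := 4 * C / θ + 1 with hC1
  have hC1p : 0 < C1 := by positivity
  set C2 := 2 * C * C1 / θ + 1 with hC2
  have hC2p : 0 < C2 := by positivity
  have e1 := eventually_const_mul_le (tendsto_rpow_neg_nat_add Γ (s := a + b) (by linarith)) α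
    one_pos
  have e2 := eventually_const_mul_le (tendsto_rpow_neg_nat_add Γ (s := 2 * a) (by linarith)) C
    (half_pos hθ)
  have e3 := eventually_const_mul_le (tendsto_rpow_neg_nat_add Γ (s := 2 * a) (by linarith)) C2
    one_pos
  have e4 := eventually_const_mul_le (tendsto_rpow_neg_nat_add Γ (s := a - b) (by linarith))
    (C * C2) (show 0 < α / 4 by positivity)
  have e5 := eventually_const_mul_le
    (tendsto_rpow_neg_nat_add Γ (s := 1 - a - b) (by linarith)) 1 (show 0 < α / 4 by positivity)
  have e6 := eventually_const_mul_le (tendsto_rpow_neg_nat_add Γ one_pos) 4 hθ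
  obtain ⟨K₀, hK₀⟩ := eventually_atTop.1
    (e1.and (e2.and (e3.and (e4.and (e5.and e6)))))
  -- The threshold is fixed before `S`, because in the application the bound `S` at the starting
  -- index depends on `K`.
  refine ⟨K₀, fun K hK S => ?_⟩
  set κ : ℕ → ℝ := fun k => ((k : ℝ) + Γ) ^ (-(a - b)) with hκ
  set g : ℕ → ℝ := fun k => ((k : ℝ) + Γ) ^ (-(2 * a)) with hg
  set δ : ℕ → ℝ := fun k => ((k : ℝ) + Γ) ^ (-(a + b)) with hδ
  have ht : ∀ k : ℕ, 1 ≤ (k : ℝ) + Γ := fun k => by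
    have : (0 : ℝ) ≤ k := Nat.cast_nonneg k
    linarith
  have ht0 : ∀ k : ℕ, 0 < (k : ℝ) + Γ := fun k => one_pos.trans_le (ht k)
  have hκp : ∀ k, 0 < κ k := fun k => Real.rpow_pos_of_pos (ht0 k) _
  have hgp : ∀ k, 0 < g k := fun k => Real.rpow_pos_of_pos (ht0 k) _
  have hg1 : ∀ k, g k ≤ 1 := fun k => Real.rpow_le_one_of_one_le_of_nonpos (ht k) (by linarith)
  have hδκ : ∀ k, δ k * κ k = g k := fun k => by
    simp only [hδ, hκ, hg]; rw [← Real.rpow_add (ht0 k)]; congr 1; ring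
  have hκanti : ∀ k ≥ K, κ k ≤ κ K := fun k hk => by
    refine Real.rpow_le_rpow_of_nonpos (ht0 K) ?_ (by linarith)
    have : (K : ℝ) ≤ k := by exact_mod_cast hk
    linarith
  have hκdiff : ∀ k ≥ K, κ k - κ (k + 1) ≤ α / 4 * g k := fun k hk => by
    have h1 := rpow_neg_sub_rpow_neg_le (ht0 k) (s := a - b) (by linarith)
    have h5 := (hK₀ k (hK.trans hk)).2.2.2.2.1
    have h6 : ((k : ℝ) + Γ) ^ (-(a - b)) * ((k : ℝ) + Γ) ^ (-1 : ℝ)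
        = ((k : ℝ) + Γ) ^ (-(1 - a - b)) * g k := by
      simp only [hg]; rw [← Real.rpow_add (ht0 k), ← Real.rpow_add (ht0 k)]; congr 1; ring
    rw [h6] at h1
    have h7 : κ (k + 1) = ((k : ℝ) + Γ + 1) ^ (-(a - b)) := by
      simp only [hκ]; congr 1; push_cast; ring
    rw [h7]
    refine h1.trans (mul_le_mul_of_nonneg_right ?_ (hgp k).le)
    linarith
  have hgsucc : ∀ k ≥ K, (1 - θ / 2) * g k ≤ g (k + 1) := fun k hk => by
    have h6 := (hK₀ k (hK.trans hk)).2.2.2.2.2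
    have h7 : g (k + 1) = ((k : ℝ) + Γ + 1) ^ (-(2 * a)) := by
      simp only [hg]; congr 1; push_cast; ring
    rw [h7]
    exact rpow_neg_succ_ge (ht0 k) (by linarith) h6
  -- The first summand dominates the forcing of the first recursion, the second covers the starting
  -- values after division by the rates at `K`.
  set A := 2 * (C * C2 + C) / α + |S| / (g K * κ K) + 1 with hA
  -- The invariant below is circular, since `S'` contains `A`. It closes because C · C2 · κ K ≤ α/4:
  -- of the gain αA, one half pays for the constants, one quarter for the `A` inside `S'`, and one
  -- quarter for the decrease of κ.
  have hAp : 0 < A := by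
    have h1 := hgp K
    have h2 := hκp K
    positivity
  set S' := 1 + A * κ K with hS'
  have hS'1 : 1 ≤ S' := by
    have := mul_pos hAp (hκp K)
    linarith
  have hA1 : 2 * (C * C2 + C) ≤ α * A := by
    have h1 : 0 ≤ |S| / (g K * κ K) :=
      div_nonneg (abs_nonneg _) (mul_pos (hgp K) (hκp K)).le
    have h2 : α * (2 * (C * C2 + C) / α) = 2 * (C * C2 + C) := by field_simp
    nlinarith
  have hA2 : |S| ≤ A * (g K * κ K) := by
    have h1 : 0 ≤ 2 * (C * C2 + C) / α := by positivity
    have h2 := mul_pos (hgp K) (hκp K)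
    rw [← div_le_iff₀ h2]
    linarith
  have hA3 : |S| ≤ A * κ K := by
    have h1 := mul_pos hAp (hκp K)
    have h2 := hg1 K
    nlinarith
  refine ⟨A + C2 * S' + C1 * S', by positivity, fun u v w hu hv hw huK hvK hwK hru hrv hrw => ?_⟩
  have key : ∀ k ≥ K, u k ≤ A * κ k ∧ v k ≤ C2 * S' * g k ∧ w k ≤ C1 * S' := by
    intro k hk
    induction k, hk using Nat.le_induction with
    | base =>
      have hSle := le_abs_self S
      refine ⟨by linarith, ?_, ?_⟩
      · have h1 : |S| ≤ S' * g K := by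
          have := hgp K
          have : A * (g K * κ K) = (S' - 1) * g K := by rw [hS']; ring
          linarith
        have h2 : 1 ≤ C2 := by
          have : 0 ≤ 2 * C * C1 / θ := by positivity
          linarith
        have h3 : 0 ≤ S' * g K := (abs_nonneg S).trans h1
        nlinarith
      · have h2 : 1 ≤ C1 := by
          have : 0 ≤ 4 * C / θ := by positivity
          linarith
        nlinarith
    | succ k hk ih =>
      obtain ⟨ihu, ihv, ihw⟩ := ih
      obtain ⟨f1, f2, f3, -, -, -⟩ := hK₀ k (hK.trans hk)
      have f4 := (hK₀ K hK).2.2.2.1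
      change α * δ k ≤ 1 at f1
      change C * g k ≤ θ / 2 at f2
      change C2 * g k ≤ 1 at f3
      change C * C2 * κ K ≤ α / 4 at f4
      have hgk := hgp k
      refine ⟨?_, ?_, ?_⟩
      · have h1 := hru k hk
        change u (k + 1) ≤ (1 - α * δ k) * u k + C * v k + C * g k at h1
        have h2 : (1 - α * δ k) * u k ≤ (1 - α * δ k) * (A * κ k) :=
          mul_le_mul_of_nonneg_left ihu (by linarith)
        have h3 : C * v k ≤ C * (C2 * S' * g k) := mul_le_mul_of_nonneg_left ihv hC
        have h4 : (1 - α * δ k) * (A * κ k) = A * κ k - α * A * g k := by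
          rw [← hδκ k]; ring
        have h5 : A * (κ k - κ (k + 1)) ≤ A * (α / 4 * g k) :=
          mul_le_mul_of_nonneg_left (hκdiff k hk) hAp.le
        have h6 : C * C2 * S' + C ≤ α * A * (3 / 4) := by
          have : C * C2 * S' = C * C2 + A * (C * C2 * κ K) := by rw [hS']; ring
          have := mul_le_mul_of_nonneg_left f4 hAp.le
          linarith
        have h7 := mul_le_mul_of_nonneg_right h6 hgk.le
        linarith
      · have h1 := hrv k hk
        change v (k + 1) ≤ (1 - θ) * v k + C * g k * w k at h1
        have h2 : (1 - θ) * v k ≤ (1 - θ) * (C2 * S' * g k) :=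
          mul_le_mul_of_nonneg_left ihv (by linarith)
        have h3 : C * g k * w k ≤ C * g k * (C1 * S') :=
          mul_le_mul_of_nonneg_left ihw (by positivity)
        have h4 : C * C1 ≤ C2 * θ / 2 := by
          have : C2 * θ / 2 = C * C1 + θ / 2 := by rw [hC2]; field_simp
          linarith
        have h5 : 0 ≤ S' * g k := mul_nonneg (by linarith) hgk.le
        have h6 := mul_le_mul_of_nonneg_right h4 h5
        have h7 := mul_le_mul_of_nonneg_left (hgsucc k hk) (mul_nonneg hC2p.le (zero_le_one.trans hS'1))
        linarith
      · have h1 := hrw k hk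
        change w (k + 1) ≤ (1 - θ) * w k + C * (1 + u k + v k) + C * g k * w k at h1
        have h2 : C * g k * w k ≤ θ / 2 * w k := mul_le_mul_of_nonneg_right f2 (hw k)
        have h3 : (1 - θ / 2) * w k ≤ (1 - θ / 2) * (C1 * S') :=
          mul_le_mul_of_nonneg_left ihw (by linarith)
        have h4 : u k ≤ A * κ K := ihu.trans (mul_le_mul_of_nonneg_left (hκanti k hk) hAp.le)
        have h5 : v k ≤ S' := by
          have := mul_le_mul_of_nonneg_left f3 (zero_le_one.trans hS'1)
          linarith
        have h6 : C * (1 + u k + v k) ≤ C * (2 * S') :=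
          mul_le_mul_of_nonneg_left (by linarith) hC
        have h7 : C * (2 * S') ≤ θ / 2 * (C1 * S') := by
          have h8 : θ / 2 * C1 = 2 * C + θ / 2 := by rw [hC1]; field_simp; ring
          have h9 : θ / 2 * (C1 * S') = 2 * C * S' + θ / 2 * S' := by
            rw [← mul_assoc, h8]; ring
          have h10 : 0 ≤ θ / 2 * S' := mul_nonneg (half_pos hθ).le (zero_le_one.trans hS'1)
          linarith
        linarith
  intro k hk
  obtain ⟨h1, h2, h4⟩ := key k hk
  have hS0 : 0 ≤ S' := by linarith
  have p1 : 0 ≤ C2 * S' := by positivity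
  have p2 : 0 ≤ C1 * S' := by positivity
  refine ⟨h1.trans ?_, h2.trans ?_, by linarith⟩
  · exact mul_le_mul_of_nonneg_right (by linarith) (hκp k).le
  · exact mul_le_mul_of_nonneg_right (by linarith) (hgp k).le

/-! ### Square-integrability and second moments -/

section L2

variable {Ω : Type*} [MeasurableSpace Ω] {P : Measure Ω} {m n : ℕ}

lemma integrable_sum_norm_sq {v : Ω → Fin m → Vec n} (h : ∀ i, MemLp (fun ω => v ω i) 2 P) :
    Integrable (fun ω => ∑ i, ‖v ω i‖ ^ 2) P :=
  integrable_finsetSum _ fun i _ => (h i).integrable_norm_pow two_ne_zero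

lemma memLp_avg {v : Ω → Fin m → Vec n} (h : ∀ i, MemLp (fun ω => v ω i) 2 P) :
    MemLp (fun ω => avg (v ω)) 2 P :=
  (memLp_finsetSum _ fun i _ => h i).const_smul (1 / (m : ℝ))

lemma integrable_disagreement {v : Ω → Fin m → Vec n} (h : ∀ i, MemLp (fun ω => v ω i) 2 P) :
    Integrable (fun ω => disagreement (v ω)) P :=
  integrable_sum_norm_sq (v := fun ω i => v ω i - avg (v ω)) fun i => (h i).sub (memLp_avg h)

lemma memLp_comp_of_lipschitz [IsFiniteMeasure P] {f : Vec n → Vec n} {K : ℝ} (hf : Continuous f)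
    (hK : ∀ x y, ‖f x - f y‖ ≤ K * ‖x - y‖) {X : Ω → Vec n} (hX : MemLp X 2 P) :
    MemLp (fun ω => f (X ω)) 2 P := by
  refine ((memLp_const ‖f 0‖).add (hX.norm.const_mul K)).mono'
    (hf.comp_aestronglyMeasurable hX.1) (Eventually.of_forall fun ω => ?_)
  have h1 := hK (X ω) 0
  rw [sub_zero] at h1
  have h2 := norm_le_norm_add_norm_sub' (f (X ω)) (f 0)
  simp only [Pi.add_apply]
  linarith

end L2

/-! ### Lipschitz and growth bounds for the expected local maps, uniform in the iteration. -/

section GLoc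

variable {m n d : ℕ} {D : Problem m n d} {p : Par} {W : Matrix (Fin m) (Fin m) ℝ}
  (hD : D.Assumptions p) (hp : p.Valid W)
include hD hp

lemma L_zero_pos : 0 < p.L 0 := by
  have h1 := hD.LF_pos
  have h2 := hD.Lf_pos
  have h3 := hp.reg_pos 0
  simp only [Nat.cast_zero] at h3
  unfold Par.L; positivity

lemma norm_gLoc_sub_le (k : ℕ) (i : Fin m) (x y : Vec n) :
    ‖gLoc D p k i x - gLoc D p k i y‖ ≤ p.L 0 * ‖x - y‖ := by
  have e : gLoc D p k i x - gLoc D p k i y = (D.FLoc i x - D.FLoc i y)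
      + p.reg k • (gradient (D.fLoc i) x - gradient (D.fLoc i) y) := by
    simp only [gLoc]; module
  rw [e, Par.L, add_mul, mul_assoc]
  refine norm_add_le_of_le (hD.lip_F i x y) ?_
  rw [norm_smul, Real.norm_of_nonneg (hp.reg_pos k).le]
  have := hp.reg_le k
  exact mul_le_mul this (hD.smooth_f i x y) (norm_nonneg _) ((hp.reg_pos k).le.trans this)

/-- A uniform affine bound for the expected local maps. -/
lemma norm_gLoc_sq_le (k : ℕ) (i : Fin m) (x : Vec n) :
    ‖gLoc D p k i x‖ ^ 2 ≤ 2 * (‖D.FLoc i 0‖ + p.reg 0 * ‖gradient (D.fLoc i) 0‖) ^ 2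
      + 2 * p.L 0 ^ 2 * ‖x‖ ^ 2 := by
  have h1 := norm_gLoc_sub_le hD hp k i x 0
  rw [sub_zero] at h1
  have h2 : ‖gLoc D p k i 0‖ ≤ ‖D.FLoc i 0‖ + p.reg 0 * ‖gradient (D.fLoc i) 0‖ := by
    refine norm_add_le_of_le le_rfl ?_
    rw [norm_smul, Real.norm_of_nonneg (hp.reg_pos k).le]
    exact mul_le_mul_of_nonneg_right (hp.reg_le k) (norm_nonneg _)
  have h3 := norm_le_norm_add_norm_sub' (gLoc D p k i x) (gLoc D p k i 0)
  set c := ‖D.FLoc i 0‖ + p.reg 0 * ‖gradient (D.fLoc i) 0‖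
  have h4 : ‖gLoc D p k i x‖ ^ 2 ≤ (c + p.L 0 * ‖x‖) ^ 2 :=
    pow_le_pow_left₀ (norm_nonneg _) (by linarith) 2
  nlinarith [sq_nonneg (c - p.L 0 * ‖x‖)]

end GLoc

namespace Run

variable {m n d : ℕ} {D : Problem m n d} {p : Par} {W : Matrix (Fin m) (Fin m) ℝ}
  {G : SimpleGraph (Fin m)} {Ω : Type*} [MeasurableSpace Ω] {P : Measure Ω}
  [IsProbabilityMeasure P] (r : Run D P)

lemma memLp_g_of_x (hD : D.Assumptions p) (hp : p.Valid W) {k : ℕ}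
    (hx : ∀ i, MemLp (fun ω => r.x p W k ω i) 2 P) (i : Fin m) :
    MemLp (fun ω => r.g p W k ω i) 2 P := by
  simp only [g_eq]
  exact (memLp_comp_of_lipschitz (continuous_gLoc hD k i) (norm_gLoc_sub_le hD hp k i) (hx i)).add
    (r.err_props hD hp k i).1

omit [IsProbabilityMeasure P] in
lemma memLp_mix {v : Ω → Fin m → Vec n} (h : ∀ i, MemLp (fun ω => v ω i) 2 P) (i : Fin m) :
    MemLp (fun ω => mix W (v ω) i) 2 P :=
  memLp_finsetSum _ fun j _ => (h j).const_smul (W i j)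

lemma memLp_xy (hD : D.Assumptions p) (hp : p.Valid W) (k : ℕ) :
    (∀ i, MemLp (fun ω => r.x p W k ω i) 2 P) ∧ ∀ i, MemLp (fun ω => r.y p W k ω i) 2 P := by
  induction k with
  | zero =>
    have hx : ∀ i, MemLp (fun ω => r.x p W 0 ω i) 2 P := r.memLp_x0
    exact ⟨hx, r.memLp_g_of_x hD hp hx⟩
  | succ k ih =>
    have hx : ∀ i, MemLp (fun ω => r.x p W (k + 1) ω i) 2 P := fun i => by
      simp only [x_succ]
      exact memLp_mix (v := fun ω j => r.x p W k ω j - p.step k • r.y p W k ω j)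
        (fun j => (ih.1 j).sub ((ih.2 j).const_smul (p.step k))) i
    refine ⟨hx, fun i => ?_⟩
    simp only [y_succ]
    exact (memLp_mix ih.2 i).add
      ((r.memLp_g_of_x hD hp hx i).sub (r.memLp_g_of_x hD hp ih.1 i))

lemma memLp_x (hD : D.Assumptions p) (hp : p.Valid W) (k : ℕ) (i : Fin m) :
    MemLp (fun ω => r.x p W k ω i) 2 P := (r.memLp_xy hD hp k).1 i

lemma memLp_y (hD : D.Assumptions p) (hp : p.Valid W) (k : ℕ) (i : Fin m) :
    MemLp (fun ω => r.y p W k ω i) 2 P := (r.memLp_xy hD hp k).2 i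

lemma memLp_g (hD : D.Assumptions p) (hp : p.Valid W) (k : ℕ) (i : Fin m) :
    MemLp (fun ω => r.g p W k ω i) 2 P := r.memLp_g_of_x hD hp (r.memLp_x hD hp k) i

lemma memLp_avg_sub (hD : D.Assumptions p) (hp : p.Valid W) (k : ℕ) (z : Vec n) :
    MemLp (fun ω => avg (r.x p W k ω) - z) 2 P :=
  (memLp_avg (r.memLp_x hD hp k)).sub (memLp_const z)

variable (p W) in
/-- Second moment of the local copies. -/
def xSq (k : ℕ) : ℝ := ∫ ω, ∑ i, ‖r.x p W k ω i‖ ^ 2 ∂P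

variable (p W) in
/-- Second moment of the trackers. -/
def ySq (k : ℕ) : ℝ := ∫ ω, ∑ i, ‖r.y p W k ω i‖ ^ 2 ∂P

variable (p W) in
/-- Second moment of the sampled regularized maps. -/
def gSq (k : ℕ) : ℝ := ∫ ω, ∑ i, ‖r.g p W k ω i‖ ^ 2 ∂P

omit [IsProbabilityMeasure P] in
lemma xSq_nonneg (k : ℕ) : 0 ≤ r.xSq p W k :=
  integral_nonneg fun _ => Finset.sum_nonneg fun _ _ => sq_nonneg _

omit [IsProbabilityMeasure P] in
lemma ySq_nonneg (k : ℕ) : 0 ≤ r.ySq p W k :=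
  integral_nonneg fun _ => Finset.sum_nonneg fun _ _ => sq_nonneg _

end Run

/-- The constant of the affine second moment bound for the sampled regularized maps. -/
def gBound {m n d : ℕ} (D : Problem m n d) (p : Par) : ℝ :=
  ∑ i, 4 * (‖D.FLoc i 0‖ + p.reg 0 * ‖gradient (D.fLoc i) 0‖) ^ 2 + 2 * m * p.var
    + 4 * p.L 0 ^ 2

lemma gBound_nonneg {m n d : ℕ} (D : Problem m n d) (p : Par) : 0 ≤ gBound D p := by
  have := p.var_nonneg
  have : 0 ≤ ∑ i, 4 * (‖D.FLoc i 0‖ + p.reg 0 * ‖gradient (D.fLoc i) 0‖) ^ 2 :=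
    Finset.sum_nonneg fun _ _ => by positivity
  unfold gBound
  positivity

/-! ### Second moment growth, uniform over all runs. -/

namespace Run

variable {m n d : ℕ} {D : Problem m n d} {p : Par} {W : Matrix (Fin m) (Fin m) ℝ}
  {G : SimpleGraph (Fin m)} {Ω : Type*} [MeasurableSpace Ω] {P : Measure Ω}
  [IsProbabilityMeasure P] (r : Run D P)

/-- Affine growth of the expected maps plus bounded variance; together with nonexpansive mixing this
makes second moments grow at most geometrically. -/
lemma gSq_le (hD : D.Assumptions p) (hp : p.Valid W) (k : ℕ) :
    r.gSq p W k ≤ gBound D p * (1 + r.xSq p W k) := by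
  set c : Fin m → ℝ := fun i => ‖D.FLoc i 0‖ + p.reg 0 * ‖gradient (D.fLoc i) 0‖ with hc
  have hpt : ∀ ω, ∑ i, ‖r.g p W k ω i‖ ^ 2 ≤ ∑ i, 4 * c i ^ 2
      + (4 * p.L 0 ^ 2 * ∑ i, ‖r.x p W k ω i‖ ^ 2 + 2 * ∑ i, ‖r.err p W k ω i‖ ^ 2) := by
    intro ω
    rw [Finset.mul_sum, Finset.mul_sum, ← Finset.sum_add_distrib, ← Finset.sum_add_distrib]
    refine Finset.sum_le_sum fun i _ => ?_
    have h1 := sq_norm_add_le one_pos (gLoc D p k i (r.x p W k ω i)) (r.err p W k ω i)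
    have h2 := norm_gLoc_sq_le hD hp k i (r.x p W k ω i)
    rw [g_eq]
    norm_num at h1
    simp only [hc]
    linarith
  have hx := integrable_sum_norm_sq (r.memLp_x hD hp k)
  have he := integrable_sum_norm_sq fun i => (r.err_props hD hp k i).1
  have h1 : r.gSq p W k ≤ ∑ i, 4 * c i ^ 2
      + (4 * p.L 0 ^ 2 * r.xSq p W k + 2 * ∫ ω, ∑ i, ‖r.err p W k ω i‖ ^ 2 ∂P) := by
    refine (integral_mono (integrable_sum_norm_sq (r.memLp_g hD hp k))
      ((integrable_const _).add ((hx.const_mul _).add (he.const_mul _))) hpt).trans_eq ?_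
    rw [integral_add' (integrable_const _) ((hx.const_mul _).add (he.const_mul _)),
      integral_add' (hx.const_mul _) (he.const_mul _), integral_const_mul, integral_const_mul]
    simp [xSq]
  have h2 : ∫ ω, ∑ i, ‖r.err p W k ω i‖ ^ 2 ∂P ≤ m * p.var := by
    rw [integral_finsetSum _ fun i _ => (r.err_props hD hp k i).1.integrable_norm_pow two_ne_zero]
    refine (Finset.sum_le_sum fun i _ => (r.err_props hD hp k i).2.1).trans_eq ?_
    simp
  have h3 := r.xSq_nonneg (p := p) (W := W) k
  have h4 : 0 ≤ ∑ i, 4 * c i ^ 2 + 2 * m * p.var := by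
    have := p.var_nonneg
    have : 0 ≤ ∑ i, 4 * c i ^ 2 := Finset.sum_nonneg fun _ _ => by positivity
    positivity
  have h5 := mul_nonneg h4 h3
  have h6 : 0 ≤ 4 * p.L 0 ^ 2 := by positivity
  unfold gBound
  simp only [hc] at h1 h4 h5
  linarith

lemma xSq_succ_le (hD : D.Assumptions p) (hp : p.Valid W) (hW : IsWeight G W) (k : ℕ) :
    r.xSq p W (k + 1) ≤ 2 * r.xSq p W k + 2 * p.step 0 ^ 2 * r.ySq p W k := by
  have hx := integrable_sum_norm_sq (r.memLp_x hD hp k)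
  have hy := integrable_sum_norm_sq (r.memLp_y hD hp k)
  have hpt : ∀ ω, ∑ i, ‖r.x p W (k + 1) ω i‖ ^ 2 ≤ 2 * ∑ i, ‖r.x p W k ω i‖ ^ 2
      + 2 * p.step 0 ^ 2 * ∑ i, ‖r.y p W k ω i‖ ^ 2 := by
    intro ω
    rw [x_succ]
    refine (hW.sum_norm_sq_mix_le _).trans ?_
    rw [Finset.mul_sum, Finset.mul_sum, ← Finset.sum_add_distrib]
    refine Finset.sum_le_sum fun i _ => ?_
    have h1 := sq_norm_add_le one_pos (r.x p W k ω i) (-(p.step k • r.y p W k ω i))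
    rw [← sub_eq_add_neg, norm_neg, norm_smul, mul_pow, Real.norm_eq_abs, sq_abs] at h1
    have h2 := mul_le_mul_of_nonneg_right
      (pow_le_pow_left₀ (hp.step_pos k).le (hp.step_le k) 2) (sq_nonneg ‖r.y p W k ω i‖)
    norm_num at h1
    linarith
  refine (integral_mono (integrable_sum_norm_sq (r.memLp_x hD hp (k + 1)))
    ((hx.const_mul _).add (hy.const_mul _)) hpt).trans_eq ?_
  rw [integral_add' (hx.const_mul _) (hy.const_mul _), integral_const_mul, integral_const_mul]
  rfl

lemma ySq_succ_le (hD : D.Assumptions p) (hp : p.Valid W) (hW : IsWeight G W) (k : ℕ) :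
    r.ySq p W (k + 1) ≤ 2 * r.ySq p W k + 4 * r.gSq p W (k + 1) + 4 * r.gSq p W k := by
  have hg := integrable_sum_norm_sq (r.memLp_g hD hp k)
  have hg' := integrable_sum_norm_sq (r.memLp_g hD hp (k + 1))
  have hy := integrable_sum_norm_sq (r.memLp_y hD hp k)
  have hpt : ∀ ω, ∑ i, ‖r.y p W (k + 1) ω i‖ ^ 2 ≤ 2 * ∑ i, ‖r.y p W k ω i‖ ^ 2
      + 4 * ∑ i, ‖r.g p W (k + 1) ω i‖ ^ 2 + 4 * ∑ i, ‖r.g p W k ω i‖ ^ 2 := by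
    intro ω
    have h0 := hW.sum_norm_sq_mix_le (r.y p W k ω)
    have h1 : ∑ i, ‖r.y p W (k + 1) ω i‖ ^ 2 ≤ ∑ i, (2 * ‖mix W (r.y p W k ω) i‖ ^ 2
      + 4 * ‖r.g p W (k + 1) ω i‖ ^ 2 + 4 * ‖r.g p W k ω i‖ ^ 2) := by
      refine Finset.sum_le_sum fun i _ => ?_
      rw [y_succ]
      have h2 := sq_norm_add_le one_pos (mix W (r.y p W k ω) i)
        (r.g p W (k + 1) ω i - r.g p W k ω i)
      have h3 := sq_norm_add_le one_pos (r.g p W (k + 1) ω i) (-r.g p W k ω i)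
      rw [← sub_eq_add_neg, norm_neg] at h3
      norm_num at h2 h3
      linarith
    rw [Finset.sum_add_distrib, Finset.sum_add_distrib, ← Finset.mul_sum, ← Finset.mul_sum,
      ← Finset.mul_sum] at h1
    linarith
  refine (integral_mono (integrable_sum_norm_sq (r.memLp_y hD hp (k + 1)))
    (((hy.const_mul _).add (hg'.const_mul _)).add (hg.const_mul _)) hpt).trans_eq ?_
  rw [integral_add' ((hy.const_mul _).add (hg'.const_mul _)) (hg.const_mul _),
    integral_add' (hy.const_mul _) (hg'.const_mul _), integral_const_mul, integral_const_mul,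
    integral_const_mul]
  rfl

/-- At every iteration the second moments are bounded in terms of the initial one only. -/
lemma exists_moment_bound (hD : D.Assumptions p) (hp : p.Valid W) (hW : IsWeight G W) (R : ℝ)
    (K : ℕ) : ∃ S, 0 < S ∧ ∀ (Ω : Type*) [MeasurableSpace Ω] (P : Measure Ω)
      [IsProbabilityMeasure P] (r : Run D P), ∑ i, ∫ ω, ‖r.x0 i ω‖ ^ 2 ∂P ≤ R →
      ∀ k ≤ K, r.xSq p W k + r.ySq p W k ≤ S := by
  have hB := gBound_nonneg D p
  set B := gBound D p with hBdef
  set c := 2 + 2 * p.step 0 ^ 2 with hc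
  set C := c + 2 + 4 * B * (1 + c) + 4 * B with hC
  have hc0 : 2 ≤ c := by have := sq_nonneg (p.step 0); linarith
  have hC0 : 0 ≤ C := by positivity
  refine ⟨(1 + C) ^ K * (1 + |R| + B * (1 + |R|)), by positivity,
    fun Ω _ P _ r hR k hk => ?_⟩
  have h0 : r.xSq p W 0 ≤ |R| := by
    have : r.xSq p W 0 = ∑ i, ∫ ω, ‖r.x0 i ω‖ ^ 2 ∂P :=
      integral_finsetSum _ fun i _ => (r.memLp_x0 i).integrable_norm_pow two_ne_zero
    rw [this]; exact hR.trans (le_abs_self R)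
  have h1 : r.ySq p W 0 ≤ B * (1 + |R|) := by
    refine (r.gSq_le hD hp 0).trans ?_
    gcongr
  -- Adding 1 to the moments turns the affine recursion into a multiplicative one.
  have hind : ∀ k, 1 + (r.xSq p W k + r.ySq p W k)
      ≤ (1 + C) ^ k * (1 + |R| + B * (1 + |R|)) := by
    intro k
    induction k with
    | zero => rw [pow_zero, one_mul]; linarith
    | succ k ih =>
      have hx := r.xSq_nonneg (p := p) (W := W) k
      have hy := r.ySq_nonneg (p := p) (W := W) k
      have h2 := r.xSq_succ_le hD hp hW k
      have h3 := r.ySq_succ_le hD hp hW k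
      have h4 := r.gSq_le hD hp k
      have h5 := r.gSq_le hD hp (k + 1)
      set s := r.xSq p W k + r.ySq p W k with hs
      have h6 : r.xSq p W (k + 1) ≤ c * s := by
        have := mul_nonneg (sq_nonneg (p.step 0)) hx
        rw [hc, hs]; linarith
      have h7 : r.gSq p W (k + 1) ≤ B * (1 + c * s) := h5.trans (by gcongr)
      have h8 : r.gSq p W k ≤ B * (1 + s) := h4.trans (by gcongr; linarith)
      have h9 : 1 + (r.xSq p W (k + 1) + r.ySq p W (k + 1)) ≤ (1 + C) * (1 + s) := by
        have hs0 : 0 ≤ s := by positivity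
        have h10 : 0 ≤ B * c := by positivity
        have h11 : 0 ≤ B * s := by positivity
        rw [hC]
        nlinarith
      calc _ ≤ (1 + C) * (1 + s) := h9
        _ ≤ (1 + C) * ((1 + C) ^ k * (1 + |R| + B * (1 + |R|))) := by gcongr
        _ = _ := by ring
  have h2 := hind k
  have h3 : (1 + C) ^ k ≤ (1 + C) ^ K := pow_le_pow_right₀ (by linarith) hk
  have h4 := mul_le_mul_of_nonneg_right h3 (show 0 ≤ 1 + |R| + B * (1 + |R|) by positivity)
  linarith

/-! ### The three error recursions -/

omit [IsProbabilityMeasure P] in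
lemma e1_nonneg (k : ℕ) : 0 ≤ r.e1 p W k := integral_nonneg fun _ => sq_nonneg _

omit [IsProbabilityMeasure P] in
lemma e2_nonneg (k : ℕ) : 0 ≤ r.e2 p W k := integral_nonneg fun _ => disagreement_nonneg _

omit [IsProbabilityMeasure P] in
lemma e3_nonneg (k : ℕ) : 0 ≤ r.e3 p W k := integral_nonneg fun _ => disagreement_nonneg _

lemma e2_le_xSq (hD : D.Assumptions p) (hp : p.Valid W) (k : ℕ) :
    r.e2 p W k ≤ r.xSq p W k :=
  integral_mono (integrable_disagreement (r.memLp_x hD hp k))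
    (integrable_sum_norm_sq (r.memLp_x hD hp k)) fun _ => disagreement_le_sum _

lemma e3_le_ySq (hD : D.Assumptions p) (hp : p.Valid W) (k : ℕ) :
    r.e3 p W k ≤ r.ySq p W k :=
  integral_mono (integrable_disagreement (r.memLp_y hD hp k))
    (integrable_sum_norm_sq (r.memLp_y hD hp k)) fun _ => disagreement_le_sum _

lemma e1_le_xSq (hD : D.Assumptions p) (hp : p.Valid W) (hW : IsWeight G W) (k : ℕ) {T : ℝ}
    (hT : ‖D.tik (p.reg ((k : ℝ) - 1))‖ ≤ T) :
    r.e1 p W k ≤ 2 * r.xSq p W k + 2 * T ^ 2 := by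
  have hx := integrable_sum_norm_sq (r.memLp_x hD hp k)
  have hm : (1 : ℝ) ≤ m := by exact_mod_cast hW.pos
  refine (integral_mono ((r.memLp_avg_sub hD hp k _).integrable_norm_pow two_ne_zero)
    ((hx.const_mul 2).add (integrable_const (2 * T ^ 2))) fun ω => ?_).trans_eq ?_
  · have h1 := sq_norm_add_le one_pos (avg (r.x p W k ω)) (-D.tik (p.reg ((k : ℝ) - 1)))
    rw [← sub_eq_add_neg, norm_neg] at h1
    have h2 := sq_norm_avg_le (r.x p W k ω)
    have h3 : (1 / (m : ℝ)) * ∑ i, ‖r.x p W k ω i‖ ^ 2 ≤ 1 * ∑ i, ‖r.x p W k ω i‖ ^ 2 := by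
      gcongr
      rw [div_le_one (by linarith)]; exact hm
    have h4 := pow_le_pow_left₀ (norm_nonneg _) hT 2
    norm_num at h1
    simp only [Pi.add_apply]
    linarith
  · rw [integral_add' (hx.const_mul 2) (integrable_const _), integral_const_mul]
    simp [xSq]

/-- Closes the system: raw moments are returned to the two errors at the price of a constant, since
the Tikhonov points are bounded. -/
lemma xSq_le (hD : D.Assumptions p) (hp : p.Valid W) (hW : IsWeight G W) (k : ℕ) {T : ℝ}
    (hT : ‖D.tik (p.reg ((k : ℝ) - 1))‖ ≤ T) :
    r.xSq p W k ≤ r.e2 p W k + 2 * m * r.e1 p W k + 2 * m * T ^ 2 := by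
  have h1 := (r.memLp_avg_sub hD hp k (D.tik (p.reg ((k : ℝ) - 1)))).integrable_norm_pow
    two_ne_zero
  have h2 := integrable_disagreement (r.memLp_x hD hp k)
  refine (integral_mono (integrable_sum_norm_sq (r.memLp_x hD hp k))
    ((h2.add (h1.const_mul (2 * m))).add (integrable_const (2 * m * T ^ 2)))
    fun ω => ?_).trans_eq ?_
  · have h3 := sum_norm_sub_sq hW.pos (r.x p W k ω) 0
    have h4 := sq_norm_add_le one_pos (avg (r.x p W k ω) - D.tik (p.reg ((k : ℝ) - 1)))
      (D.tik (p.reg ((k : ℝ) - 1)))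
    have h5 := pow_le_pow_left₀ (norm_nonneg _) hT 2
    rw [sub_add_cancel] at h4
    norm_num at h4
    simp only [sub_zero] at h3
    simp only [Pi.add_apply]
    rw [h3]
    have h6 : ‖avg (r.x p W k ω)‖ ^ 2 ≤
      2 * ‖avg (r.x p W k ω) - D.tik (p.reg ((k : ℝ) - 1))‖ ^ 2 + 2 * T ^ 2 := by linarith
    have h7 := mul_le_mul_of_nonneg_left h6 (Nat.cast_nonneg (α := ℝ) m)
    linarith
  · rw [integral_add' (h2.add (h1.const_mul _)) (integrable_const _),
      integral_add' h2 (h1.const_mul _), integral_const_mul]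
    simp [e1, e2]

lemma e2_succ_le (hD : D.Assumptions p) (hp : p.Valid W) (hW : IsWeight G W) (k : ℕ) :
    r.e2 p W (k + 1) ≤ (1 - θ₄ W) * r.e2 p W k + θ₅ W * p.step k ^ 2 * r.e3 p W k := by
  have hx := integrable_disagreement (r.memLp_x hD hp k)
  have hy := integrable_disagreement (r.memLp_y hD hp k)
  refine (integral_mono (integrable_disagreement (r.memLp_x hD hp (k + 1)))
    ((hx.const_mul (1 - θ₄ W)).add (hy.const_mul (θ₅ W * p.step k ^ 2))) fun ω => ?_).trans_eq ?_
  · rw [x_succ]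
    exact hW.disagreement_mix_sub_smul_le _ _ _
  · rw [integral_add' (hx.const_mul _) (hy.const_mul _), integral_const_mul, integral_const_mul]
    rfl

/-- No cancellation in the increments of the sampled maps is exploited, because only boundedness of
the tracking error is needed. The constant does not depend on the run. -/
lemma exists_e3_succ_le (hD : D.Assumptions p) (hp : p.Valid W) (hW : IsWeight G W) :
    ∃ C, 0 ≤ C ∧ ∀ (Ω : Type*) [MeasurableSpace Ω] (P : Measure Ω)
      [IsProbabilityMeasure P] (r : Run D P) (k : ℕ), r.e3 p W (k + 1)
        ≤ (1 - θ₄ W) * r.e3 p W k + C * (1 + r.xSq p W k + r.xSq p W (k + 1)) := by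
  obtain ⟨C, hC, h⟩ := hW.disagreement_mix_add_le (n := n)
  have hB := gBound_nonneg D p
  refine ⟨4 * C * gBound D p, by positivity, fun Ω _ P _ r k => ?_⟩
  have hy := integrable_disagreement (r.memLp_y hD hp k)
  have hg := integrable_sum_norm_sq (r.memLp_g hD hp k)
  have hg' := integrable_sum_norm_sq (r.memLp_g hD hp (k + 1))
  have h1 : r.e3 p W (k + 1) ≤ (1 - θ₄ W) * r.e3 p W k
      + (2 * C * r.gSq p W (k + 1) + 2 * C * r.gSq p W k) := by
    refine (integral_mono (integrable_disagreement (r.memLp_y hD hp (k + 1)))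
      ((hy.const_mul (1 - θ₄ W)).add ((hg'.const_mul (2 * C)).add (hg.const_mul (2 * C))))
      fun ω => ?_).trans_eq ?_
    · rw [y_succ]
      refine (h _ _).trans (add_le_add le_rfl ?_)
      have h2 : ∑ i, ‖r.g p W (k + 1) ω i - r.g p W k ω i‖ ^ 2
          ≤ 2 * ∑ i, ‖r.g p W (k + 1) ω i‖ ^ 2 + 2 * ∑ i, ‖r.g p W k ω i‖ ^ 2 := by
        rw [Finset.mul_sum, Finset.mul_sum, ← Finset.sum_add_distrib]
        refine Finset.sum_le_sum fun i _ => ?_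
        have h3 := sq_norm_add_le one_pos (r.g p W (k + 1) ω i) (-r.g p W k ω i)
        rw [← sub_eq_add_neg, norm_neg] at h3
        norm_num at h3
        linarith
      refine (mul_le_mul_of_nonneg_left h2 hC).trans_eq ?_
      simp only [Pi.add_apply]
      ring
    · rw [integral_add' (hy.const_mul _) ((hg'.const_mul _).add (hg.const_mul _)),
        integral_add' (hg'.const_mul _) (hg.const_mul _), integral_const_mul, integral_const_mul,
        integral_const_mul]
      rfl
  have h2 := mul_le_mul_of_nonneg_left (r.gSq_le hD hp k) hC
  have h3 := mul_le_mul_of_nonneg_left (r.gSq_le hD hp (k + 1)) hC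
  have h4 : 0 ≤ C * gBound D p * (r.xSq p W k + r.xSq p W (k + 1)) :=
    mul_nonneg (mul_nonneg hC hB) (add_nonneg (r.xSq_nonneg k) (r.xSq_nonneg _))
  linarith

end Run

/-! ### One step of the averaged iterate. -/

section Descent

variable {m n d : ℕ} {D : Problem m n d} {p : Par} {W : Matrix (Fin m) (Fin m) ℝ}

lemma avg_gLoc (hD : D.Assumptions p) (k : ℕ) (x : Vec n) :
    avg (fun i => gLoc D p k i x)
      = (1 / (m : ℝ)) • (D.FTot x + p.reg k • gradient D.fTot x) := by
  simp only [avg, gLoc, Finset.sum_add_distrib, ← Finset.smul_sum, hD.gradient_fTot, Problem.FTot]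

lemma avg_gLoc_tik (hD : D.Assumptions p) (hp : p.Valid W) (k : ℕ) :
    avg (fun i => gLoc D p k i (D.tik (p.reg k))) = 0 := by
  rw [avg_gLoc hD, hD.tik_spec (hp.reg_pos k), smul_zero]

lemma sq_norm_avg_gLoc_sub_le (hD : D.Assumptions p) (hp : p.Valid W) (k : ℕ)
    (v w : Fin m → Vec n) :
    ‖avg (fun i => gLoc D p k i (v i) - gLoc D p k i (w i))‖ ^ 2
      ≤ (1 / (m : ℝ)) * (p.L 0 ^ 2 * ∑ i, ‖v i - w i‖ ^ 2) := by
  refine (sq_norm_avg_le _).trans ?_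
  rw [Finset.mul_sum (a := p.L 0 ^ 2)]
  gcongr with i
  rw [← mul_pow]
  exact pow_le_pow_left₀ (norm_nonneg _) (norm_gLoc_sub_le hD hp k i _ _) 2

/-- The averaged regularized step contracts towards the regularized solution. -/
lemma sq_norm_regularized_step_le (hD : D.Assumptions p) (hp : p.Valid W) (hm : 0 < m) {k : ℕ}
    (hk : p.step k * p.L 0 ^ 2 ≤ p.reg k * p.μf / m) (x : Vec n) :
    ‖x - D.tik (p.reg k) - p.step k • avg (fun i => gLoc D p k i x)‖ ^ 2
      ≤ (1 - p.step k * (p.reg k * p.μf / m)) * ‖x - D.tik (p.reg k)‖ ^ 2 := by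
  have hm' : (0 : ℝ) < m := by exact_mod_cast hm
  set z := D.tik (p.reg k) with hz
  have hγ := hp.step_pos k
  have hgz := avg_gLoc_tik hD hp k
  rw [norm_sub_sq_real, inner_smul_right, norm_smul, mul_pow, Real.norm_eq_abs, sq_abs]
  have h1 : ‖avg (fun i => gLoc D p k i x)‖ ^ 2 ≤ p.L 0 ^ 2 * ‖x - z‖ ^ 2 := by
    have h := sq_norm_avg_gLoc_sub_le hD hp k (fun _ => x) (fun _ => z)
    rw [avg_sub (fun i => gLoc D p k i x) (fun i => gLoc D p k i z), hgz, sub_zero] at h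
    refine h.trans_eq ?_
    simp
    field_simp
  have h2 : p.reg k * p.μf / m * ‖x - z‖ ^ 2 ≤ inner ℝ (x - z) (avg fun i => gLoc D p k i x) := by
    have h := hD.strongly_monotone_reg (hp.reg_pos k) x z
    rw [hD.tik_spec (hp.reg_pos k), sub_zero, real_inner_comm] at h
    rw [avg_gLoc hD, inner_smul_right, div_mul_eq_mul_div, one_div_mul_eq_div]
    gcongr
  have h3 := mul_le_mul_of_nonneg_left h2 hγ.le
  have h4 := mul_le_mul_of_nonneg_left h1 (sq_nonneg (p.step k))
  -- The cross term gives twice the contraction; `hk` lets the quadratic term consume one copy.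
  have h5 := mul_le_mul_of_nonneg_right hk (mul_nonneg hγ.le (sq_nonneg ‖x - z‖))
  nlinarith

/-- Two perturbations of the contracting step: local maps are evaluated at the local copies instead
of the average, and the reference point moves from z₀ to the current Tikhonov point. Young's
inequality with η = δ/4 is spent on each, and (1 + δ/4)²(1 - δ) ≤ 1 - δ/2. -/
lemma sq_norm_descent_le (hD : D.Assumptions p) (hp : p.Valid W) (hm : 0 < m) {k : ℕ}
    (hk : p.step k * p.L 0 ^ 2 ≤ p.reg k * p.μf / m) {δ : ℝ}
    (hδ : δ = p.step k * (p.reg k * p.μf / m)) (hδ1 : δ ≤ 1) (v : Fin m → Vec n) (z₀ : Vec n) :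
    ‖avg v - p.step k • avg (fun i => gLoc D p k i (v i)) - D.tik (p.reg k)‖ ^ 2
      ≤ (1 - δ / 2) * ‖avg v - z₀‖ ^ 2 + 5 / δ * ‖D.tik (p.reg k) - z₀‖ ^ 2
        + 5 / δ * (p.step k ^ 2 * p.L 0 ^ 2) * disagreement v := by
  have hm' : (1 : ℝ) ≤ m := by exact_mod_cast hm
  set z := D.tik (p.reg k) with hz
  have hγ := hp.step_pos k
  have hδ0 : 0 < δ := by
    have := hp.reg_pos k
    have := hD.μf_pos
    rw [hδ]; positivity
  set A := avg v - z - p.step k • avg (fun i => gLoc D p k i (avg v)) with hA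
  set b := p.step k • avg (fun i => gLoc D p k i (avg v) - gLoc D p k i (v i)) with hb
  have e : avg v - p.step k • avg (fun i => gLoc D p k i (v i)) - z = A + b := by
    rw [hA, hb, avg_sub, smul_sub]; abel
  have h1 : ‖A‖ ^ 2 ≤ (1 - δ) * ‖avg v - z‖ ^ 2 := by
    rw [hδ]; exact sq_norm_regularized_step_le hD hp hm hk _
  have h2 : ‖b‖ ^ 2 ≤ p.step k ^ 2 * p.L 0 ^ 2 * disagreement v := by
    rw [hb, norm_smul, mul_pow, Real.norm_eq_abs, sq_abs, mul_assoc]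
    refine mul_le_mul_of_nonneg_left ?_ (sq_nonneg _)
    refine (sq_norm_avg_gLoc_sub_le hD hp k (fun _ => avg v) v).trans ?_
    have h3 : ∑ i, ‖avg v - v i‖ ^ 2 = disagreement v := by
      simp only [disagreement, norm_sub_rev]
    rw [h3]
    have h4 : 0 ≤ p.L 0 ^ 2 * disagreement v := mul_nonneg (sq_nonneg _) (disagreement_nonneg v)
    have h5 : 1 / (m : ℝ) ≤ 1 := by rw [div_le_one (by linarith)]; exact hm'
    nlinarith
  have hη : 0 < δ / 4 := by positivity
  have h3 := sq_norm_add_le hη A b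
  have h4 := sq_norm_add_le hη (avg v - z₀) (z₀ - z)
  rw [sub_add_sub_cancel, norm_sub_rev z₀ z] at h4
  have h5 : 1 + (δ / 4)⁻¹ ≤ 5 / δ := by
    rw [inv_div, le_div_iff₀ hδ0, add_mul, div_mul_cancel₀ _ hδ0.ne']; linarith
  have h6 : (1 + δ / 4) * (1 - δ) ≤ 1 := by nlinarith
  have h7 : (1 + δ / 4) * (1 - δ) * (1 + δ / 4) ≤ 1 - δ / 2 := by nlinarith [sq_nonneg δ]
  have h8 : 0 ≤ (1 + δ / 4) * (1 - δ) := mul_nonneg (by linarith) (by linarith)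
  have hd := disagreement_nonneg v
  have i1 : (1 + δ / 4) * ‖A‖ ^ 2 ≤ (1 + δ / 4) * (1 - δ) * ‖avg v - z‖ ^ 2 := by
    rw [mul_assoc]; exact mul_le_mul_of_nonneg_left h1 (by linarith)
  have i2 : (1 + δ / 4) * (1 - δ) * ‖avg v - z‖ ^ 2
      ≤ (1 - δ / 2) * ‖avg v - z₀‖ ^ 2 + 5 / δ * ‖z - z₀‖ ^ 2 := by
    refine (mul_le_mul_of_nonneg_left h4 h8).trans ?_
    rw [mul_add, ← mul_assoc, ← mul_assoc]
    refine add_le_add (mul_le_mul_of_nonneg_right h7 (sq_nonneg _))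
      (mul_le_mul_of_nonneg_right ?_ (sq_nonneg _))
    refine (mul_le_mul_of_nonneg_left h5 h8).trans ?_
    exact mul_le_of_le_one_left (by positivity) h6
  have i3 : (1 + (δ / 4)⁻¹) * ‖b‖ ^ 2
      ≤ 5 / δ * (p.step k ^ 2 * p.L 0 ^ 2) * disagreement v := by
    rw [mul_assoc (5 / δ)]
    exact mul_le_mul h5 h2 (sq_nonneg _) (by positivity)
  rw [e]
  linarith

end Descent

namespace Run

variable {m n d : ℕ} {D : Problem m n d} {p : Par} {W : Matrix (Fin m) (Fin m) ℝ}
  {G : SimpleGraph (Fin m)} {Ω : Type*} [MeasurableSpace Ω] {P : Measure Ω}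
  [IsProbabilityMeasure P] (r : Run D P)

omit [IsProbabilityMeasure P] in
lemma e1_succ (k : ℕ) :
    r.e1 p W (k + 1) = ∫ ω, ‖avg (r.x p W (k + 1) ω) - D.tik (p.reg k)‖ ^ 2 ∂P := by
  simp only [e1, Nat.cast_add, Nat.cast_one, add_sub_cancel_right]

/-- The next average is a function of the current copies minus γ_k times the averaged noise. The
cross term integrates to zero, so the noise costs only γ_k² times its variance. -/
lemma e1_succ_le (hD : D.Assumptions p) (hp : p.Valid W) (hW : IsWeight G W) {k : ℕ}
    (hk : p.step k * p.L 0 ^ 2 ≤ p.reg k * p.μf / m) {δ : ℝ}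
    (hδ : δ = p.step k * (p.reg k * p.μf / m)) (hδ1 : δ ≤ 1) :
    r.e1 p W (k + 1) ≤ (1 - δ / 2) * r.e1 p W k
      + 5 / δ * ‖D.tik (p.reg k) - D.tik (p.reg ((k : ℝ) - 1))‖ ^ 2
      + 5 / δ * (p.step k ^ 2 * p.L 0 ^ 2) * r.e2 p W k + p.step k ^ 2 * p.var := by
  set z := D.tik (p.reg k) with hz
  set z₀ := D.tik (p.reg ((k : ℝ) - 1)) with hz₀
  have hm' : (1 : ℝ) ≤ m := by exact_mod_cast hW.pos
  set A : (Fin m → Vec n) → Vec n :=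
    fun v => avg v - p.step k • avg (fun i => gLoc D p k i (v i)) - z with hA
  have hAm : Measurable A := by
    have h : ∀ i, Measurable fun v : Fin m → Vec n => gLoc D p k i (v i) := fun i =>
      (continuous_gLoc hD k i).measurable.comp (measurable_pi_apply i)
    have h1 : Measurable fun v : Fin m → Vec n => avg v :=
      (Finset.measurable_fun_sum _ fun i _ => measurable_pi_apply i).fun_const_smul (1 / (m : ℝ))
    have h2 : Measurable fun v : Fin m → Vec n => avg (fun i => gLoc D p k i (v i)) :=
      (Finset.measurable_fun_sum _ fun i _ => h i).fun_const_smul (1 / (m : ℝ))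
    exact (h1.fun_sub (h2.fun_const_smul _)).fun_sub measurable_const
  have hx := r.memLp_x hD hp k
  have hAL : MemLp (fun ω => A (r.x p W k ω)) 2 P :=
    ((memLp_avg hx).sub ((memLp_avg (v := fun ω i => gLoc D p k i (r.x p W k ω i)) fun i =>
      memLp_comp_of_lipschitz (continuous_gLoc hD k i)
        (norm_gLoc_sub_le hD hp k i) (hx i)).const_smul (p.step k))).sub (memLp_const z)
  have herr := fun i => r.err_props hD hp k i
  have heL : MemLp (fun ω => avg (r.err p W k ω)) 2 P := memLp_avg fun i => (herr i).1
  have hcross : ∫ ω, inner ℝ (A (r.x p W k ω)) (avg (r.err p W k ω)) ∂P = 0 := by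
    simp only [avg, inner_smul_right, inner_sum]
    rw [integral_const_mul, integral_finsetSum _ fun i _ =>
      integrable_inner_of_memLp hAL (herr i).1]
    rw [Finset.sum_eq_zero fun i _ => (herr i).2.2 A hAm hAL, mul_zero]
  have hvar : ∫ ω, ‖avg (r.err p W k ω)‖ ^ 2 ∂P ≤ p.var := by
    have hs := integrable_sum_norm_sq fun i => (herr i).1
    have h1 : ∫ ω, ‖avg (r.err p W k ω)‖ ^ 2 ∂P
        ≤ ∫ ω, (1 / (m : ℝ)) * ∑ i, ‖r.err p W k ω i‖ ^ 2 ∂P :=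
      integral_mono (heL.integrable_norm_pow two_ne_zero) (hs.const_mul _)
        fun ω => sq_norm_avg_le _
    refine h1.trans ?_
    rw [integral_const_mul, integral_finsetSum _ fun i _ =>
      (herr i).1.integrable_norm_pow two_ne_zero]
    have h2 : ∑ i, ∫ ω, ‖r.err p W k ω i‖ ^ 2 ∂P ≤ m * p.var :=
      (Finset.sum_le_sum fun i _ => (herr i).2.1).trans_eq (by simp)
    refine (mul_le_mul_of_nonneg_left h2 (by positivity)).trans_eq ?_
    field_simp
  have hexp : ∀ ω, ‖avg (r.x p W (k + 1) ω) - z‖ ^ 2 = ‖A (r.x p W k ω)‖ ^ 2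
      + (-(2 * p.step k) * inner ℝ (A (r.x p W k ω)) (avg (r.err p W k ω))
        + p.step k ^ 2 * ‖avg (r.err p W k ω)‖ ^ 2) := by
    intro ω
    have e : avg (r.x p W (k + 1) ω) - z
        = A (r.x p W k ω) - p.step k • avg (r.err p W k ω) := by
      have e1 : avg (r.g p W k ω) = avg (fun i => gLoc D p k i (r.x p W k ω i))
          + avg (r.err p W k ω) := by
        rw [← avg_add]; congr 1; funext i; exact r.g_eq p W k ω i
      rw [r.avg_x_succ hW, e1, hA, smul_add]; simp only; abel
    rw [e, norm_sub_sq_real, inner_smul_right, norm_smul, mul_pow, Real.norm_eq_abs, sq_abs]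
    ring
  have hAi := hAL.integrable_norm_pow two_ne_zero
  have hei := heL.integrable_norm_pow two_ne_zero
  have hci := integrable_inner_of_memLp hAL heL
  have h1 : r.e1 p W (k + 1) ≤ ∫ ω, ‖A (r.x p W k ω)‖ ^ 2 ∂P + p.step k ^ 2 * p.var := by
    rw [e1_succ]
    simp only [← hz, hexp]
    have hs : Integrable (fun ω => -(2 * p.step k) * inner ℝ (A (r.x p W k ω))
        (avg (r.err p W k ω)) + p.step k ^ 2 * ‖avg (r.err p W k ω)‖ ^ 2) P :=
      (hci.const_mul _).add (hei.const_mul _)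
    rw [integral_add hAi hs, integral_add (hci.const_mul _) (hei.const_mul _), integral_const_mul, integral_const_mul,
      hcross, mul_zero, zero_add]
    have := mul_le_mul_of_nonneg_left hvar (sq_nonneg (p.step k))
    linarith
  have hi1 := (r.memLp_avg_sub hD hp k z₀).integrable_norm_pow two_ne_zero
  have hi2 := integrable_disagreement hx
  have h2 : ∫ ω, ‖A (r.x p W k ω)‖ ^ 2 ∂P ≤ (1 - δ / 2) * r.e1 p W k
      + 5 / δ * ‖z - z₀‖ ^ 2 + 5 / δ * (p.step k ^ 2 * p.L 0 ^ 2) * r.e2 p W k := by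
    refine (integral_mono hAi (((hi1.const_mul (1 - δ / 2)).add (integrable_const
      (5 / δ * ‖z - z₀‖ ^ 2))).add (hi2.const_mul (5 / δ * (p.step k ^ 2 * p.L 0 ^ 2))))
      fun ω => sq_norm_descent_le hD hp hW.pos hk hδ hδ1 _ z₀).trans_eq ?_
    rw [integral_add' ((hi1.const_mul _).add (integrable_const _)) (hi2.const_mul _),
      integral_add' (hi1.const_mul _) (integrable_const _), integral_const_mul,
      integral_const_mul, integral_const_mul]
    simp [e1, e2, hz₀]
  linarith

end Run

/-! ### Power form of the stepsizes and drift of the regularization. -/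

namespace Par.Valid

variable {m : ℕ} {p : Par} {W : Matrix (Fin m) (Fin m) ℝ} (hp : p.Valid W)
include hp

lemma one_le_add_Γ (k : ℕ) : 1 ≤ (k : ℝ) + p.Γ := by
  have := hp.one_le_Γ
  have : (0 : ℝ) ≤ k := Nat.cast_nonneg k
  linarith

lemma step_eq (k : ℕ) : p.step k = p.γ * ((k : ℝ) + p.Γ) ^ (-p.a) := by
  rw [Par.step, Real.rpow_neg (hp.add_Γ_pos k).le, div_eq_mul_inv]

lemma reg_eq (k : ℕ) : p.reg k = p.lam * ((k : ℝ) + p.Γ) ^ (-p.b) := by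
  rw [Par.reg, Real.rpow_neg (hp.add_Γ_pos k).le, div_eq_mul_inv]

lemma step_sq_eq (k : ℕ) : p.step k ^ 2 = p.γ ^ 2 * ((k : ℝ) + p.Γ) ^ (-(2 * p.a)) := by
  rw [hp.step_eq, mul_pow, ← Real.rpow_natCast (_ ^ _), ← Real.rpow_mul (hp.add_Γ_pos k).le]
  congr 2; push_cast; ring

lemma step_mul_reg (k : ℕ) :
    p.step k * p.reg k = p.γ * p.lam * ((k : ℝ) + p.Γ) ^ (-(p.a + p.b)) := by
  rw [hp.step_eq, hp.reg_eq, neg_add, Real.rpow_add (hp.add_Γ_pos k)]; ring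

lemma reg_sub_one_pos {k : ℕ} (h : k = 0 → 1 < p.Γ) : 0 < p.reg ((k : ℝ) - 1) := by
  have ht : 0 < (k : ℝ) - 1 + p.Γ := by
    rcases Nat.eq_zero_or_pos k with rfl | hk
    · have := h rfl; simp; linarith
    · have : (1 : ℝ) ≤ k := by exact_mod_cast hk
      have := hp.Γ_pos
      linarith
  exact div_pos hp.lam_pos (Real.rpow_pos_of_pos ht _)

/-- Since b < 1, the ratio (t/(t+1))^b with t = k - 1 + Γ lies between t/(t+1) and 1, hence differs
from 1 by at most 1/(t+1). -/
lemma Lam_le {k : ℕ} (hk : 1 ≤ k) : p.Lam ((k : ℝ) - 1) ≤ ((k : ℝ) + p.Γ) ^ (-1 : ℝ) := by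
  obtain ⟨j, rfl⟩ : ∃ j, k = j + 1 := ⟨k - 1, by omega⟩
  have ht := hp.add_Γ_pos j
  have e1 : ((j + 1 : ℕ) : ℝ) - 1 = j := by push_cast; ring
  rw [e1]
  set t := (j : ℝ) + p.Γ with htdef
  have e2 : ((j + 1 : ℕ) : ℝ) + p.Γ = t + 1 := by rw [htdef]; push_cast; ring
  have e3 : p.reg ((j : ℝ) + 1) / p.reg j = (t / (t + 1)) ^ p.b := by
    have hl := hp.lam_pos
    have h1 := Real.rpow_pos_of_pos ht p.b
    have h2 := Real.rpow_pos_of_pos (show 0 < t + 1 by linarith) p.b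
    have e4 : (j : ℝ) + 1 + p.Γ = t + 1 := by rw [htdef]; ring
    rw [Par.reg, Par.reg, e4, ← htdef, Real.div_rpow ht.le (by linarith)]
    field_simp
  rw [Par.Lam, e3, e2]
  have h0 : 0 < t / (t + 1) := by positivity
  have h1 : t / (t + 1) ≤ 1 := by rw [div_le_one (by linarith)]; linarith
  have h2 : t / (t + 1) ≤ (t / (t + 1)) ^ p.b := by
    have hb : p.b ≤ 1 := by have := hp.b_lt_a; have := hp.exponents; linarith [hp.b_pos]
    have := Real.rpow_le_rpow_of_exponent_ge h0 h1 hb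
    simpa using this
  have h3 : (t / (t + 1)) ^ p.b ≤ 1 := Real.rpow_le_one h0.le h1 hp.b_pos.le
  rw [abs_of_nonneg (by linarith), Real.rpow_neg_one]
  have h4 : 1 - t / (t + 1) = (t + 1)⁻¹ := by field_simp; ring
  linarith

lemma rate_le (hμ : 0 < p.μf) : p.μf * p.γ * p.lam / 2 ≤ p.Γ ^ (p.a + p.b) := by
  have h := hp.Γ_ge₁
  have h1 := hp.γ_pos
  have h2 := hp.lam_pos
  rw [one_div] at h
  exact (Real.rpow_inv_le_iff_of_pos (by positivity) hp.Γ_pos.le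
    (add_pos hp.a_pos hp.b_pos)).1 h

lemma θ₁_mul_le_one (hμ : 0 < p.μf) (k : ℕ) : θ₁ p * p.step k * p.reg k ≤ 1 := by
  have hab : 0 < p.a + p.b := add_pos hp.a_pos hp.b_pos
  have ht := hp.add_Γ_pos k
  have h1 := hp.rate_le hμ
  have h2 : p.Γ ^ (p.a + p.b) ≤ ((k : ℝ) + p.Γ) ^ (p.a + p.b) :=
    Real.rpow_le_rpow hp.Γ_pos.le (by have : (0 : ℝ) ≤ k := Nat.cast_nonneg k; linarith) hab.le
  have h3 : 0 < ((k : ℝ) + p.Γ) ^ (p.a + p.b) := Real.rpow_pos_of_pos ht _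
  rw [mul_assoc, hp.step_mul_reg, Real.rpow_neg ht.le, θ₁, ← div_eq_mul_inv, ← mul_div_assoc,
    div_le_one h3]
  linarith

end Par.Valid

namespace Problem.Assumptions

variable {m n d : ℕ} {D : Problem m n d} {p : Par} {W : Matrix (Fin m) (Fin m) ℝ}

lemma norm_tik_drift_le (hD : D.Assumptions p) (hp : p.Valid W) {T : ℝ}
    (hT : ∀ l, 0 < l → ‖D.tik l‖ ≤ T ∧ ‖gradient D.fTot (D.tik l)‖ ≤ T) {k : ℕ} (hk : 1 ≤ k) :
    ‖D.tik (p.reg k) - D.tik (p.reg ((k : ℝ) - 1))‖ ≤ T / p.μf * p.Lam ((k : ℝ) - 1) := by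
  have h := hD.norm_tik_sub_le (hp.reg_sub_one_pos (k := k) fun h => by omega) (hp.reg_pos k)
    (hT _ (hp.reg_pos k)).2
  rw [Par.Lam, sub_add_cancel]
  exact h

end Problem.Assumptions

/-! ### Order bounds for the three errors, with constants common to all runs. -/

section Order

variable {m n d : ℕ} {D : Problem m n d} {p : Par} {W : Matrix (Fin m) (Fin m) ℝ}
  {G : SimpleGraph (Fin m)}

/-- The three errors satisfy recursions of the form required by `coupled_decay`. -/
lemma exists_coupled (hD : D.Assumptions p) (hp : p.Valid W) (hW : IsWeight G W) {T : ℝ}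
    (hT : ∀ l, 0 < l → ‖D.tik l‖ ≤ T ∧ ‖gradient D.fTot (D.tik l)‖ ≤ T) :
    ∃ C, 0 ≤ C ∧ ∃ K₁ : ℕ, 1 ≤ K₁ ∧ ∀ (Ω : Type*) [MeasurableSpace Ω] (P : Measure Ω)
      [IsProbabilityMeasure P] (r : Run D P), ∀ k ≥ K₁,
      r.e1 p W (k + 1) ≤ (1 - p.γ * p.lam * p.μf / (2 * m)
          * ((k : ℝ) + p.Γ) ^ (-(p.a + p.b))) * r.e1 p W k + C * r.e2 p W k
          + C * ((k : ℝ) + p.Γ) ^ (-(2 * p.a)) ∧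
      r.e2 p W (k + 1) ≤ (1 - θ₄ W) * r.e2 p W k
          + C * ((k : ℝ) + p.Γ) ^ (-(2 * p.a)) * r.e3 p W k ∧
      r.e3 p W (k + 1) ≤ (1 - θ₄ W) * r.e3 p W k + C * (1 + r.e1 p W k + r.e2 p W k)
          + C * ((k : ℝ) + p.Γ) ^ (-(2 * p.a)) * r.e3 p W k := by
  obtain ⟨C3, hC3, h3⟩ := Run.exists_e3_succ_le hD hp hW
  have hm : (0 : ℝ) < m := by exact_mod_cast hW.pos
  have hγ := hp.γ_pos
  have hlam := hp.lam_pos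
  have hμ := hD.μf_pos
  have hT0 : 0 ≤ T := (norm_nonneg _).trans (hT 1 one_pos).1
  have hvar := p.var_nonneg
  have hθ5 := hW.θ₅_nonneg
  have hθ4 := hW.θ₄_pos
  set α := p.γ * p.lam * p.μf / (2 * m) with hα
  have hα0 : 0 < α := by positivity
  set Ca := 5 / (2 * α) * (T / p.μf) ^ 2 with hCa
  set Cb := 5 / (2 * α) * (p.γ ^ 2 * p.L 0 ^ 2) with hCb
  have hCa0 : 0 ≤ Ca := by positivity
  have hCb0 : 0 ≤ Cb := by positivity
  -- γ_k/λ_k tends to zero because b < a, so the stepsize condition of the descent step holds from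
  -- some index on.
  have ev1 := eventually_const_mul_le (tendsto_rpow_neg_nat_add p.Γ (s := p.a - p.b)
    (by have := hp.b_lt_a; linarith)) (p.γ * p.L 0 ^ 2) (show 0 < p.lam * p.μf / m by positivity)
  have ev2 := eventually_const_mul_le (tendsto_rpow_neg_nat_add p.Γ (s := p.a + p.b)
    (add_pos hp.a_pos hp.b_pos)) (2 * α) one_pos
  obtain ⟨K, hK⟩ := eventually_atTop.1 (ev1.and ev2)
  set X := C3 * (1 + 4 * m * T ^ 2 + 2 * m * (Ca + p.γ ^ 2 * p.var) + 4 * m + 2 + 2 * m * Cb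
    + θ₅ W * p.γ ^ 2) with hX
  have hX0 : 0 ≤ X := by positivity
  set C := Ca + Cb + p.γ ^ 2 * p.var + θ₅ W * p.γ ^ 2 + X with hC
  have hγv : 0 ≤ p.γ ^ 2 * p.var := by positivity
  have hθγ : 0 ≤ θ₅ W * p.γ ^ 2 := by positivity
  refine ⟨C, by positivity, K + 1, by omega, fun Ω _ P _ r k hk => ?_⟩
  obtain ⟨f1, f2⟩ := hK k (by omega)
  have ht := hp.add_Γ_pos k
  have ht1 := hp.one_le_add_Γ k
  set t := (k : ℝ) + p.Γ with htdef
  have hg0 : 0 < t ^ (-(2 * p.a)) := Real.rpow_pos_of_pos ht _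
  have hg1 : t ^ (-(2 * p.a)) ≤ 1 :=
    Real.rpow_le_one_of_one_le_of_nonpos ht1 (by have := hp.a_pos; linarith)
  set g := t ^ (-(2 * p.a)) with hg
  set δ := p.step k * (p.reg k * p.μf / m) with hδ
  have hδe : δ = 2 * α * t ^ (-(p.a + p.b)) := by
    rw [hδ, mul_div_assoc, ← mul_assoc, hp.step_mul_reg, ← htdef, hα]; field_simp
  have hcond : p.step k * p.L 0 ^ 2 ≤ p.reg k * p.μf / m := by
    have e : p.step k = p.γ * t ^ (-(p.a - p.b)) * t ^ (-p.b) := by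
      rw [hp.step_eq, ← htdef, mul_assoc, ← Real.rpow_add ht]; congr 2; ring
    rw [e, hp.reg_eq, ← htdef]
    have := mul_le_mul_of_nonneg_right f1 (Real.rpow_pos_of_pos ht (-p.b)).le
    calc _ = p.γ * p.L 0 ^ 2 * t ^ (-(p.a - p.b)) * t ^ (-p.b) := by ring
      _ ≤ _ := this
      _ = _ := by ring
  have hδ5 : 5 / δ = 5 / (2 * α) * t ^ (p.a + p.b) := by
    rw [hδe, Real.rpow_neg ht.le]; field_simp
  have hE1 := r.e1_nonneg (p := p) (W := W) k
  have hE2 := r.e2_nonneg (p := p) (W := W) k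
  have hE3 := r.e3_nonneg (p := p) (W := W) k
  have r1 : r.e1 p W (k + 1) ≤ (1 - α * t ^ (-(p.a + p.b))) * r.e1 p W k
      + Cb * r.e2 p W k + (Ca + p.γ ^ 2 * p.var) * g := by
    have h := r.e1_succ_le hD hp hW hcond hδ (by rw [hδe]; exact f2)
    -- The squared drift is of order t^(-2) and 1/δ of order t^(a+b); the product is O(t^(-2a))
    -- because 3a + b < 2.
    have hd : 5 / δ * ‖D.tik (p.reg k) - D.tik (p.reg ((k : ℝ) - 1))‖ ^ 2 ≤ Ca * g := by
      have h1 : ‖D.tik (p.reg k) - D.tik (p.reg ((k : ℝ) - 1))‖ ≤ T / p.μf * t ^ (-1 : ℝ) :=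
        (hD.norm_tik_drift_le hp hT (by omega)).trans
          (mul_le_mul_of_nonneg_left (hp.Lam_le (by omega)) (by positivity))
      have h2 := pow_le_pow_left₀ (norm_nonneg _) h1 2
      have h3 : t ^ (p.a + p.b) * (t ^ (-1 : ℝ)) ^ 2 ≤ g := by
        rw [← Real.rpow_natCast (t ^ (-1 : ℝ)), ← Real.rpow_mul ht.le, ← Real.rpow_add ht]
        refine Real.rpow_le_rpow_of_exponent_le ht1 ?_
        have := hp.exponents
        push_cast; linarith
      rw [hδ5]
      calc 5 / (2 * α) * t ^ (p.a + p.b)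
            * ‖D.tik (p.reg k) - D.tik (p.reg ((k : ℝ) - 1))‖ ^ 2
          ≤ 5 / (2 * α) * t ^ (p.a + p.b) * (T / p.μf * t ^ (-1 : ℝ)) ^ 2 :=
            mul_le_mul_of_nonneg_left h2
              (mul_nonneg (by positivity) (Real.rpow_pos_of_pos ht _).le)
        _ = Ca * (t ^ (p.a + p.b) * (t ^ (-1 : ℝ)) ^ 2) := by rw [hCa]; ring
        _ ≤ Ca * g := mul_le_mul_of_nonneg_left h3 hCa0
    -- Here γ_k²/δ is of order t^(b-a), which stays bounded.
    have hb : 5 / δ * (p.step k ^ 2 * p.L 0 ^ 2) ≤ Cb := by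
      have h3 : t ^ (p.a + p.b) * g ≤ 1 := by
        rw [hg, ← Real.rpow_add ht]
        exact Real.rpow_le_one_of_one_le_of_nonpos ht1 (by have := hp.b_lt_a; linarith)
      rw [hδ5, hp.step_sq_eq, ← htdef, ← hg]
      calc 5 / (2 * α) * t ^ (p.a + p.b) * (p.γ ^ 2 * g * p.L 0 ^ 2)
          = Cb * (t ^ (p.a + p.b) * g) := by rw [hCb]; ring
        _ ≤ Cb * 1 := mul_le_mul_of_nonneg_left h3 hCb0
        _ = Cb := mul_one _
    have hb' := mul_le_mul_of_nonneg_right hb hE2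
    have hδh : δ / 2 = α * t ^ (-(p.a + p.b)) := by rw [hδe]; ring
    rw [hδh, hp.step_sq_eq, ← htdef, ← hg] at h
    rw [hp.step_sq_eq, ← htdef, ← hg] at hb'
    linarith
  have r2 : r.e2 p W (k + 1) ≤ (1 - θ₄ W) * r.e2 p W k + θ₅ W * p.γ ^ 2 * g * r.e3 p W k := by
    have h := r.e2_succ_le hD hp hW k
    rw [hp.step_sq_eq, ← htdef, ← hg] at h
    linarith
  have hδ0 : 0 ≤ α * t ^ (-(p.a + p.b)) := mul_nonneg hα0.le (Real.rpow_pos_of_pos ht _).le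
  have r3 : r.e3 p W (k + 1) ≤ (1 - θ₄ W) * r.e3 p W k
      + X * (1 + r.e1 p W k + r.e2 p W k) + X * g * r.e3 p W k := by
    have h := h3 Ω P r k
    have q1 := r.xSq_le hD hp hW k (hT _ (hp.reg_sub_one_pos (k := k) fun h => by omega)).1
    have q2 := r.xSq_le hD hp hW (k + 1)
      (hT _ (hp.reg_sub_one_pos (k := k + 1) fun h => by omega)).1
    have q3 : r.e1 p W (k + 1) ≤ r.e1 p W k + Cb * r.e2 p W k + (Ca + p.γ ^ 2 * p.var) := by
      have := mul_nonneg hδ0 hE1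
      have := mul_le_mul_of_nonneg_left hg1 (add_nonneg hCa0 hγv)
      linarith
    have q4 : r.e2 p W (k + 1) ≤ r.e2 p W k + θ₅ W * p.γ ^ 2 * g * r.e3 p W k := by
      have := mul_nonneg hθ4.le hE2
      linarith
    have q5 := mul_le_mul_of_nonneg_left q3 (show (0 : ℝ) ≤ 2 * m by positivity)
    have q6 : 1 + r.xSq p W k + r.xSq p W (k + 1) ≤
        (1 + 4 * m * T ^ 2 + 2 * m * (Ca + p.γ ^ 2 * p.var) + 4 * m + 2 + 2 * m * Cb
          + θ₅ W * p.γ ^ 2) * (1 + r.e1 p W k + r.e2 p W k)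
        + (1 + 4 * m * T ^ 2 + 2 * m * (Ca + p.γ ^ 2 * p.var) + 4 * m + 2 + 2 * m * Cb
          + θ₅ W * p.γ ^ 2) * g * r.e3 p W k := by
      set Y := 1 + 4 * m * T ^ 2 + 2 * m * (Ca + p.γ ^ 2 * p.var) + 4 * m + 2 + 2 * m * Cb
          + θ₅ W * p.γ ^ 2 with hY
      have z1 : 0 ≤ 4 * m * T ^ 2 := by positivity
      have z2 : 0 ≤ 2 * m * (Ca + p.γ ^ 2 * p.var) := by positivity
      have z3 : 0 ≤ 2 * m * Cb := by positivity
      have y1 : (1 + 4 * m * T ^ 2 + 2 * m * (Ca + p.γ ^ 2 * p.var)) * 1 ≤ Y * 1 :=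
        mul_le_mul_of_nonneg_right (by linarith) zero_le_one
      have y2 : (4 * m) * r.e1 p W k ≤ Y * r.e1 p W k :=
        mul_le_mul_of_nonneg_right (by linarith) hE1
      have y3 : (2 + 2 * m * Cb) * r.e2 p W k ≤ Y * r.e2 p W k :=
        mul_le_mul_of_nonneg_right (by linarith) hE2
      have y4 : θ₅ W * p.γ ^ 2 * (g * r.e3 p W k) ≤ Y * (g * r.e3 p W k) :=
        mul_le_mul_of_nonneg_right (by linarith) (by positivity)
      linarith
    have q7 := mul_le_mul_of_nonneg_left q6 hC3
    rw [hX]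
    linarith
  have hCX : X ≤ C := by linarith
  refine ⟨r1.trans ?_, r2.trans ?_, r3.trans ?_⟩
  · have y1 : Cb * r.e2 p W k ≤ C * r.e2 p W k :=
      mul_le_mul_of_nonneg_right (by linarith) hE2
    have y2 : (Ca + p.γ ^ 2 * p.var) * g ≤ C * g :=
      mul_le_mul_of_nonneg_right (by linarith) hg0.le
    linarith
  · have y1 : θ₅ W * p.γ ^ 2 * (g * r.e3 p W k) ≤ C * (g * r.e3 p W k) :=
      mul_le_mul_of_nonneg_right (by linarith) (by positivity)
    linarith
  · have y1 : X * (1 + r.e1 p W k + r.e2 p W k) ≤ C * (1 + r.e1 p W k + r.e2 p W k) :=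
      mul_le_mul_of_nonneg_right hCX (by positivity)
    have y2 : X * (g * r.e3 p W k) ≤ C * (g * r.e3 p W k) :=
      mul_le_mul_of_nonneg_right hCX (by positivity)
    linarith

/-- Order bounds for the three errors, and the recursion of the first error with the nominal
contraction factor. -/
lemma exists_orderBounds (hD : D.Assumptions p) (hp : p.Valid W) (hW : IsWeight G W) {T : ℝ}
    (hT : ∀ l, 0 < l → ‖D.tik l‖ ≤ T ∧ ‖gradient D.fTot (D.tik l)‖ ≤ T) (R : ℝ) :
    ∃ c, 0 < c ∧ ∃ C', 0 < C' ∧ ∀ (Ω : Type*) [MeasurableSpace Ω] (P : Measure Ω)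
      [IsProbabilityMeasure P] (r : Run D P), ∑ i, ∫ ω, ‖r.x0 i ω‖ ^ 2 ∂P ≤ R →
      r.OrderBounds p W c ∧ ∀ k : ℕ, (k = 0 → 1 < p.Γ) → r.e1 p W (k + 1)
        ≤ (1 - θ₁ p * p.step k * p.reg k) * r.e1 p W k + C' * p.step k ^ 2 := by
  obtain ⟨C, hC, K₁, hK₁, hrec⟩ := exists_coupled hD hp hW hT
  have hm : (0 : ℝ) < m := by exact_mod_cast hW.pos
  have hγ := hp.γ_pos
  have hlam := hp.lam_pos
  have hμ := hD.μf_pos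
  have ha := hp.a_pos
  have hb := hp.b_pos
  have hab := hp.b_lt_a
  have h3ab := hp.exponents
  obtain ⟨K₀, hK₀⟩ := coupled_decay hp.b_pos hp.b_lt_a hp.exponents hp.one_le_Γ
    (α := p.γ * p.lam * p.μf / (2 * m)) (by positivity) hW.θ₄_pos (θ₄_lt_one W).le hC
  -- From `K` on the rates come from the recursions; before `K` the moment bound, inflated by tK²,
  -- dominates every rate, all exponents being at most 2.
  set K := max K₀ K₁ with hK
  obtain ⟨S, hS, hmom⟩ := Run.exists_moment_bound hD hp hW R K
  obtain ⟨c₀, hc₀, hdec⟩ := hK₀ K (le_max_left _ _) (2 * S + 2 * T ^ 2)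
  have htK := hp.one_le_add_Γ K
  set tK := (K : ℝ) + p.Γ with htKdef
  set c := c₀ + (2 * S + 2 * T ^ 2) * tK ^ 2 with hc
  have hcp : 0 < c := by positivity
  -- The first part treats k ≥ K, where the nominal contraction term, the disagreement and the noise
  -- are all multiples of t^(-2a); the second treats k ≤ K, where c is at most c · tK² · t^(-2a).
  -- Division by γ² converts t^(-2a) into γ_k².
  set C' := (p.μf * p.γ * p.lam / 2 * c₀ + C * c₀ + C) / p.γ ^ 2 + c * tK ^ 2 / p.γ ^ 2 with hC'
  have hsmall : ∀ (k : ℕ), k ≤ K → ∀ s : ℝ, s ≤ 2 → ((k : ℝ) + p.Γ) ^ s ≤ tK ^ 2 := by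
    intro k hk s hs
    have h1 := hp.one_le_add_Γ k
    calc ((k : ℝ) + p.Γ) ^ s ≤ ((k : ℝ) + p.Γ) ^ (2 : ℝ) :=
          Real.rpow_le_rpow_of_exponent_le h1 hs
      _ = ((k : ℝ) + p.Γ) ^ 2 := Real.rpow_two _
      _ ≤ tK ^ 2 := by
          refine pow_le_pow_left₀ (by linarith) ?_ 2
          have : (k : ℝ) ≤ K := by exact_mod_cast hk
          linarith
  refine ⟨c, hcp, C', by positivity, fun Ω _ P _ r hR => ?_⟩
  have hbd : ∀ k ≤ K, ((k = 0 → 1 < p.Γ) → r.e1 p W k ≤ 2 * S + 2 * T ^ 2) ∧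
      r.e2 p W k ≤ 2 * S + 2 * T ^ 2 ∧ r.e3 p W k ≤ 2 * S + 2 * T ^ 2 := by
    intro k hk
    have h1 := hmom Ω P r hR k hk
    have hx := r.xSq_nonneg (p := p) (W := W) k
    have hy := r.ySq_nonneg (p := p) (W := W) k
    have h2 := r.e2_le_xSq hD hp k
    have h3 := r.e3_le_ySq hD hp k
    have hT2 := sq_nonneg T
    refine ⟨fun h => ?_, by linarith, by linarith⟩
    have := r.e1_le_xSq hD hp hW k (hT _ (hp.reg_sub_one_pos h)).1
    linarith
  have hK1 : 1 ≤ K := hK₁.trans (le_max_right _ _)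
  obtain ⟨b1, b2, b3⟩ := hbd K le_rfl
  have hdecr := hdec (r.e1 p W) (r.e2 p W) (r.e3 p W) r.e1_nonneg r.e2_nonneg r.e3_nonneg
    (b1 fun h => by omega) b2 b3
    (fun k hk => (hrec Ω P r k ((le_max_right _ _).trans hk)).1)
    (fun k hk => (hrec Ω P r k ((le_max_right _ _).trans hk)).2.1)
    (fun k hk => (hrec Ω P r k ((le_max_right _ _).trans hk)).2.2)
  have hc0c : c₀ ≤ c := by
    have : 0 ≤ (2 * S + 2 * T ^ 2) * tK ^ 2 := by positivity
    linarith
  have hSc : (2 * S + 2 * T ^ 2) * tK ^ 2 ≤ c := by linarith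
  have hS0 : 0 ≤ 2 * S + 2 * T ^ 2 := by positivity
  have horder : r.OrderBounds p W c := by
    intro k
    have ht := hp.add_Γ_pos k
    rcases le_total K k with hk | hk
    · obtain ⟨d1, d2, d3⟩ := hdecr k hk
      have conv : ∀ s x : ℝ, x ≤ c₀ * ((k : ℝ) + p.Γ) ^ (-s) → x ≤ c / ((k : ℝ) + p.Γ) ^ s := by
        intro s x hx
        rw [div_eq_mul_inv, ← Real.rpow_neg ht.le]
        exact hx.trans (mul_le_mul_of_nonneg_right hc0c (Real.rpow_pos_of_pos ht _).le)
      exact ⟨fun _ => conv _ _ d1, conv _ _ d2, d3.trans hc0c⟩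
    · obtain ⟨d1, d2, d3⟩ := hbd k hk
      have conv : ∀ s x : ℝ, s ≤ 2 → x ≤ 2 * S + 2 * T ^ 2 → x ≤ c / ((k : ℝ) + p.Γ) ^ s := by
        intro s x hs hx
        rw [le_div_iff₀ (Real.rpow_pos_of_pos ht _)]
        calc x * ((k : ℝ) + p.Γ) ^ s ≤ (2 * S + 2 * T ^ 2) * ((k : ℝ) + p.Γ) ^ s :=
              mul_le_mul_of_nonneg_right hx (Real.rpow_pos_of_pos ht _).le
          _ ≤ (2 * S + 2 * T ^ 2) * tK ^ 2 :=
              mul_le_mul_of_nonneg_left (hsmall k hk s hs) hS0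
          _ ≤ c := hSc
      refine ⟨fun h => conv _ _ (by linarith) (d1 h), conv _ _ (by linarith) d2, d3.trans ?_⟩
      have : 2 * S + 2 * T ^ 2 ≤ (2 * S + 2 * T ^ 2) * tK ^ 2 :=
        le_mul_of_one_le_right hS0 (one_le_pow₀ htK)
      linarith
  refine ⟨horder, fun k hk0 => ?_⟩
  have ht := hp.add_Γ_pos k
  have hE1 := r.e1_nonneg (p := p) (W := W) k
  rw [hp.step_sq_eq]
  set g := ((k : ℝ) + p.Γ) ^ (-(2 * p.a)) with hg
  have hg0 : 0 < g := Real.rpow_pos_of_pos ht _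
  have hC'g : C' * (p.γ ^ 2 * g)
      = (p.μf * p.γ * p.lam / 2 * c₀ + C * c₀ + C) * g + c * tK ^ 2 * g := by
    rw [hC']; field_simp
  rw [hC'g]
  rcases le_total K k with hk | hk
  · obtain ⟨d1, d2, -⟩ := hdecr k hk
    have h1 := (hrec Ω P r k ((le_max_right _ _).trans hk)).1
    have h2 : θ₁ p * p.step k * p.reg k * r.e1 p W k ≤ p.μf * p.γ * p.lam / 2 * c₀ * g := by
      have e : ((k : ℝ) + p.Γ) ^ (-(p.a + p.b)) * ((k : ℝ) + p.Γ) ^ (-(p.a - p.b)) = g := by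
        rw [← Real.rpow_add ht, hg]; congr 1; ring
      -- The exponents add up as (a + b) + (a - b) = 2a: the whole nominal contraction term is of
      -- noise size.
      rw [mul_assoc (θ₁ p), hp.step_mul_reg, θ₁]
      have h3 := mul_le_mul_of_nonneg_left d1 (show 0 ≤ 0.5 * p.μf
        * (p.γ * p.lam * ((k : ℝ) + p.Γ) ^ (-(p.a + p.b))) by
          have := Real.rpow_pos_of_pos ht (-(p.a + p.b)); positivity)
      refine h3.trans_eq ?_
      rw [← e]; ring
    have h3 := mul_le_mul_of_nonneg_left d2 hC
    have h4 : 0 ≤ p.γ * p.lam * p.μf / (2 * m) * ((k : ℝ) + p.Γ) ^ (-(p.a + p.b))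
        * r.e1 p W k := by
      have := Real.rpow_pos_of_pos ht (-(p.a + p.b)); positivity
    have h5 : 0 ≤ c * tK ^ 2 * g := by positivity
    linarith
  · have h1 : r.e1 p W (k + 1) ≤ c := by
      refine ((horder (k + 1)).1 fun h => by omega).trans ?_
      exact div_le_self hcp.le (Real.one_le_rpow (hp.one_le_add_Γ (k + 1)) (by linarith))
    have h2 : 0 ≤ (1 - θ₁ p * p.step k * p.reg k) * r.e1 p W k :=
      mul_nonneg (by linarith [hp.θ₁_mul_le_one hμ k]) hE1
    have h3 : c ≤ c * tK ^ 2 * g := by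
      have h4 := hsmall k hk (2 * p.a) (by linarith)
      have h5 : 1 ≤ tK ^ 2 * g := by
        rw [hg, Real.rpow_neg ht.le, ← div_eq_mul_inv, le_div_iff₀ (Real.rpow_pos_of_pos ht _),
          one_mul]
        exact h4
      rw [mul_assoc]
      exact le_mul_of_one_le_right hcp.le h5
    have h4 : 0 ≤ (p.μf * p.γ * p.lam / 2 * c₀ + C * c₀ + C) * g := by positivity
    linarith

end Order

/-! ### Positivity of the scalars -/

section Theta

variable {m n d : ℕ} {D : Problem m n d} {p : Par} {W : Matrix (Fin m) (Fin m) ℝ}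
  {G : SimpleGraph (Fin m)}

lemma Par.Valid.step_zero_pos (hp : p.Valid W) : 0 < p.step 0 := by
  simpa using hp.step_pos 0

lemma Par.Valid.reg_zero_pos (hp : p.Valid W) : 0 < p.reg 0 := by
  simpa using hp.reg_pos 0

lemma θ₁_pos (hD : D.Assumptions p) : 0 < θ₁ p := by
  have := hD.μf_pos
  unfold θ₁; positivity

lemma θ₂_pos (hD : D.Assumptions p) (hp : p.Valid W) (hm : 0 < m) : 0 < θ₂ p m := by
  have h1 := hD.μf_pos
  have h2 := L_zero_pos hD hp
  have h3 := hp.step_zero_pos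
  have h4 := hp.reg_zero_pos
  have h5 := hp.γ_pos
  have h6 := hp.lam_pos
  unfold θ₂; positivity

lemma θ₇_pos (hD : D.Assumptions p) (hp : p.Valid W) (hm : 0 < m) : 0 < θ₇ p m := by
  have h1 := L_zero_pos hD hp
  have h2 := hp.ζ_pos
  have h3 := hp.Γ_pos
  unfold θ₇; positivity

lemma θ₈_pos (hD : D.Assumptions p) (hp : p.Valid W) : 0 < θ₈ p W := by
  have h1 := L_zero_pos hD hp
  have h2 := hp.ζ_pos
  have h3 := hp.Γ_pos
  have h4 := hp.γ_pos
  have h5 : 0 ≤ frobSq (W - 1) :=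
    Finset.sum_nonneg fun _ _ => Finset.sum_nonneg fun _ _ => sq_nonneg _
  have h6 := Real.rpow_pos_of_pos h3 (2 * p.a)
  unfold θ₈; positivity

/-- The coefficient of `M ^ 2` in `θ₃`. -/
def θ₃Coeff (p : Par) : ℝ :=
  2 / (p.μf ^ 3 * p.lam * p.γ ^ 3 * p.Γ ^ (2 - 3 * p.a - p.b))

lemma θ₃Coeff_pos (hD : D.Assumptions p) (hp : p.Valid W) : 0 < θ₃Coeff p := by
  have h1 := hD.μf_pos
  have h2 := hp.γ_pos
  have h3 := hp.lam_pos
  have h4 := Real.rpow_pos_of_pos hp.Γ_pos (2 - 3 * p.a - p.b)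
  unfold θ₃Coeff; positivity

lemma θ₃Coeff_mul_le (hp : p.Valid W) (M : ℝ) : θ₃Coeff p * M ^ 2 ≤ θ₃ p M m := by
  have h1 : 0 ≤ 2 * (p.νF ^ 2 * p.Γ ^ (2 * p.b) + p.lam ^ 2 * p.νf ^ 2)
      / (m * p.Γ ^ (2 * p.b)) := by
    have h2 := Real.rpow_pos_of_pos hp.Γ_pos (2 * p.b)
    positivity
  unfold θ₃Coeff θ₃
  rw [div_mul_eq_mul_div]
  linarith

/-- All other summands are nonnegative, so `B` alone can make `θ₉` exceed any prescribed bound on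
the tracking error. -/
lemma le_θ₉ (hp : p.Valid W) (M B : ℝ) : 6 * (1 / p.Γ ^ 2) * B ^ 2 ≤ θ₉ p M B m := by
  have h1 := hp.ζ_pos
  have h2 := hp.Γ_pos
  have h3 : 0 ≤ p.ζ⁻¹ * (6 * (1 / p.Γ ^ 2) * B ^ 2) := by positivity
  have h4 : 0 ≤ (1 + p.ζ⁻¹) * 12 * (p.νF ^ 2 + p.lam ^ 2 / p.Γ ^ 2 * p.νf ^ 2) := by positivity
  have h5 : 0 ≤ 4 * m * (p.νF ^ 2 + p.lam ^ 2 / p.Γ ^ 2 * p.νf ^ 2) := by positivity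
  have h6 : 0 ≤ 4 * (p.νF ^ 2 + p.lam ^ 2 / p.Γ ^ 2 * p.νf ^ 2) := by positivity
  have h7 : 0 ≤ (1 + p.ζ⁻¹) * 12 * m * p.L 0 ^ 2 * (M ^ 2 / p.μf ^ 2) * (4 / p.Γ ^ 2 + 1)
    * (1 / p.Γ ^ 2) := by positivity
  unfold θ₉
  linarith

/-- The stepsize conditions give `4 (1 + ζ⁻¹) L₀² γ₀² ≤ ζ`. -/
lemma Par.Valid.ζ_ge (hD : D.Assumptions p) (hp : p.Valid W) :
    (1 + p.ζ⁻¹) * (4 * p.L 0 ^ 2 * p.step 0 ^ 2) ≤ p.ζ := by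
  have hζ := hp.ζ_pos
  have hγ := hp.γ_pos
  have hl := hp.lam_pos
  have hLF := hD.LF_pos
  have hLf := hD.Lf_pos
  have hΓ := hp.Γ_pos
  have ha := Real.rpow_pos_of_pos hΓ p.a
  have hb := Real.rpow_pos_of_pos hΓ p.b
  have h2 : p.lam * p.Lf / p.LF ≤ p.Γ ^ p.b := by
    have h := hp.Γ_ge₂
    rw [one_div] at h
    exact (Real.rpow_inv_le_iff_of_pos (by positivity) hΓ.le hp.b_pos).1 h
  have h4 : 4 * p.γ * p.LF * p.ζ⁻¹ * √(1 + p.ζ) ≤ p.Γ ^ p.a := by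
    have h := hp.Γ_ge₄
    rw [one_div] at h
    exact (Real.rpow_inv_le_iff_of_pos (by positivity) hΓ.le hp.a_pos).1 h
  -- The second lower bound on Γ is exactly λ₀ L_f ≤ L_F.
  have hL : p.L 0 ≤ 2 * p.LF := by
    have : p.reg 0 * p.Lf ≤ p.LF := by
      rw [Par.reg, zero_add, div_mul_eq_mul_div, div_le_iff₀ hb]
      rw [div_le_iff₀ hLF] at h2
      linarith
    unfold Par.L; linarith
  have hs : p.step 0 * p.Γ ^ p.a = p.γ := by
    rw [Par.step, zero_add]; field_simp
  have hstep := hp.step_zero_pos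
  have h5 : 4 * p.step 0 * p.LF * √(1 + p.ζ) ≤ p.ζ := by
    have h6 : 4 * p.γ * p.LF * √(1 + p.ζ) ≤ p.Γ ^ p.a * p.ζ := by
      have := mul_le_mul_of_nonneg_right h4 hζ.le
      refine le_trans (le_of_eq ?_) this
      field_simp
    rw [← hs] at h6
    refine le_of_mul_le_mul_right ?_ ha
    linarith
  have h7 := pow_le_pow_left₀ (by positivity) h5 2
  rw [mul_pow, Real.sq_sqrt (by positivity)] at h7
  have hL0 := L_zero_pos hD hp
  have h8 : p.L 0 ^ 2 ≤ (2 * p.LF) ^ 2 := pow_le_pow_left₀ hL0.le hL 2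
  have h9 : (1 + p.ζ) * (4 * p.L 0 ^ 2 * p.step 0 ^ 2) ≤ p.ζ ^ 2 := by
    refine le_trans ?_ h7
    have := mul_le_mul_of_nonneg_left h8
      (show 0 ≤ (1 + p.ζ) * (4 * p.step 0 ^ 2) by positivity)
    linarith
  have e : 1 + p.ζ⁻¹ = (1 + p.ζ) / p.ζ := by field_simp; ring
  rw [e, div_mul_eq_mul_div, div_le_iff₀ hζ]
  linarith

/-- By `Par.Valid.ζ_ge` the bracket is at most 2ζ + 1, and the upper bound on ζ gives 2ζρ² ≤ (1 -
ρ²)/2; hence θ₆ ≥ (1 - ρ²)/2. -/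
lemma θ₆_pos (hD : D.Assumptions p) (hp : p.Valid W) (hW : IsWeight G W) : 0 < θ₆ p W := by
  have h1 := hp.ζ_ge hD
  have h2 := hW.rho_sq_lt_one
  have h3 : ((1 + p.ζ⁻¹) * (4 * p.L 0 ^ 2 * p.step 0 ^ 2) + p.ζ + 1) * rho W ^ 2
      ≤ (2 * p.ζ + 1) * rho W ^ 2 := mul_le_mul_of_nonneg_right (by linarith) (sq_nonneg _)
  have h4 : 2 * p.ζ * rho W ^ 2 ≤ (1 - rho W ^ 2) / 2 := by
    rcases (rho_nonneg W).eq_or_lt with h0 | h0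
    · rw [← h0]; norm_num
    · have h5 := hp.ζ_le h0
      rw [le_div_iff₀ (by positivity)] at h5
      linarith
  unfold θ₆
  linarith

lemma θ₆_le_one (hp : p.Valid W) : θ₆ p W ≤ 1 := by
  have hζ := hp.ζ_pos
  have : 0 ≤ ((1 + p.ζ⁻¹) * (4 * p.L 0 ^ 2 * p.step 0 ^ 2) + p.ζ + 1) * rho W ^ 2 := by
    positivity
  unfold θ₆; linarith

lemma θ₆_lt_one (hp : p.Valid W) (h : 0 < rho W) : θ₆ p W < 1 := by
  have hζ := hp.ζ_pos
  have : 0 < ((1 + p.ζ⁻¹) * (4 * p.L 0 ^ 2 * p.step 0 ^ 2) + p.ζ + 1) * rho W ^ 2 := by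
    positivity
  unfold θ₆; linarith

/-! ### The scalars of the explicit bounds -/

/-- The ratio between the explicit bounds of the second and of the first error. -/
def ratio₂ (p : Par) (W : Matrix (Fin m) (Fin m) ℝ) : ℝ :=
  12 * θ₅ W * θ₇ p m * p.γ ^ 2 / (θ₄ W * θ₆ p W)

/-- The common denominator of the explicit bounds, divided by `e_{1,0}`. -/
def denom (p : Par) (W : Matrix (Fin m) (Fin m) ℝ) : ℝ :=
  (p.γ * p.lam * θ₁ p - 1) * p.Γ ^ (p.a - p.b) - θ₂ p m * ratio₂ p W

variable {M B e10 e20 : ℝ}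

/-- `θ₉` and `e20` cancel in the product, so `M` and `B` disappear from the denominator of the
explicit bounds. This is what allows enlarging `M` to enlarge the bounds. -/
lemma two_C₁_C₄_C₅ (h9 : θ₉ p M B m ≠ 0) (h20 : e20 ≠ 0) :
    2 * C₁ p e20 m * C₄ p W M B e20 * C₅ p M B e10 m = θ₂ p m * ratio₂ p W * e10 := by
  unfold C₁ C₄ C₅ ratio₂
  field_simp
  ring

lemma denom_mul (h9 : θ₉ p M B m ≠ 0) (h20 : e20 ≠ 0) :
    C₃ p e10 * p.Γ ^ (p.a - p.b) - 2 * C₁ p e20 m * C₄ p W M B e20 * C₅ p M B e10 m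
      = denom p W * e10 := by
  rw [two_C₁_C₄_C₅ h9 h20, C₃, denom]; ring

lemma e10_mul_n₁ (h9 : θ₉ p M B m ≠ 0) (h10 : e10 ≠ 0) (h20 : e20 ≠ 0) :
    e10 * n₁ p W M B e10 e20 = 2 * θ₃ p M m * p.γ ^ 2 / denom p W := by
  rw [n₁, denom_mul h9 h20, C₂]
  rcases eq_or_ne (denom p W) 0 with h | h
  · simp [h]
  · field_simp

lemma eHat₁_eq (h9 : θ₉ p M B m ≠ 0) (h10 : e10 ≠ 0) (h20 : e20 ≠ 0) :
    eHat₁ p W M B e10 e20 = p.Γ ^ (p.a - p.b) * (2 * θ₃ p M m * p.γ ^ 2 / denom p W) := by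
  rw [eHat₁, mul_assoc, e10_mul_n₁ h9 h10 h20]

lemma eHat₂_eq (hΓ : 0 < p.Γ) (h9 : θ₉ p M B m ≠ 0) (h10 : e10 ≠ 0) (h20 : e20 ≠ 0) :
    eHat₂ p W M B e10 e20 = ratio₂ p W * (2 * θ₃ p M m * p.γ ^ 2 / denom p W) := by
  rw [← e10_mul_n₁ h9 h10 h20, eHat₂, n₂]
  have := (Real.rpow_pos_of_pos hΓ (2 * p.a)).ne'
  generalize n₁ p W M B e10 e20 = N
  unfold C₄ C₅ ratio₂
  field_simp
  ring

lemma eHat₃_eq (hΓ : 0 < p.Γ) (h9 : θ₉ p M B m ≠ 0) (h10 : e10 ≠ 0) (h20 : e20 ≠ 0) :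
    eHat₃ p W M B e10 e20
      = 3 * θ₇ p m / θ₆ p W * (2 * θ₃ p M m * p.γ ^ 2 / denom p W) := by
  rw [← e10_mul_n₁ h9 h10 h20, eHat₃, n₃]
  have := (Real.rpow_pos_of_pos hΓ (2 * p.a)).ne'
  generalize n₁ p W M B e10 e20 = N
  unfold C₅
  field_simp

/-- The strict lower bound on Γ is this positivity after raising to the power a - b and multiplying
by C₃ > 0. -/
lemma BoundCond.denom_pos (hD : D.Assumptions p) (hp : p.Valid W) (hW : IsWeight G W)
    (h9 : 0 < θ₉ p M B m) (h : BoundCond p W M B e10 e20) : 0 < denom p W := by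
  have hθ1 := θ₁_pos hD
  have hθ2 := θ₂_pos hD hp hW.pos
  have hθ4 := hW.θ₄_pos
  have hθ5 := hW.θ₅_pos h.rho_pos
  have hθ6 := θ₆_pos hD hp hW
  have hθ7 := θ₇_pos hD hp hW.pos
  have hγ := hp.γ_pos
  have h10 := h.e10_pos
  have h1 : 0 < p.γ * p.lam * θ₁ p - 1 := by
    have := h.γlam
    rw [div_lt_iff₀ hθ1] at this
    linarith
  have hC3 : 0 < C₃ p e10 := mul_pos h1 h10
  have h2 := h.Γ_gt₂
  rw [two_C₁_C₄_C₅ h9.ne' h.e20_pos.ne', one_div] at h2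
  have hr : 0 < ratio₂ p W := by unfold ratio₂; positivity
  have h3 := (Real.rpow_inv_lt_iff_of_pos (by positivity) hp.Γ_pos.le
    (by have := hp.b_lt_a; linarith)).1 h2
  rw [div_lt_iff₀ hC3] at h3
  have h4 : 0 < denom p W * e10 := by
    rw [denom, sub_mul]
    unfold C₃ at h3
    linarith
  exact pos_of_mul_pos_left h4 h10.le

end Theta

/-- Order bounds imply the explicit bounds once `θ₃` is large. -/
lemma Run.explicitBounds_of_orderBounds {m n d : ℕ} {D : Problem m n d} {p : Par}
    {W : Matrix (Fin m) (Fin m) ℝ} {G : SimpleGraph (Fin m)} {Ω : Type*} [MeasurableSpace Ω]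
    {P : Measure Ω} (r : Run D P) (hD : D.Assumptions p) (hp : p.Valid W) (hW : IsWeight G W)
    {c M B : ℝ} (hc : 0 < c) (h9 : 0 < θ₉ p M B m)
    (h3 : |denom p W| * c / (2 * p.γ ^ 2) * (1 + 1 / ratio₂ p W + θ₆ p W / (3 * θ₇ p m))
      ≤ θ₃ p M m) (h3pos : 0 < θ₃ p M m) (hr : r.OrderBounds p W c) :
    r.ExplicitBounds p W M B := by
  intro h
  have hden := h.denom_pos hD hp hW h9
  have h10 := h.e10_pos
  have h20 := h.e20_pos
  have hθ4 := hW.θ₄_pos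
  have hθ5 := hW.θ₅_pos h.rho_pos
  have hθ6 := θ₆_pos hD hp hW
  have hθ7 := θ₇_pos hD hp hW.pos
  have hγ := hp.γ_pos
  have hΓ := hp.Γ_pos
  have ha2 := Real.rpow_pos_of_pos hΓ (2 * p.a)
  have hrat : 0 < ratio₂ p W := by unfold ratio₂; positivity
  -- For Γ = 1 the first lower bound on Γ gives μ_f γ λ ≤ 2, while the condition γλ > 1/θ₁ gives the
  -- strict reverse. So λ_{-1} is meaningful here.
  have hΓ1 : 1 < p.Γ := by
    rcases hp.one_le_Γ.eq_or_lt with h0 | h0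
    · have h1 := hp.rate_le hD.μf_pos
      rw [← h0, Real.one_rpow] at h1
      have h2 := h.γlam
      rw [div_lt_iff₀ (θ₁_pos hD), θ₁] at h2
      linarith
    · exact h0
  have hn1 : 0 < n₁ p W M B (r.e1 p W 0) (r.e2 p W 0) := by
    rw [n₁, denom_mul h9.ne' h20.ne']
    have : 0 < C₂ p M m := by unfold C₂; positivity
    positivity
  have hC5 : 0 < C₅ p M B (r.e1 p W 0) m := by unfold C₅; positivity
  have hC4 : 0 < C₄ p W M B (r.e2 p W 0) := by unfold C₄; positivity
  -- The three bounds are N times Γ^(a-b), `ratio₂` and 3θ₇/θ₆ respectively. The first factor is at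
  -- least 1; the three summands in `hNc` make each product at least c.
  set N := 2 * θ₃ p M m * p.γ ^ 2 / denom p W with hN
  have hN0 : 0 < N := by positivity
  have hNc : c * (1 + 1 / ratio₂ p W + θ₆ p W / (3 * θ₇ p m)) ≤ N := by
    rw [abs_of_pos hden] at h3
    rw [hN, le_div_iff₀ hden]
    have := mul_le_mul_of_nonneg_right h3 (show 0 ≤ 2 * p.γ ^ 2 by positivity)
    calc _ = denom p W * c / (2 * p.γ ^ 2) * (1 + 1 / ratio₂ p W + θ₆ p W / (3 * θ₇ p m))
          * (2 * p.γ ^ 2) := by field_simp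
      _ ≤ θ₃ p M m * (2 * p.γ ^ 2) := this
      _ = _ := by ring
  have z1 : 0 < 1 / ratio₂ p W := by positivity
  have z2 : 0 < θ₆ p W / (3 * θ₇ p m) := by positivity
  have b1 : c ≤ eHat₁ p W M B (r.e1 p W 0) (r.e2 p W 0) := by
    rw [eHat₁_eq h9.ne' h10.ne' h20.ne', ← hN]
    have h1 : c ≤ N := (le_mul_of_one_le_right hc.le (by linarith)).trans hNc
    exact h1.trans (le_mul_of_one_le_left hN0.le (Real.one_le_rpow hp.one_le_Γ
      (by have := hp.b_lt_a; linarith)))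
  have b2 : c ≤ eHat₂ p W M B (r.e1 p W 0) (r.e2 p W 0) := by
    rw [eHat₂_eq hΓ h9.ne' h10.ne' h20.ne', ← hN]
    have h1 : c * (1 / ratio₂ p W) ≤ N :=
      (mul_le_mul_of_nonneg_left (by linarith) hc.le).trans hNc
    rw [mul_one_div, div_le_iff₀ hrat] at h1
    linarith
  have b3 : c ≤ eHat₃ p W M B (r.e1 p W 0) (r.e2 p W 0) := by
    rw [eHat₃_eq hΓ h9.ne' h10.ne' h20.ne', ← hN]
    have h1 : c * (θ₆ p W / (3 * θ₇ p m)) ≤ N :=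
      (mul_le_mul_of_nonneg_left (by linarith) hc.le).trans hNc
    rw [← mul_div_assoc, div_le_iff₀ (by positivity)] at h1
    rw [div_mul_eq_mul_div, le_div_iff₀ hθ6]
    linarith
  refine ⟨hn1, ?_, ?_, fun k => ⟨?_, ?_, ?_⟩⟩
  · unfold n₂; positivity
  · unfold n₃; positivity
  · exact ((hr k).1 fun _ => hΓ1).trans
      (div_le_div_of_nonneg_right b1 (Real.rpow_pos_of_pos (hp.add_Γ_pos k) _).le)
  · exact (hr k).2.1.trans
      (div_le_div_of_nonneg_right b2 (Real.rpow_pos_of_pos (hp.add_Γ_pos k) _).le)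
  · exact (hr k).2.2.trans b3

/-- Convergence in mean square to the optimal solution. -/
lemma Run.tendsto_of_orderBounds {m n d : ℕ} {D : Problem m n d} {p : Par}
    {W : Matrix (Fin m) (Fin m) ℝ} {Ω : Type*} [MeasurableSpace Ω]
    {P : Measure Ω} [IsProbabilityMeasure P] (r : Run D P) (hD : D.Assumptions p)
    (hp : p.Valid W) {c : ℝ} (hr : r.OrderBounds p W c) {xs : Vec n}
    (hxs : Tendsto D.tik (𝓝[>] 0) (𝓝 xs)) :
    Tendsto (fun k : ℕ => ∫ ω, ‖avg (r.x p W (k + 1) ω) - xs‖ ^ 2 ∂P) atTop (𝓝 0) := by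
  have hreg : Tendsto (fun k : ℕ => p.reg k) atTop (𝓝[>] 0) := by
    refine tendsto_nhdsWithin_iff.2 ⟨?_, Eventually.of_forall fun k => hp.reg_pos k⟩
    have h := (tendsto_rpow_neg_nat_add p.Γ hp.b_pos).const_mul p.lam
    rw [mul_zero] at h
    exact h.congr fun k => (hp.reg_eq k).symm
  have htik : Tendsto (fun k : ℕ => 2 * ‖D.tik (p.reg k) - xs‖ ^ 2) atTop (𝓝 0) := by
    have h := (((hxs.comp hreg).sub_const xs).norm.pow 2).const_mul 2
    simpa using h
  have he1 : Tendsto (fun k : ℕ => 2 * r.e1 p W (k + 1)) atTop (𝓝 0) := by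
    have h := ((tendsto_rpow_neg_nat_add p.Γ (s := p.a - p.b)
      (by have := hp.b_lt_a; linarith)).const_mul (2 * c)).comp (tendsto_add_atTop_nat 1)
    rw [mul_zero] at h
    refine squeeze_zero (fun k => mul_nonneg zero_le_two (r.e1_nonneg _)) (fun k => ?_) h
    have h1 := (hr (k + 1)).1 fun h => by omega
    rw [div_eq_mul_inv, ← Real.rpow_neg (hp.add_Γ_pos _).le] at h1
    simp only [Function.comp_apply]
    linarith
  have hsum := he1.add htik
  rw [add_zero] at hsum
  refine squeeze_zero (fun k => integral_nonneg fun _ => sq_nonneg _) (fun k => ?_) hsum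
  have hi := (r.memLp_avg_sub hD hp (k + 1) (D.tik (p.reg k))).integrable_norm_pow two_ne_zero
  rw [r.e1_succ]
  refine (integral_mono ((r.memLp_avg_sub hD hp (k + 1) xs).integrable_norm_pow two_ne_zero)
    ((hi.const_mul 2).add (integrable_const (2 * ‖D.tik (p.reg k) - xs‖ ^ 2)))
    fun ω => ?_).trans_eq ?_
  · have h := sq_norm_add_le one_pos (avg (r.x p W (k + 1) ω) - D.tik (p.reg k))
      (D.tik (p.reg k) - xs)
    rw [sub_add_sub_cancel] at h
    norm_num at h
    simp only [Pi.add_apply]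
    linarith
  · rw [integral_add' (hi.const_mul 2) (integrable_const _), integral_const_mul]
    simp

end IRDSGT

end

/-! ### Choice of the thresholds and assembly. -/

theorem theorem2 {m n d : ℕ} (D : IRDSGT.Problem m n d) (p : IRDSGT.Par)
    (hD : D.Assumptions p) (hsol : D.sol.Nonempty)
    (G : SimpleGraph (Fin m)) (W : Matrix (Fin m) (Fin m) ℝ) (hW : IRDSGT.IsWeight G W)
    (hp : p.Valid W) :
    -- the Tikhonov trajectory and the optimal solution are well defined
    (∀ l : ℝ, 0 < l → D.regSol l = {D.tik l}) ∧
    ∃ xs : IRDSGT.Vec n, D.optSet = {xs} ∧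
      -- the constants depend on the run only through a bound `R` on the initial second moment
      ∀ R : ℝ, ∃ M₀ > 0, ∃ B₀ > 0, ∃ c > 0, ∀ M ≥ M₀, ∀ B ≥ B₀,
        (∀ k : ℕ, 1 ≤ k → ‖D.tik (p.reg k) - D.tik (p.reg ((k : ℝ) - 1))‖
          ≤ M / p.μf * p.Lam ((k : ℝ) - 1)) ∧
        (∀ k : ℕ, p.LF * (√(m : ℝ) * ‖D.tik (p.reg k) - xs‖) ≤ B) ∧
        (0 < IRDSGT.θ₁ p ∧ 0 < IRDSGT.θ₂ p m ∧ 0 < IRDSGT.θ₃ p M m ∧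
          0 < IRDSGT.θ₄ W ∧ IRDSGT.θ₄ W < 1 ∧
          (0 < IRDSGT.rho W → 0 < IRDSGT.θ₅ W) ∧
          0 < IRDSGT.θ₆ p W ∧ (0 < IRDSGT.rho W → IRDSGT.θ₆ p W < 1) ∧
          0 < IRDSGT.θ₇ p m ∧ 0 < IRDSGT.θ₈ p W ∧ 0 < IRDSGT.θ₉ p M B m) ∧
        ∀ (Ω : Type*) [MeasurableSpace Ω] (P : Measure Ω) [IsProbabilityMeasure P]
          (r : IRDSGT.Run D P), ∑ i, ∫ ω, ‖r.x0 i ω‖ ^ 2 ∂P ≤ R →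
          -- all expectations below are finite
          (∀ k i, MemLp (fun ω => r.x p W k ω i) 2 P ∧ MemLp (fun ω => r.y p W k ω i) 2 P) ∧
          -- (a)
          r.Recursions p W M B ∧
          -- (b)
          r.ExplicitBounds p W M B ∧ r.OrderBounds p W c ∧
          -- (c)
          Tendsto (fun k : ℕ => ∫ ω, ‖IRDSGT.avg (r.x p W (k + 1) ω) - xs‖ ^ 2 ∂P)
            atTop (𝓝 0) := by
  open IRDSGT in
  refine ⟨fun l hl => hD.regSol_eq hl, ?_⟩
  obtain ⟨xs, hopt, -, hlim⟩ := hD.exists_optSet_eq hsol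
  obtain ⟨T, hT0, hT⟩ := hD.exists_norm_tik_le hsol
  refine ⟨xs, hopt, fun R => ?_⟩
  obtain ⟨c, hc, C', hC', hrun⟩ := exists_orderBounds hD hp hW hT R
  have hμ := hD.μf_pos
  have hLF := hD.LF_pos
  have hΓ := hp.Γ_pos
  have hco := θ₃Coeff_pos hD hp
  have hθ6 := θ₆_pos hD hp hW
  have hθ7 := θ₇_pos hD hp hW.pos
  -- The size of `θ₃` that puts the explicit bounds above c. The absolute value is needed because
  -- the threshold is fixed before `denom` is known to be positive.
  set X := |denom p W| * c / (2 * p.γ ^ 2) * (1 + 1 / ratio₂ p W + θ₆ p W / (3 * θ₇ p m)) with hX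
  -- The 1 in each threshold makes M² ≥ M and B² ≥ B. The other terms cover the Tikhonov drift and
  -- size of `θ₃` for `M`, and the distance from the Tikhonov path to the optimum and the bound c ≤
  -- θ₉ for `B`.
  refine ⟨1 + T + (|X| + C') / θ₃Coeff p, by positivity,
    1 + p.LF * (√(m : ℝ) * (T + ‖xs‖)) + c * p.Γ ^ 2, by positivity, c, hc, fun M hM B hB => ?_⟩
  have hXC : 0 < (|X| + C') / θ₃Coeff p := by positivity
  have hM1 : 1 ≤ M := by linarith
  have hMT : T ≤ M := by linarith
  have h3 : |X| + C' ≤ θ₃ p M m := by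
    refine le_trans ?_ (θ₃Coeff_mul_le hp M)
    have h1 : (|X| + C') / θ₃Coeff p ≤ M ^ 2 := by nlinarith
    rw [div_le_iff₀ hco] at h1
    linarith
  have h3pos : 0 < θ₃ p M m := lt_of_lt_of_le (by positivity) h3
  have hB0 : 0 ≤ p.LF * (√(m : ℝ) * (T + ‖xs‖)) := by positivity
  have hcΓ : 0 < c * p.Γ ^ 2 := by positivity
  have h9c : c ≤ θ₉ p M B m := by
    refine le_trans ?_ (le_θ₉ hp M B)
    have hB1 : 1 ≤ B := by linarith
    have h1 : c * p.Γ ^ 2 ≤ B ^ 2 := by nlinarith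
    have h2 : c ≤ 1 / p.Γ ^ 2 * B ^ 2 := by
      rw [one_div_mul_eq_div, le_div_iff₀ (by positivity)]; exact h1
    linarith
  have h9 : 0 < θ₉ p M B m := hc.trans_le h9c
  have hLam : ∀ t, 0 ≤ p.Lam t := fun t => abs_nonneg _
  refine ⟨fun k hk => ?_, fun k => ?_, ⟨θ₁_pos hD, θ₂_pos hD hp hW.pos, h3pos, hW.θ₄_pos,
    θ₄_lt_one W, hW.θ₅_pos, hθ6, θ₆_lt_one hp, hθ7, θ₈_pos hD hp, h9⟩, ?_⟩
  · refine (hD.norm_tik_drift_le hp hT hk).trans (mul_le_mul_of_nonneg_right ?_ (hLam _))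
    gcongr
  · have h1 : ‖D.tik (p.reg k) - xs‖ ≤ T + ‖xs‖ :=
      (norm_sub_le _ _).trans (by linarith [(hT _ (hp.reg_pos k)).1])
    have h2 : p.LF * (√(m : ℝ) * ‖D.tik (p.reg k) - xs‖)
        ≤ p.LF * (√(m : ℝ) * (T + ‖xs‖)) := by gcongr
    linarith
  · intro Ω _ P _ r hR
    obtain ⟨hord, hrec1⟩ := hrun Ω P r hR
    refine ⟨fun k i => ⟨r.memLp_x hD hp k i, r.memLp_y hD hp k i⟩, fun k => ⟨fun hk => ?_,
      r.e2_succ_le hD hp hW k, fun _ => ?_⟩,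
      r.explicitBounds_of_orderBounds hD hp hW hc h9 ?_ h3pos hord, hord,
      r.tendsto_of_orderBounds hD hp hord hlim⟩
    · have h1 := hrec1 k hk
      have h2 := mul_nonneg (θ₂_pos hD hp hW.pos).le (r.e2_nonneg (p := p) (W := W) k)
      have h4 : C' * p.step k ^ 2 ≤ θ₃ p M m * p.step k ^ 2 :=
        mul_le_mul_of_nonneg_right (by linarith [abs_nonneg X]) (sq_nonneg _)
      linarith
    -- The next tracking error is at most c ≤ θ₉, and all other terms on the right are nonnegative.
    · have h1 := (hord (k + 1)).2.2
      have h2 := mul_nonneg (sub_nonneg.2 (θ₆_le_one hp)) (r.e3_nonneg (p := p) (W := W) k)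
      have h4 := mul_nonneg hθ7.le (r.e1_nonneg (p := p) (W := W) k)
      have h5 := mul_nonneg (θ₈_pos hD hp).le (r.e2_nonneg (p := p) (W := W) k)
      linarith
    · linarith [le_abs_self X]
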